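/- Setting. Consider an open quantum harmonic oscillator with system variables $X=(X_1,\dots,X_n)^{\mathrm T}$ satisfying the Weyl canonical commutation relations $[X,X^{\mathrm T}]=2i\Theta$, where $\Theta$ is a nonsingular real antisymmetric matrix, and governed by the linear quantum stochastic differential equation $\mathrm dX=AX\,\mathrm dt+B\,\mathrm dW$. Here $W$ is a vector of $m=2d$ quantum Wiener processes on a symmetric Fock space with $\mathrm dW\,\mathrm dW^{\mathrm T}=(I+iJ)\,\mathrm dt$, $J=\begin{bmatrix}0&I\\-I&0\end{bmatrix}$, and $A=2\Theta(R+M^{\mathrm T}JM)$, $B=2\Theta M^{\mathrm T}$ for a real symmetric matrix $R$ and a real matrix $M$. For $t>0$, let $\mathfrak H_t=\mathfrak H_0\otimes\mathfrak F_t$, where $\mathfrak H_0$ is the complex separable Hilbert space of the initial system variables and $\mathfrak F_t$ is the Fock space of the fields over $[0,t]$. Let $\widehat\rho_t=\rho_0\otimes\upsilon_t$ be the nominal state, where $\rho_0$ is a density operator on $\mathfrak H_0$ and $\upsilon_t$ is the vacuum state on $\mathfrak F_t$. Let $Q$ be a real positive semi-definite symmetric matrix, and let $$\varphi(t)=\int_0^t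 X(s)^{\mathrm T}QX(s)\,\mathrm ds,$$ understood as the positive self-adjoint operator on $\mathfrak H_t$ associated with the closed quadratic form $v\mapsto\int_0^t\sum_k\|\zeta_k(s)v\|^2\,\mathrm ds$, $\zeta=\sqrt Q\,X$. Let $\widehat\Xi_\theta(t)=\mathrm{Tr}(\widehat\rho_t\,e^{\theta\varphi(t)})\in[1,\infty]$ be the nominal quadratic-exponential functional, and, for $\varepsilon\ge 0$, let $$\mathfrak R_{t,\varepsilon}=\{\rho_t:\ \rho_t\text{ is a density operator on }\mathfrak H_t\text{ with }\mathbf D(\rho_t\|\widehat\rho_t)\le\varepsilon t\},$$ where $\mathbf D(\rho\|\sigma)=\mathrm{Tr}(\rho(\ln\rho-\ln\sigma))\in[0,\infty]$ is the quantum relative entropy (infinite unless $\mathrm{supp}\,\rho\subset\mathrm{supp}\,\sigma$). Theorem. For every $\varepsilon\ge 0$, the growth rate of the worst-case value of the quadratic cost $\mathbf E\varphi(t)=\mathrm{Tr}(\rho_t\varphi(t))$ satisfies $$\limsup_{t\to+\infty}\Big(\frac1t\sup_{\rho_t\in\mathfrak R_{t,\varepsilon}}\mathbf E\varphi(t)\Big)\le\inf_{\theta>0}\frac{\varepsilon+\gamma(\theta)}{\theta},\qquad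 \gamma(\theta):=\limsup_{t\to+\infty}\Big(\frac1t\ln\widehat\Xi_\theta(t)\Big),$$ where all quantities may take the value $+\infty$. -/

import Mathlib

open scoped ENNReal TensorProduct MatrixOrder ComplexOrder
open MeasureTheory

noncomputable section

namespace QuantumOscillator

/-! ### Density operators and quantum relative entropy on a Hilbert space -/

section States

variable {H : Type*} [NormedAddCommGroup H] [InnerProductSpace ℂ H] [CompleteSpace H]

/-- Index set of a fixed orthonormal basis of `H`. -/
def basisIndex (H : Type*) [NormedAddCommGroup H] [InnerProductSpace ℂ H] [CompleteSpace H] :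
    Set H :=
  (exists_hilbertBasis ℂ H).choose

/-- A fixed orthonormal basis of `H`, used to evaluate traces (which do not depend on it). -/
def basis (H : Type*) [NormedAddCommGroup H] [InnerProductSpace ℂ H] [CompleteSpace H] :
    HilbertBasis (basisIndex H) ℂ H :=
  (exists_hilbertBasis ℂ H).choose_spec.choose

/-- The mean value `Tr (√ρ ξ √ρ) = ∑ᵢ q (√ρ eᵢ) ∈ [0, ∞]` of a positive self-adjoint, possibly
unbounded, operator `ξ` given by its closed quadratic form `q v = ‖√ξ v‖²`
(with `q v = ∞` off the form domain). -/
def mean (ρ : H →L[ℂ] H) (q : H → ℝ≥0∞) : ℝ≥0∞ :=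
  ∑' i, q (CFC.sqrt ρ (basis H i))

/-- Density operators: positive operators of unit trace. -/
def IsDensity (ρ : H →L[ℂ] H) : Prop :=
  ρ.IsPositive ∧ mean ρ (fun v => ‖v‖ₑ ^ 2) = 1

/-- The orthogonal projection onto `ker (ρ - p)`. -/
def eigenProj (ρ : H →L[ℂ] H) (p : ℝ) : H →L[ℂ] H :=
  (ρ - (p : ℂ) • ContinuousLinearMap.id ℂ H).ker.starProjection

/-- `Tr (P Q)` for orthogonal projections `P` and `Q`. -/
def overlap (P Q : H →L[ℂ] H) : ℝ≥0∞ :=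
  ∑' i, ‖Q (P (basis H i))‖ₑ ^ 2

/-- `p ln p - p ln q + q - p` for `p, q ≥ 0`, equal to `∞` if `q = 0 < p`. -/
def entropyTerm (p q : ℝ) : ℝ≥0∞ :=
  if q = 0 then (if p = 0 then 0 else ⊤)
  else ENNReal.ofReal (p * Real.log p - p * Real.log q + q - p)

/-- The quantum relative entropy `D(ρ‖σ) = Tr (ρ (ln ρ - ln σ)) ∈ [0, ∞]`.  In terms of the spectral
decompositions `ρ = ∑ p P_p`, `σ = ∑ q Q_q` it is
`∑_{p,q} (p ln p - p ln q + q - p) Tr (P_p Q_q)`, where the terms `q - p` add up to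
`Tr σ - Tr ρ = 0` and make all the summands nonnegative.  It is infinite unless
`supp ρ ⊆ supp σ`. -/
def relEntropy (ρ σ : H →L[ℂ] H) : ℝ≥0∞ :=
  ∑' pq : ℝ × ℝ, entropyTerm pq.1 pq.2 * overlap (eigenProj ρ pq.1) (eigenProj σ pq.2)

end States

/-! ### The symmetric Fock space -/

section Fock

theorem posSemidef_inner {ι E : Type*} [NormedAddCommGroup E] [InnerProductSpace ℂ E] (v : ι → E) :
    (Matrix.of fun f g : ι => inner ℂ (v f) (v g) : Matrix ι ι ℂ).PosSemidef := by
  refine ⟨?_, fun x => ?_⟩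
  · ext f g
    simp [Matrix.conjTranspose_apply]
  · have : (x.sum fun f z => x.sum fun g w =>
        star z * (Matrix.of fun f g : ι => inner ℂ (v f) (v g) : Matrix ι ι ℂ) f g * w)
        = inner ℂ (x.sum fun f z => z • v f) (x.sum fun g w => w • v g) := by
      simp only [Finsupp.sum]
      rw [sum_inner]
      refine Finset.sum_congr rfl fun f _ => ?_
      rw [inner_sum]
      refine Finset.sum_congr rfl fun g _ => ?_
      simp only [inner_smul_left, inner_smul_right, Matrix.of_apply, RCLike.star_def]
      ring
    have h : (0 : ℂ) ≤ ((‖x.sum fun f z => z • v f‖ ^ 2 : ℝ) : ℂ) :=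
      Complex.zero_le_real.2 (by positivity)
    rw [this, inner_self_eq_norm_sq_to_K]
    simp only [Complex.ofReal_pow] at h
    exact h

variable {K : Type*} [NormedAddCommGroup K] [InnerProductSpace ℂ K]

/-- The kernel `exp ⟪f, g⟫` of the symmetric Fock space over `K`. -/
def fockKernel (K : Type*) [NormedAddCommGroup K] [InnerProductSpace ℂ K] :
    Matrix K K (ℂ →L[ℂ] ℂ) :=
  Matrix.of fun f g => Complex.exp (inner ℂ f g) • ContinuousLinearMap.id ℂ ℂ

theorem posSemidef_inner_pow (m : ℕ) :
    (Matrix.of fun f g : K => (inner ℂ f g) ^ m : Matrix K K ℂ).PosSemidef := by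
  induction m with
  | zero => simpa using posSemidef_inner (fun _ : K => (1 : ℂ))
  | succ m ih =>
    have h := ih.hadamard (posSemidef_inner (fun f : K => f))
    have h2 : (Matrix.of fun f g : K => (inner ℂ f g) ^ (m + 1) : Matrix K K ℂ)
        = (Matrix.of fun f g : K => (inner ℂ f g) ^ m : Matrix K K ℂ).hadamard
          (Matrix.of fun f g : K => inner ℂ f g) := by
      ext f g
      simp [Matrix.hadamard_apply, pow_succ]
    rw [h2]
    exact h

theorem expKernel_nonneg (x : K →₀ ℂ) :
    0 ≤ (x.sum fun f z => x.sum fun g w =>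
      star z * Complex.exp (inner ℂ f g) * w).re := by
  have h : HasSum (fun m : ℕ => x.sum fun f z => x.sum fun g w =>
      star z * (((m.factorial : ℂ))⁻¹ * (inner ℂ f g) ^ m) * w)
      (x.sum fun f z => x.sum fun g w => star z * Complex.exp (inner ℂ f g) * w) := by
    simp only [Finsupp.sum]
    refine hasSum_sum fun f _ => hasSum_sum fun g _ => ?_
    refine (HasSum.mul_left _ ?_).mul_right _
    have := NormedSpace.expSeries_div_hasSum_exp (inner ℂ f g : ℂ)
    rw [← Complex.exp_eq_exp_ℂ] at this
    simpa [div_eq_inv_mul] using this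
  refine (Complex.hasSum_re h).nonneg fun m => ?_
  have h1 := (posSemidef_inner_pow (K := K) m).2 x
  have h2 : (x.sum fun f z => x.sum fun g w =>
      star z * (((m.factorial : ℂ))⁻¹ * (inner ℂ f g) ^ m) * w)
      = ((m.factorial : ℝ)⁻¹ : ℝ) * (x.sum fun f z => x.sum fun g w =>
        star z * (Matrix.of fun f g : K => (inner ℂ f g) ^ m : Matrix K K ℂ) f g * w) := by
    simp only [Finsupp.sum, Finset.mul_sum, Matrix.of_apply]
    refine Finset.sum_congr rfl fun f _ => Finset.sum_congr rfl fun g _ => ?_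
    push_cast
    ring
  rw [h2, Complex.re_ofReal_mul]
  exact mul_nonneg (by positivity) (Complex.nonneg_iff.1 h1).1

instance fockKernel_posSemidef : Fact (fockKernel K).PosSemidef := by
  refine ⟨((RKHS.posSemidef_tfae (K := fockKernel K)).out 0 2 rfl rfl).mpr ⟨?_, fun x => ?_⟩⟩
  · ext f g
    rw [Matrix.conjTranspose_apply, ContinuousLinearMap.star_eq_adjoint]
    refine ext_inner_right ℂ fun w => ?_
    rw [ContinuousLinearMap.adjoint_inner_left]
    simp [fockKernel, ← Complex.exp_conj]
    try ring
  · convert expKernel_nonneg x using 2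
    simp only [Finsupp.sum]
    rw [RCLike.re_eq_complex_re]
    congr 1
    refine Finset.sum_congr rfl fun f _ => Finset.sum_congr rfl fun g _ => ?_
    simp [fockKernel, ← Complex.exp_conj]
    ring

/-- The symmetric Fock space over `K`, as the Hilbert space with reproducing kernel
`exp ⟪f, g⟫`. -/
abbrev Fock (K : Type*) [NormedAddCommGroup K] [InnerProductSpace ℂ K] : Type _ :=
  RKHS.OfKernel (fockKernel K)

/-- The exponential vector `e(f)`. -/
def expVec (f : K) : Fock K := RKHS.kerFun (Fock K) f (1 : ℂ)

theorem inner_expVec (f g : K) :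
    inner ℂ (expVec f) (expVec g) = Complex.exp (inner ℂ f g) := by
  rw [expVec, expVec, ← RKHS.kernel_inner, RKHS.OfKernel.kernel_ofKernel]
  simp [fockKernel, ← Complex.exp_conj]

/-- The linear extension of `f ↦ e(f)` to formal linear combinations. -/
def expComb (K : Type*) [NormedAddCommGroup K] [InnerProductSpace ℂ K] : (K →₀ ℂ) →ₗ[ℂ] Fock K :=
  Finsupp.linearCombination ℂ expVec

theorem expComb_denseRange : DenseRange (expComb K) := by
  have h := RKHS.kerFun_dense (H := Fock K)
  have h1 : Submodule.span ℂ {y | ∃ (x : K) (v : ℂ), RKHS.kerFun (Fock K) x v = y}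
      ≤ LinearMap.range (expComb K) := by
    rw [Submodule.span_le]
    rintro _ ⟨f, v, rfl⟩
    refine ⟨Finsupp.single f v, ?_⟩
    rw [expComb, Finsupp.linearCombination_single, expVec, ← map_smul]
    simp
  have h2 := Submodule.topologicalClosure_mono h1
  rw [h, top_le_iff] at h2
  exact (Submodule.dense_iff_topologicalClosure_eq_top).2 h2

/-- The vector `𝒲(h) e(f) = exp (-‖h‖² / 2 - ⟪h, f⟫) e(f + h)`. -/
def weylVec (h f : K) : Fock K :=
  Complex.exp (-(‖h‖ : ℂ) ^ 2 / 2 - inner ℂ h f) • expVec (f + h)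

theorem inner_weylVec (h f g : K) :
    inner ℂ (weylVec h f) (weylVec h g) = inner ℂ (expVec f) (expVec g) := by
  rw [weylVec, weylVec, inner_smul_left, inner_smul_right, inner_expVec, inner_expVec,
    ← Complex.exp_conj, ← Complex.exp_add, ← Complex.exp_add]
  congr 1
  simp only [inner_add_left, inner_add_right, map_sub, map_neg, map_div₀, map_pow,
    Complex.conj_ofReal, inner_conj_symm, inner_self_eq_norm_sq_to_K, Complex.coe_algebraMap,
    map_ofNat]
  ring

/-- The linear extension of `f ↦ 𝒲(h) e(f)` to formal linear combinations. -/
def weylComb (h : K) : (K →₀ ℂ) →ₗ[ℂ] Fock K :=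
  Finsupp.linearCombination ℂ (weylVec h)

theorem norm_weylComb (h : K) (x : K →₀ ℂ) : ‖weylComb h x‖ = ‖expComb K x‖ := by
  have : inner ℂ (weylComb h x) (weylComb h x) = inner ℂ (expComb K x) (expComb K x) := by
    simp only [weylComb, expComb, Finsupp.linearCombination_apply, Finsupp.sum, sum_inner,
      inner_sum, inner_smul_left, inner_smul_right, inner_weylVec]
  rw [inner_self_eq_norm_sq_to_K, inner_self_eq_norm_sq_to_K] at this
  have h2 : ‖weylComb h x‖ ^ 2 = ‖expComb K x‖ ^ 2 := by exact_mod_cast this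
  exact (sq_eq_sq₀ (norm_nonneg _) (norm_nonneg _)).1 h2

theorem weylComb_bound (h : K) : ∃ C : ℝ, ∀ x, ‖weylComb h x‖ ≤ C * ‖expComb K x‖ :=
  ⟨1, fun x => by rw [norm_weylComb, one_mul]⟩

/-- The Weyl operator `𝒲(h) = exp (a†(h) - a(h))` on the Fock space: the isometry with
`𝒲(h) e(f) = exp (-‖h‖² / 2 - ⟪h, f⟫) e(f + h)` for all `f`. -/
def fockWeyl (h : K) : Fock K →ₗᵢ[ℂ] Fock K where
  toLinearMap := ((weylComb h).extendOfNorm (expComb K)).toLinearMap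
  norm_map' := by
    refine expComb_denseRange.induction ?_ (isClosed_eq (by
      simp only [ContinuousLinearMap.coe_coe]; fun_prop) continuous_norm)
    rintro _ ⟨x, rfl⟩
    rw [ContinuousLinearMap.coe_coe, LinearMap.extendOfNorm_eq expComb_denseRange
      (weylComb_bound h), norm_weylComb]

theorem fockWeyl_expVec (h f : K) : fockWeyl h (expVec f) = weylVec h f := by
  have := LinearMap.extendOfNorm_eq expComb_denseRange (weylComb_bound h) (Finsupp.single f 1)
  simpa [expComb, weylComb, fockWeyl] using this

end Fock

/-! ### The open quantum harmonic oscillator -/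

/-- Parameters of an open quantum harmonic oscillator with `n` system variables and `m = 2 d` field
quadratures: the CCR matrix `Θ`, the energy matrix `R` of the Hamiltonian `Xᵀ R X / 2`, and the
coupling matrix `M` of the system-field coupling operators `M X`. -/
structure OQHO (n d : ℕ) where
  Θ : Matrix (Fin n) (Fin n) ℝ
  antisymm : Θ.transpose = -Θ
  nonsing : IsUnit Θ.det
  R : Matrix (Fin n) (Fin n) ℝ
  symm : R.IsSymm
  M : Matrix (Fin d ⊕ Fin d) (Fin n) ℝ

namespace OQHO

variable {n d : ℕ} (S : OQHO n d)

/-- `J = [0, I; -I, 0]`. -/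
def J (d : ℕ) : Matrix (Fin d ⊕ Fin d) (Fin d ⊕ Fin d) ℝ := Matrix.fromBlocks 0 1 (-1) 0

/-- `A = 2 Θ (R + Mᵀ J M)`. -/
def A : Matrix (Fin n) (Fin n) ℝ := (2 : ℝ) • (S.Θ * (S.R + S.M.transpose * J d * S.M))

/-- `B = 2 Θ Mᵀ`. -/
def B : Matrix (Fin n) (Fin d ⊕ Fin d) ℝ := (2 : ℝ) • (S.Θ * S.M.transpose)

/-- `exp (s Aᵀ) u`, the coefficient vector of `X(0)` in `uᵀ X(s)`. -/
def initCoeff (s : ℝ) (u : Fin n → ℝ) : Fin n → ℝ :=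
  (NormedSpace.exp (s • S.A.transpose)).mulVec u

/-- `w(r) = Bᵀ exp ((s - r) Aᵀ) u`, the coefficient vector of `dW(r)` in `uᵀ X(s)`,
for `0 ≤ r ≤ s`. -/
def noiseCoeff (s : ℝ) (u : Fin n → ℝ) (r : ℝ) : Fin d ⊕ Fin d → ℝ :=
  S.B.transpose.mulVec (S.initCoeff (s - r) u)

/-- The test function `z = (w₁ + i w₂) 1_{[0, s]}` with
`∫₀ˢ wᵀ dW = a†(z) + a(z)`, where `w = (w₁, w₂)` is `noiseCoeff S s u`, and the quantum Wiener
processes are `W = (a + a†, -i (a - a†))`, so that `dW dWᵀ = (I + i J) dt` in the vacuum state. -/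
def noiseFun (s : ℝ) (u : Fin n → ℝ) : ℝ → EuclideanSpace ℂ (Fin d) :=
  (Set.Icc 0 s).indicator fun r => WithLp.toLp 2 fun k =>
    (S.noiseCoeff s u r (Sum.inl k) : ℂ) + Complex.I * (S.noiseCoeff s u r (Sum.inr k) : ℂ)

theorem continuous_initCoeff (u : Fin n → ℝ) : Continuous fun s => S.initCoeff s u := by
  let : NormedRing (Matrix (Fin n) (Fin n) ℝ) := Matrix.linftyOpNormedRing
  let : NormedAlgebra ℝ (Matrix (Fin n) (Fin n) ℝ) := Matrix.linftyOpNormedAlgebra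
  have h : Continuous fun s : ℝ => NormedSpace.exp (s • S.A.transpose) := by
    let : NormedAlgebra ℚ (Matrix (Fin n) (Fin n) ℝ) := NormedAlgebra.restrictScalars ℚ ℝ _
    exact NormedSpace.exp_continuous.comp (continuous_id.smul continuous_const)
  exact h.matrix_mulVec continuous_const

theorem memLp_noiseFun (s : ℝ) (u : Fin n → ℝ) (t : ℝ) :
    MemLp (S.noiseFun s u) 2 (volume.restrict (Set.Icc 0 t)) := by
  have h1 : Continuous fun r => S.noiseCoeff s u r :=
    continuous_const.matrix_mulVec
      ((S.continuous_initCoeff u).comp (continuous_const.sub continuous_id))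
  have h2 : Continuous fun r : ℝ => (WithLp.toLp 2 fun k =>
      (S.noiseCoeff s u r (Sum.inl k) : ℂ) + Complex.I * (S.noiseCoeff s u r (Sum.inr k) : ℂ) :
      EuclideanSpace ℂ (Fin d)) := by
    fun_prop
  refine MemLp.restrict _ ?_
  rw [noiseFun, memLp_indicator_iff_restrict measurableSet_Icc]
  obtain ⟨C, hC⟩ := isCompact_Icc.exists_bound_of_continuousOn (s := Set.Icc 0 s) h2.continuousOn
  refine MemLp.of_bound h2.aestronglyMeasurable C ?_
  exact (ae_restrict_iff' measurableSet_Icc).2 (Filter.Eventually.of_forall hC)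

end OQHO

/-- One-particle space of the fields over the time interval `[0, t]`. -/
abbrev NoiseSpace (d : ℕ) (t : ℝ) : Type :=
  Lp (EuclideanSpace ℂ (Fin d)) 2 (volume.restrict (Set.Icc (0 : ℝ) t))

/-- The system-field space `ℌ_t = ℌ₀ ⊗ 𝔉_t` over the time interval `[0, t]`: the Hilbert space
tensor product of `H₀` with the Fock space. -/
abbrev SysField (H₀ : Type*) [NormedAddCommGroup H₀] [InnerProductSpace ℂ H₀] (d : ℕ) (t : ℝ) :
    Type _ :=
  UniformSpace.Completion (H₀ ⊗[ℂ] Fock (NoiseSpace d t))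

/-- Initial system variables `X₁(0), …, X_n(0)` on `H₀` with the CCR matrix `Θ`, given by their
Weyl operators `W u = exp (i uᵀ X(0))`: a strongly continuous family of unitary operators satisfying
the Weyl CCRs, whose infinitesimal form is `[X(0), X(0)ᵀ] = 2 i Θ`. -/
structure WeylSystem {n : ℕ} (Θ : Matrix (Fin n) (Fin n) ℝ) (H₀ : Type*) [NormedAddCommGroup H₀]
    [InnerProductSpace ℂ H₀] where
  W : (Fin n → ℝ) → H₀ ≃ₗᵢ[ℂ] H₀
  ccr : ∀ u v x, W u (W v x) = Complex.exp (-Complex.I * ((u ⬝ᵥ Θ.mulVec v : ℝ) : ℂ)) • W (u + v) x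
  continuous : ∀ x, Continuous fun u => W u x

section Dynamics

variable {n d : ℕ} {S : OQHO n d} {H₀ : Type*} [NormedAddCommGroup H₀] [InnerProductSpace ℂ H₀]
  [CompleteSpace H₀] (X₀ : WeylSystem S.Θ H₀)

/-- The Weyl operator `exp (i uᵀ X(s))` on `ℌ_t`, for `0 ≤ s ≤ t`, where
`X(s) = exp (s A) X(0) + ∫₀ˢ exp ((s - r) A) B dW(r)` is the solution of the linear QSDE
`dX = A X dt + B dW`. -/
def weylAt (t s : ℝ) (u : Fin n → ℝ) : SysField H₀ d t →L[ℂ] SysField H₀ d t :=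
  (TensorProduct.mapIsometry (X₀.W (S.initCoeff s u)).toLinearIsometry
    (fockWeyl (Complex.I • (S.memLp_noiseFun s u t).toLp))).toContinuousLinearMap.completion

/-- Membership in the domain of `uᵀ X(s)`, the self-adjoint generator of the unitary group
`r ↦ exp (i r uᵀ X(s))`. -/
def InDomain (t s : ℝ) (u : Fin n → ℝ) (v : SysField H₀ d t) : Prop :=
  DifferentiableAt ℝ (fun r : ℝ => weylAt X₀ t s (r • u) v) 0

/-- The action `uᵀ X(s) v = -i ∂_r exp (i r uᵀ X(s)) v |_{r = 0}` on the domain. -/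
def sysVar (t s : ℝ) (u : Fin n → ℝ) (v : SysField H₀ d t) : SysField H₀ d t :=
  -Complex.I • deriv (fun r : ℝ => weylAt X₀ t s (r • u) v) 0

variable (Q : Matrix (Fin n) (Fin n) ℝ)

/-- The quadratic form `v ↦ ∑ₖ ‖ζₖ(s) v‖²` of `ψ(s) = X(s)ᵀ Q X(s) = ∑ₖ ζₖ(s)²`, where
`ζ = √Q X`. -/
def psiForm (t s : ℝ) (v : SysField H₀ d t) : ℝ≥0∞ :=
  open Classical in
  ∑ k, if InDomain X₀ t s (CFC.sqrt Q k) v then ‖sysVar X₀ t s (CFC.sqrt Q k) v‖ₑ ^ 2 else ⊤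

/-- The closed quadratic form of the positive self-adjoint operator `φ(t) = ∫₀ᵗ ψ(s) ds`. -/
def phiForm (t : ℝ) (v : SysField H₀ d t) : ℝ≥0∞ :=
  ∫⁻ s in Set.Icc 0 t, psiForm X₀ Q t s v

/-- The graph of `φ(t) = ∫₀ᵗ ψ(s) ds`, the self-adjoint operator associated with the closed form
`phiForm`: `φ(t) v = w` if `v` is in the form domain and
`∫₀ᵗ ∑ₖ ⟪ζₖ(s) u, ζₖ(s) v⟫ ds = ⟪u, w⟫` for all `u` in the form domain. -/
def IsPhi (t : ℝ) (v w : SysField H₀ d t) : Prop :=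
  phiForm X₀ Q t v ≠ ⊤ ∧ ∀ u, phiForm X₀ Q t u ≠ ⊤ →
    ∫ s in Set.Icc 0 t, ∑ k, inner ℂ (sysVar X₀ t s (CFC.sqrt Q k) u)
      (sysVar X₀ t s (CFC.sqrt Q k) v) = inner ℂ u w

/-- The quadratic form `⟪v, exp (θ φ(t)) v⟫ = ∑ₘ θᵐ / m! ⟪v, φ(t)ᵐ v⟫ ∈ [0, ∞]` of `exp (θ φ(t))`
for `θ > 0`.  Here `x k = φ(t)ᵏ v`, the terms of degree `2 k` and `2 k + 1` being multiples of
`‖φ(t)ᵏ v‖²` and of the form of `φ(t)` at `φ(t)ᵏ v`; the value is `∞` if `v` is not in the domain of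
every power of `φ(t)`.  Since `φ(t) ≥ 0`, this is the integral of `exp (θ λ)` over the spectral
measure of `φ(t)` at `v`. -/
def expForm (θ t : ℝ) (v : SysField H₀ d t) : ℝ≥0∞ :=
  ⨅ (x : ℕ → SysField H₀ d t) (_ : x 0 = v ∧ ∀ k, IsPhi X₀ Q t (x k) (x (k + 1))),
    ∑' k : ℕ, (ENNReal.ofReal (θ ^ (2 * k) / (2 * k).factorial) * ‖x k‖ₑ ^ 2
      + ENNReal.ofReal (θ ^ (2 * k + 1) / (2 * k + 1).factorial) * phiForm X₀ Q t (x k))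

/-- The isometry `x ↦ x ⊗ e(0)`, where `e(0)` is the vacuum vector of the Fock space. -/
def vacEmb (H₀ : Type*) [NormedAddCommGroup H₀] [InnerProductSpace ℂ H₀] (d : ℕ) (t : ℝ) :
    H₀ →L[ℂ] SysField H₀ d t :=
  UniformSpace.Completion.toComplL ∘L
    ((TensorProduct.mkL ℂ H₀ (Fock (NoiseSpace d t))).flip (expVec 0))

/-- The nominal state `ρ₀ ⊗ υ_t`, where `υ_t` is the vacuum state `|e(0)⟩⟨e(0)|` of the fields. -/
def nominal (d : ℕ) (ρ₀ : H₀ →L[ℂ] H₀) (t : ℝ) : SysField H₀ d t →L[ℂ] SysField H₀ d t :=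
  vacEmb H₀ d t ∘L ρ₀ ∘L (vacEmb H₀ d t).adjoint

/-- The class of states on `ℌ_t` whose relative entropy with respect to the nominal state is at most
`ε t`. -/
def uncertaintyClass (d : ℕ) (ρ₀ : H₀ →L[ℂ] H₀) (ε t : ℝ) :
    Set (SysField H₀ d t →L[ℂ] SysField H₀ d t) :=
  {ρ | IsDensity ρ ∧ relEntropy ρ (nominal d ρ₀ t) ≤ ENNReal.ofReal (ε * t)}

/-- The quadratic cost `𝐄 φ(t) = Tr (ρ φ(t))` in the state `ρ`. -/
def quadCost (t : ℝ) (ρ : SysField H₀ d t →L[ℂ] SysField H₀ d t) : ℝ≥0∞ :=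
  mean ρ (phiForm X₀ Q t)

/-- The nominal quadratic-exponential functional `Tr ((ρ₀ ⊗ υ_t) exp (θ φ(t)))`. -/
def nominalQEF (ρ₀ : H₀ →L[ℂ] H₀) (θ t : ℝ) : ℝ≥0∞ :=
  mean (nominal d ρ₀ t) (expForm X₀ Q θ t)

/-- The upper growth rate `γ(θ)` of the logarithm of the nominal QEF. -/
def qefRate (ρ₀ : H₀ →L[ℂ] H₀) (θ : ℝ) : EReal :=
  Filter.limsup (fun t : ℝ => ENNReal.log (nominalQEF X₀ Q ρ₀ θ t) / (t : EReal)) Filter.atTop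

end Dynamics

end QuantumOscillator

end

/-!
The bound is the Gibbs variational principle applied for each fixed `t > 0`: if `ρ` belongs to the
uncertainty class, then
`θ Tr (ρ φ(t)) ≤ D(ρ‖ρ₀ ⊗ υ_t) + ln Ξ_θ(t) ≤ ε t + ln Ξ_θ(t)` (`quadCost_le`).
Dividing by `θ t` and passing to the upper limit gives the theorem.  Two points need work: the
variational principle when neither state is of finite rank or faithful, and the reduction of the
unbounded operator `φ(t)`, which is only given by a quadratic form, to bounded operators.

**The variational principle for a bounded operator `T ≥ 0`** (`mean_le_relEntropy_add_log`).  A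
density operator has an orthonormal eigenbasis, since its square root is Hilbert–Schmidt, and in
eigenbases of `ρ` and `σ` the relative entropy is the sum of `entropyTerm (p i) (q j)` with the
weights `|⟪ψ i, χ j⟫|²` (`relEntropy_eq_tsum`).  Operator logarithms, whose domains would be
an issue, are avoided by the integral representation of the scalar entropy term: it is the integral
over `τ ∈ [0, 1]` of `τ (p - q)² / ((1 - τ) p + τ q)`, and completing the square bounds the
integrand from below by an expression that is affine in `p` and `q`, with a free parameter `y`.
Taking for `y` the matrix elements of the operator `Y_τ = (r - 1) / (τ + (1 - τ) r)` with
`r = exp K`, summing over the two eigenbases (with Bessel's inequality for the quadratic terms) and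
integrating over `τ` yields `Tr (ρ K) - Tr (σ exp K) + 1 ≤ D(ρ‖σ)` (`gibbs_eigenbasis`).
The choice `K = T - ln Z` gives the principle.

**From a closed form to bounded operators.**  Let `q` be a closed form (`ClosedForm`).  Its domain
with the inner product `⟪u, v⟫ + ε q(u, v)` is a Hilbert space, and if `ι` is the inclusion of this
space, then `R = ι ι*` is the resolvent `(1 + ε φ)⁻¹`.  The Yosida approximations
`φ_ε = (1 - R) / ε` are bounded and positive; `exp (θ φ_ε)` is dominated by the power series
defining `exp (θ φ)` (`re_inner_exp_yosida_le`), while `q` is at most the lower limit of the forms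
of `φ_ε` as `ε → 0` (`form_le_liminf`).  The variational principle for `θ φ_ε` and Fatou's lemma
therefore give the one for `q` (`ClosedForm.mean_form_le`).

**The form of `φ(t)` is closed.**  For a strongly continuous unitary group `U r = exp (i r L)`, the
form `‖L v‖²` is the supremum over `r` of `‖(U r v - v) / r‖²`; in particular, a vector for which
this supremum is finite is in the domain of `L`, by weak compactness (`exists_hasDerivAt`).  As a
supremum of continuous functions, this form is lower semicontinuous in `v` and, for a family of
groups depending continuously on time, measurable in time, so that integration over time leads to a
closed form by Fatou's lemma (`integralClosedForm`).  The Weyl operators of the oscillator are such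
a family, because the Weyl operators on the Fock space are strongly continuous in the test
function, and the test functions depend continuously on time in `L²` (`phiClosedForm`).
-/

set_option linter.unusedSectionVars false

noncomputable section

namespace QuantumOscillator

/-! ### Hilbert–Schmidt sums and eigenbases of density operators -/

section HilbertSchmidt

variable {H H' ι κ : Type*} [NormedAddCommGroup H] [InnerProductSpace ℂ H] [CompleteSpace H]
  [NormedAddCommGroup H'] [InnerProductSpace ℂ H'] [CompleteSpace H']

theorem hasSum_norm_sq_inner (b : HilbertBasis ι ℂ H) (x : H) :
    HasSum (fun i => ‖inner ℂ (b i) x‖ ^ 2) (‖x‖ ^ 2) := by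
  have h := b.hasSum_inner_mul_inner x x
  rw [inner_self_eq_norm_sq_to_K] at h
  have h2 := Complex.hasSum_re h
  convert h2 using 2 with i
  · rw [← inner_conj_symm x, ← Complex.normSq_eq_conj_mul_self, Complex.ofReal_re,
      Complex.normSq_eq_norm_sq]
  · norm_cast

theorem tsum_enorm_sq_inner (b : HilbertBasis ι ℂ H) (x : H) :
    ∑' i, ‖inner ℂ (b i) x‖ₑ ^ 2 = ‖x‖ₑ ^ 2 := by
  have h := hasSum_norm_sq_inner b x
  have h2 := (ENNReal.ofReal_tsum_of_nonneg (fun i => by positivity) h.summable)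
  rw [h.tsum_eq] at h2
  simpa [ENNReal.ofReal_pow, ofReal_norm] using h2.symm

theorem enorm_inner_symm (x y : H) : ‖inner ℂ x y‖ₑ = ‖inner ℂ y x‖ₑ := by
  rw [← ofReal_norm, ← ofReal_norm, norm_inner_symm]

/-- The Hilbert–Schmidt norm of an operator and of its adjoint agree, whatever the orthonormal
bases used to evaluate them. -/
theorem tsum_enorm_sq_adjoint (b : HilbertBasis ι ℂ H) (c : HilbertBasis κ ℂ H')
    (T : H →L[ℂ] H') : ∑' i, ‖T (b i)‖ₑ ^ 2 = ∑' j, ‖T.adjoint (c j)‖ₑ ^ 2 := by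
  simp_rw [← tsum_enorm_sq_inner c, ← tsum_enorm_sq_inner b]
  rw [ENNReal.tsum_comm]
  refine tsum_congr fun j => tsum_congr fun i => ?_
  rw [ContinuousLinearMap.adjoint_inner_right, enorm_inner_symm]

theorem tsum_enorm_sq_eq (b : HilbertBasis ι ℂ H) (c : HilbertBasis κ ℂ H) (T : H →L[ℂ] H') :
    ∑' i, ‖T (b i)‖ₑ ^ 2 = ∑' j, ‖T (c j)‖ₑ ^ 2 := by
  rw [tsum_enorm_sq_adjoint b (basis H'), tsum_enorm_sq_adjoint c (basis H')]

theorem isCompactOperator_of_hilbertSchmidt (b : HilbertBasis ι ℂ H) (T : H →L[ℂ] H')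
    (hT : ∑' i, ‖T (b i)‖ₑ ^ 2 ≠ ⊤) : IsCompactOperator T := by
  classical
  have hsum : Summable fun i => ‖T (b i)‖ ^ 2 := by
    have := ENNReal.summable_toReal hT
    simpa using this
  -- the truncations of `T` to finitely many basis vectors
  let F : Finset ι → H →L[ℂ] H' := fun s => ∑ i ∈ s, (innerSL ℂ (b i)).smulRight (T (b i))
  have hF : ∀ s x, F s x = ∑ i ∈ s, inner ℂ (b i) x • T (b i) := by
    intro s x; simp [F]
  have hcomp : ∀ s, IsCompactOperator (F s) := by
    intro s
    change F s ∈ compactOperator (RingHom.id ℂ) H H'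
    refine Submodule.sum_mem _ fun i _ => ?_
    change IsCompactOperator _
    have h1 : IsCompactOperator (innerSL ℂ (b i)) :=
      isCompactOperator_of_locallyCompactSpace_dom _
    exact h1.clm_comp (ContinuousLinearMap.toSpanSingleton ℂ (T (b i)))
  refine isCompactOperator_of_tendsto (l := Filter.atTop) (F := F) ?_
    (Filter.Eventually.of_forall hcomp)
  rw [tendsto_iff_norm_sub_tendsto_zero]
  have htail := hsum.hasSum
  have h0 : Filter.Tendsto (fun s : Finset ι => Real.sqrt (∑' i, ‖T (b i)‖ ^ 2
      - ∑ i ∈ s, ‖T (b i)‖ ^ 2)) Filter.atTop (nhds 0) := by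
    have h := (tendsto_const_nhds (x := ∑' i, ‖T (b i)‖ ^ 2)).sub htail
    rw [sub_self] at h
    simpa using h.sqrt
  refine squeeze_zero (fun _ => norm_nonneg _) (fun s => ?_) h0
  rw [← norm_neg, neg_sub]
  refine ContinuousLinearMap.opNorm_le_bound _ (Real.sqrt_nonneg _) fun x => ?_
  have hx : HasSum (fun i => inner ℂ (b i) x • T (b i)) (T x) := by
    have := (b.hasSum_repr x).mapL T
    simpa [HilbertBasis.repr_apply_apply] using this
  have hlim : Filter.Tendsto (fun u => ‖F u x - F s x‖) Filter.atTop (nhds ‖T x - F s x‖) := by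
    refine (Filter.Tendsto.sub ?_ tendsto_const_nhds).norm
    simp_rw [hF]
    exact hx
  rw [sub_apply]
  refine le_of_tendsto hlim ?_
  filter_upwards [Filter.eventually_ge_atTop s] with u hu
  rw [hF, hF, ← Finset.sum_sdiff hu, add_sub_cancel_right]
  calc ‖∑ i ∈ u \ s, inner ℂ (b i) x • T (b i)‖
      ≤ ∑ i ∈ u \ s, ‖T (b i)‖ * ‖inner ℂ (b i) x‖ := by
        refine (norm_sum_le _ _).trans (Finset.sum_le_sum fun i _ => ?_)
        rw [norm_smul, mul_comm]
    _ ≤ Real.sqrt (∑ i ∈ u \ s, ‖T (b i)‖ ^ 2) * Real.sqrt (∑ i ∈ u \ s, ‖inner ℂ (b i) x‖ ^ 2) :=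
        Real.sum_mul_le_sqrt_mul_sqrt _ _ _
    _ ≤ _ := by
        gcongr
        · rw [le_sub_iff_add_le, Finset.sum_sdiff hu]
          exact hsum.sum_le_tsum _ fun _ _ => by positivity
        · rw [Real.sqrt_le_left (norm_nonneg _)]
          exact sum_le_hasSum _ (fun _ _ => by positivity) (hasSum_norm_sq_inner b x)

/-- A compact self-adjoint operator has an orthonormal basis of eigenvectors. -/
theorem exists_hilbertBasis_eigenvectors (T : H →L[ℂ] H) (hT : (T : H →ₗ[ℂ] H).IsSymmetric)
    (hc : IsCompactOperator T) :
    ∃ (s : Set H) (b : HilbertBasis s ℂ H) (μ : s → ℂ), ∀ i, T (b i) = μ i • b i := by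
  classical
  let V : ℂ → Submodule ℂ H := fun μ => Module.End.eigenspace (T : H →ₗ[ℂ] H) μ
  have hV : OrthogonalFamily ℂ (fun μ => V μ) fun μ => (V μ).subtypeₗᵢ :=
    hT.orthogonalFamily_eigenspaces
  have hclosed : ∀ μ, IsClosed (V μ : Set H) := fun μ => by
    have : (V μ : Set H) = {x | T x = μ • x} := by
      ext x; simp [V]
    rw [this]
    exact isClosed_eq T.continuous (continuous_const_smul μ)
  have : ∀ μ, CompleteSpace (V μ) := fun μ => (hclosed μ).completeSpace_coe
  choose w e he using fun μ => exists_hilbertBasis ℂ (V μ)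
  have hon : Orthonormal ℂ fun i : (Σ μ, w μ) => ((e i.1 i.2 : V i.1) : H) :=
    hV.orthonormal_sigma_orthonormal fun μ => (e μ).orthonormal
  have hmem : ∀ i : (Σ μ, w μ), T ((e i.1 i.2 : V i.1) : H) = i.1 • ((e i.1 i.2 : V i.1) : H) :=
    fun i => Module.End.mem_eigenspace_iff.1 (e i.1 i.2).2
  have hon2 := hon.toSubtypeRange
  have hbot : (Submodule.span ℂ (Set.range ((↑) :
      Set.range (fun i : (Σ μ, w μ) => ((e i.1 i.2 : V i.1) : H)) → H)))ᗮ = ⊥ := by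
    rw [Subtype.range_coe, ← Submodule.orthogonal_closure]
    have hle : (⨆ μ, V μ) ≤ (Submodule.span ℂ (Set.range
        (fun i : (Σ μ, w μ) => ((e i.1 i.2 : V i.1) : H)))).topologicalClosure := by
      refine iSup_le fun μ x hx => ?_
      have hs := ((e μ).hasSum_repr ⟨x, hx⟩).mapL (V μ).subtypeL
      refine (Submodule.isClosed_topologicalClosure _).mem_of_tendsto hs
        (Filter.Eventually.of_forall fun s => ?_)
      refine Submodule.sum_mem _ fun i _ => ?_
      simp only [map_smul]
      refine Submodule.smul_mem _ _ (Submodule.le_topologicalClosure _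
        (Submodule.subset_span ⟨⟨μ, i⟩, rfl⟩))
    have h := ContinuousLinearMap.orthogonalComplement_iSup_eigenspaces_eq_bot hc hT
    have h2 := Submodule.orthogonal_le hle
    rw [eq_bot_iff]
    refine h2.trans ?_
    exact h.le
  refine ⟨_, HilbertBasis.mkOfOrthogonalEqBot hon2 hbot,
    fun i => i.2.choose.1, fun i => ?_⟩
  rw [HilbertBasis.coe_mkOfOrthogonalEqBot]
  have := hmem i.2.choose
  rwa [show ((e i.2.choose.1 i.2.choose.2 : V i.2.choose.1) : H) = i from i.2.choose_spec] at this

end HilbertSchmidt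

section Eigenbasis

variable {H ι κ : Type*} [NormedAddCommGroup H] [InnerProductSpace ℂ H] [CompleteSpace H]

theorem norm_sq_sqrt_apply {T : H →L[ℂ] H} (hT : T.IsPositive) (v : H) :
    ‖CFC.sqrt T v‖ ^ 2 = (inner ℂ v (T v)).re := by
  have h0 : 0 ≤ T := (ContinuousLinearMap.nonneg_iff_isPositive T).2 hT
  have h1 : (CFC.sqrt T).IsPositive :=
    (ContinuousLinearMap.nonneg_iff_isPositive _).1 (CFC.sqrt_nonneg T)
  have h2 : T v = CFC.sqrt T (CFC.sqrt T v) := by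
    conv_lhs => rw [← CFC.sqrt_mul_sqrt_self T h0]
    rfl
  rw [h2, ← ContinuousLinearMap.adjoint_inner_left, h1.isSelfAdjoint.adjoint_eq,
    inner_self_eq_norm_sq_to_K]
  norm_cast

theorem enorm_sq_sqrt_apply {T : H →L[ℂ] H} (hT : T.IsPositive) (v : H) :
    ‖CFC.sqrt T v‖ₑ ^ 2 = ENNReal.ofReal (inner ℂ v (T v)).re := by
  rw [← norm_sq_sqrt_apply hT, ENNReal.ofReal_pow (norm_nonneg _), ofReal_norm]

theorem sqrt_apply_eigenvector {ρ : H →L[ℂ] H} (hρ : ρ.IsPositive) {v : H} {p : ℝ} (hp : 0 ≤ p)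
    (hv : ρ v = (p : ℂ) • v) : CFC.sqrt ρ v = (Real.sqrt p : ℂ) • v := by
  have h0 : 0 ≤ ρ := (ContinuousLinearMap.nonneg_iff_isPositive ρ).2 hρ
  have h1 : (CFC.sqrt ρ).IsPositive :=
    (ContinuousLinearMap.nonneg_iff_isPositive _).1 (CFC.sqrt_nonneg ρ)
  have h2 : CFC.sqrt ρ (CFC.sqrt ρ v) = ρ v := by
    conv_rhs => rw [← CFC.sqrt_mul_sqrt_self ρ h0]
    rfl
  rcases hp.eq_or_lt with rfl | hp
  · have := norm_sq_sqrt_apply hρ v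
    rw [hv] at this
    simpa using this
  set w := CFC.sqrt ρ v - (Real.sqrt p : ℂ) • v with hw
  have h3 : CFC.sqrt ρ w = -(Real.sqrt p : ℂ) • w := by
    have hs : (Real.sqrt p : ℂ) * (Real.sqrt p : ℂ) = p := by
      rw [← Complex.ofReal_mul, Real.mul_self_sqrt hp.le]
    rw [hw, map_sub, h2, map_smul, hv, ← hs]
    module
  have h4 := h1.re_inner_nonneg_right w
  rw [h3, inner_smul_right, inner_self_eq_norm_sq_to_K] at h4
  have h5 : 0 ≤ -(Real.sqrt p * ‖w‖ ^ 2) := by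
    convert h4 using 1
    simp [← Complex.ofReal_pow]
  have h6 : ‖w‖ ^ 2 ≤ 0 := by
    by_contra h
    push Not at h
    have := mul_pos (Real.sqrt_pos.2 hp) h
    linarith
  have h7 : w = 0 := by
    rw [← norm_eq_zero]
    exact pow_eq_zero_iff (two_ne_zero) |>.1 (le_antisymm h6 (by positivity))
  rwa [hw, sub_eq_zero] at h7

/-- The mean value of a bounded positive operator, in an eigenbasis of the state. -/
theorem mean_re_inner {ρ : H →L[ℂ] H} (hρ : ρ.IsPositive) (ψ : HilbertBasis ι ℂ H) {p : ι → ℝ}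
    (hp : ∀ i, 0 ≤ p i) (hψ : ∀ i, ρ (ψ i) = (p i : ℂ) • ψ i) {T : H →L[ℂ] H}
    (hT : T.IsPositive) :
    mean ρ (fun v => ENNReal.ofReal (inner ℂ v (T v)).re)
      = ∑' i, ENNReal.ofReal (p i * (inner ℂ (ψ i) (T (ψ i))).re) := by
  simp only [mean, ← enorm_sq_sqrt_apply hT]
  refine (tsum_enorm_sq_eq (basis H) ψ (CFC.sqrt T ∘L CFC.sqrt ρ)).trans (tsum_congr fun i => ?_)
  rw [ContinuousLinearMap.comp_apply, sqrt_apply_eigenvector hρ (hp i) (hψ i), map_smul,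
    enorm_smul, mul_pow, enorm_sq_sqrt_apply hT, ENNReal.ofReal_mul (hp i)]
  congr 1
  rw [← ofReal_norm, ← ENNReal.ofReal_pow (norm_nonneg _), Complex.norm_real, Real.norm_eq_abs,
    sq_abs, Real.sq_sqrt (hp i)]

/-- A density operator has an orthonormal basis of eigenvectors, and its eigenvalues form a
probability distribution. -/
theorem IsDensity.exists_eigenbasis {ρ : H →L[ℂ] H} (hρ : IsDensity ρ) :
    ∃ (s : Set H) (ψ : HilbertBasis s ℂ H) (p : s → ℝ), (∀ i, ρ (ψ i) = (p i : ℂ) • ψ i) ∧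
      (∀ i, 0 ≤ p i) ∧ HasSum p 1 := by
  obtain ⟨hpos, htr⟩ := hρ
  have h0 : 0 ≤ ρ := (ContinuousLinearMap.nonneg_iff_isPositive ρ).2 hpos
  have hc : IsCompactOperator (CFC.sqrt ρ : H →L[ℂ] H) := by
    refine isCompactOperator_of_hilbertSchmidt (basis H) (CFC.sqrt ρ) ?_
    rw [mean] at htr
    rw [htr]
    exact ENNReal.one_ne_top
  have hc2 : IsCompactOperator ρ := by
    conv => arg 1; rw [← CFC.sqrt_mul_sqrt_self ρ h0]
    exact hc.comp_clm (CFC.sqrt ρ)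
  have hsymm := hpos.isSymmetric
  obtain ⟨s, ψ, μ, hμ⟩ := exists_hilbertBasis_eigenvectors ρ hsymm hc2
  have hval : ∀ i, μ i = ((inner ℂ (ψ i) (ρ (ψ i))).re : ℂ) := fun i => by
    have h1 : inner ℂ (ψ i) (ρ (ψ i)) = μ i := by
      rw [hμ, inner_smul_right, inner_self_eq_norm_sq_to_K, ψ.orthonormal.1 i]
      simp
    have h2 := hsymm.conj_eigenvalue_eq_self (μ := μ i)
      (Module.End.hasEigenvalue_of_hasEigenvector
        ⟨Module.End.mem_eigenspace_iff.2 (hμ i), ψ.orthonormal.ne_zero i⟩)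
    rw [h1]
    exact (Complex.conj_eq_iff_re.1 h2).symm
  have hp : ∀ i, 0 ≤ (inner ℂ (ψ i) (ρ (ψ i))).re := fun i => hpos.re_inner_nonneg_right _
  have hψ : ∀ i, ρ (ψ i) = ((inner ℂ (ψ i) (ρ (ψ i))).re : ℂ) • ψ i := fun i => by
    rw [← hval, hμ]
  refine ⟨s, ψ, fun i => (inner ℂ (ψ i) (ρ (ψ i))).re, hψ, hp, ?_⟩
  have h1 := mean_re_inner hpos ψ hp hψ (T := ContinuousLinearMap.id ℂ H)
    ((ContinuousLinearMap.nonneg_iff_isPositive _).1 (zero_le_one' (H →L[ℂ] H)))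
  have h2 : (fun v : H => ENNReal.ofReal (inner ℂ v (ContinuousLinearMap.id ℂ H v)).re)
      = fun v => ‖v‖ₑ ^ 2 := by
    ext v
    rw [← ofReal_norm, ← ENNReal.ofReal_pow (norm_nonneg _), ContinuousLinearMap.id_apply,
      inner_self_eq_norm_sq_to_K]
    norm_cast
  rw [h2, htr] at h1
  have h3 : ∀ i, (inner ℂ (ψ i) (ρ (ψ i))).re
      * (inner ℂ (ψ i) (ContinuousLinearMap.id ℂ H (ψ i))).re = (inner ℂ (ψ i) (ρ (ψ i))).re := by
    intro i
    rw [ContinuousLinearMap.id_apply, inner_self_eq_norm_sq_to_K, ψ.orthonormal.1 i]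
    simp
  simp_rw [h3] at h1
  have h4 := ENNReal.hasSum_toReal (h1 ▸ ENNReal.one_ne_top)
  rw [← ENNReal.tsum_toReal_eq fun _ => ENNReal.ofReal_ne_top, ← h1] at h4
  simpa [ENNReal.toReal_ofReal (hp _)] using h4

theorem eigenProj_apply_of_eq {ρ : H →L[ℂ] H} {v : H} {p : ℝ} (hv : ρ v = (p : ℂ) • v) :
    eigenProj ρ p v = v := by
  rw [eigenProj, Submodule.starProjection_eq_self_iff]
  simp [hv]

theorem eigenProj_apply_of_ne {ρ : H →L[ℂ] H} (hρ : ρ.IsPositive) {v : H} {p r : ℝ}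
    (hv : ρ v = (p : ℂ) • v) (hr : p ≠ r) : eigenProj ρ r v = 0 := by
  rw [eigenProj, Submodule.starProjection_apply_eq_zero_iff, Submodule.mem_orthogonal]
  intro u hu
  have hu : ρ u = (r : ℂ) • u := by simpa [sub_eq_zero] using hu
  have h := hρ.isSymmetric u v
  simp only [ContinuousLinearMap.coe_coe, hu, hv, inner_smul_left, inner_smul_right,
    Complex.conj_ofReal] at h
  have h2 : ((r : ℂ) - p) * inner ℂ u v = 0 := by rw [sub_mul, h, sub_self]
  rcases mul_eq_zero.1 h2 with h3 | h3
  · exact absurd (by exact_mod_cast (sub_eq_zero.1 h3).symm) hr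
  · exact h3

/-- The quantum relative entropy in terms of eigenbases of the two states. -/
theorem relEntropy_eq_tsum {ρ σ : H →L[ℂ] H} (hρ : ρ.IsPositive) (hσ : σ.IsPositive)
    (ψ : HilbertBasis ι ℂ H) {p : ι → ℝ} (hψ : ∀ i, ρ (ψ i) = (p i : ℂ) • ψ i)
    (χ : HilbertBasis κ ℂ H) {q : κ → ℝ} (hχ : ∀ i, σ (χ i) = (q i : ℂ) • χ i) :
    relEntropy ρ σ = ∑' ij : ι × κ,
      entropyTerm (p ij.1) (q ij.2) * ‖inner ℂ (ψ ij.1) (χ ij.2)‖ₑ ^ 2 := by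
  classical
  have hov : ∀ a b, overlap (eigenProj ρ a) (eigenProj σ b) = ∑' ij : ι × κ,
      if (a, b) = (p ij.1, q ij.2) then ‖inner ℂ (ψ ij.1) (χ ij.2)‖ₑ ^ 2 else 0 := by
    intro a b
    rw [overlap, ENNReal.tsum_prod (f := fun i j =>
      if (a, b) = (p i, q j) then ‖inner ℂ (ψ i) (χ j)‖ₑ ^ 2 else 0)]
    refine (tsum_enorm_sq_eq (basis H) ψ (eigenProj σ b ∘L eigenProj ρ a)).trans
      (tsum_congr fun i => ?_)
    rw [ContinuousLinearMap.comp_apply]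
    by_cases hi : a = p i
    · rw [hi, eigenProj_apply_of_eq (hψ i), ← tsum_enorm_sq_inner χ]
      refine tsum_congr fun j => ?_
      have hsa : inner ℂ (χ j) (eigenProj σ b (ψ i)) = inner ℂ (eigenProj σ b (χ j)) (ψ i) :=
        (Submodule.starProjection_isSymmetric _ _ _).symm
      rw [hsa]
      by_cases hj : b = q j
      · rw [hj, eigenProj_apply_of_eq (hχ j), enorm_inner_symm]; simp
      · rw [eigenProj_apply_of_ne hσ (hχ j) (Ne.symm hj)]; simp [hj]
    · rw [eigenProj_apply_of_ne hρ (hψ i) (Ne.symm hi)]; simp [hi]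
  rw [relEntropy]
  simp_rw [hov, ← ENNReal.tsum_mul_left]
  rw [ENNReal.tsum_comm]
  refine tsum_congr fun ij => ?_
  rw [tsum_eq_single (p ij.1, q ij.2)]
  · simp
  · intro b hb
    simp [hb]

end Eigenbasis

/-! ### Integral representations of the logarithm -/

/-- The function `k ↦ (r - 1) / (τ + (1 - τ) r)`, `r = exp k`, for `τ ∈ [0, 1]`: the pointwise
optimal choice in the variational lower bound for the relative entropy.  The parameter `τ` is
clamped to `[0, 1]` to make the function jointly continuous on the whole plane. -/
def logWeight (τ k : ℝ) : ℝ :=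
  (Real.exp k - 1) / (max 0 (min 1 τ) + (1 - max 0 (min 1 τ)) * Real.exp k)

theorem logWeight_denom_pos {τ r : ℝ} (hr : 0 < r) (h0 : 0 ≤ τ) (h1 : τ ≤ 1) :
    0 < τ + (1 - τ) * r := by
  rcases h0.eq_or_lt with rfl | h0
  · simpa using hr
  · have : 0 ≤ (1 - τ) * r := mul_nonneg (by linarith) hr.le
    linarith

theorem logWeight_of_mem {τ : ℝ} (h : τ ∈ Set.Icc (0 : ℝ) 1) (k : ℝ) :
    logWeight τ k = (Real.exp k - 1) / (τ + (1 - τ) * Real.exp k) := by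
  rw [logWeight, min_eq_right h.2, max_eq_right h.1]

theorem continuous_logWeight : Continuous fun x : ℝ × ℝ => logWeight x.1 x.2 := by
  unfold logWeight
  refine Continuous.div (by fun_prop) (by fun_prop) fun x => ?_
  exact (logWeight_denom_pos (Real.exp_pos _) (le_max_left _ _)
    (max_le zero_le_one (min_le_left _ _))).ne'

/-- The integral that recovers `k`, and through the functional calculus the term `Tr (ρ K)`. -/
theorem integral_logWeight_log (k : ℝ) :
    ∫ τ in (0 : ℝ)..1, (2 * τ * logWeight τ k - τ * (1 - τ) * logWeight τ k ^ 2) = k := by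
  set r := Real.exp k with hr
  have hr0 : 0 < r := Real.exp_pos k
  have key := intervalIntegral.integral_eq_sub_of_hasDerivAt (a := 0) (b := 1)
    (f := fun τ => -Real.log (τ + (1 - τ) * r) - (r - 1) * τ * (1 - τ) / (τ + (1 - τ) * r))
    (f' := fun τ => 2 * τ * logWeight τ k - τ * (1 - τ) * logWeight τ k ^ 2) ?_ ?_
  · rw [key]
    simp [hr]
  · intro τ hτ
    rw [Set.uIcc_of_le zero_le_one] at hτ
    have hN := logWeight_denom_pos hr0 hτ.1 hτ.2
    have hd : HasDerivAt (fun τ : ℝ => τ + (1 - τ) * r) (1 - r) τ := by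
      have := (hasDerivAt_id τ).add (((hasDerivAt_id τ).const_sub 1).mul_const r)
      exact this.congr_deriv (by ring)
    have hd2 : HasDerivAt (fun τ : ℝ => (r - 1) * τ * (1 - τ)) ((r - 1) * (1 - 2 * τ)) τ := by
      have := ((hasDerivAt_id τ).const_mul (r - 1)).mul ((hasDerivAt_id τ).const_sub 1)
      exact this.congr_deriv (by simp; ring)
    have := (hd.log hN.ne').neg.sub (hd2.div hd hN.ne')
    refine this.congr_deriv ?_
    rw [logWeight_of_mem hτ, ← hr]
    field_simp
    ring
  · refine Continuous.intervalIntegrable ?_ _ _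
    have := continuous_logWeight.comp (continuous_id.prodMk (continuous_const (y := k)))
    simp only [Function.comp_def, id] at this
    fun_prop

/-- The integral that recovers `exp k - 1`, and through the functional calculus the term
`Tr (σ exp K) - 1`. -/
theorem integral_logWeight_exp (k : ℝ) :
    ∫ τ in (0 : ℝ)..1, (2 * τ * logWeight τ k + τ ^ 2 * logWeight τ k ^ 2) = Real.exp k - 1 := by
  set r := Real.exp k with hr
  have hr0 : 0 < r := Real.exp_pos k
  have key := intervalIntegral.integral_eq_sub_of_hasDerivAt (a := 0) (b := 1)
    (f := fun τ => r * τ / (τ + (1 - τ) * r) - τ)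
    (f' := fun τ => 2 * τ * logWeight τ k + τ ^ 2 * logWeight τ k ^ 2) ?_ ?_
  · rw [key]
    simp
  · intro τ hτ
    rw [Set.uIcc_of_le zero_le_one] at hτ
    have hN := logWeight_denom_pos hr0 hτ.1 hτ.2
    have hd : HasDerivAt (fun τ : ℝ => τ + (1 - τ) * r) (1 - r) τ := by
      have := (hasDerivAt_id τ).add (((hasDerivAt_id τ).const_sub 1).mul_const r)
      exact this.congr_deriv (by ring)
    have hd2 : HasDerivAt (fun τ : ℝ => r * τ) r τ := by
      simpa using (hasDerivAt_id τ).const_mul r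
    have := (hd2.div hd hN.ne').sub (hasDerivAt_id τ)
    refine this.congr_deriv ?_
    rw [logWeight_of_mem hτ, ← hr, div_sub_one (pow_ne_zero 2 hN.ne'), div_pow, mul_div_assoc',
      mul_div_assoc', div_add_div _ _ hN.ne' (pow_ne_zero 2 hN.ne'),
      div_eq_div_iff (pow_ne_zero 2 hN.ne') (mul_ne_zero hN.ne' (pow_ne_zero 2 hN.ne'))]
    ring
  · refine Continuous.intervalIntegrable ?_ _ _
    have := continuous_logWeight.comp (continuous_id.prodMk (continuous_const (y := k)))
    simp only [Function.comp_def, id] at this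
    fun_prop

/-- Completing the square, with the sign of `δ = q - p` that makes the bound affine in `p, q`
once `m = (1 - τ) p + τ q`. -/
theorem quadratic_le {δ m : ℝ} (hm : 0 < m) (c y : ℂ) :
    -2 * δ * (starRingEnd ℂ c * y).re - m * ‖y‖ ^ 2 ≤ δ ^ 2 / m * ‖c‖ ^ 2 := by
  have h : 0 ≤ ‖(δ : ℂ) * c + m * y‖ ^ 2 := by positivity
  have h2 : ‖(δ : ℂ) * c + m * y‖ ^ 2
      = δ ^ 2 * ‖c‖ ^ 2 + 2 * δ * m * (starRingEnd ℂ c * y).re + m ^ 2 * ‖y‖ ^ 2 := by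
    simp only [← Complex.normSq_eq_norm_sq, Complex.normSq_apply]
    simp
    ring
  rw [h2] at h
  rw [div_mul_eq_mul_div, le_div_iff₀ hm]
  nlinarith

theorem integral_entropy {p q : ℝ} (hp : 0 < p) (hq : 0 < q) :
    ∫ τ in (0 : ℝ)..1, ((q - p) - p * (q - p) / (p + τ * (q - p)))
      = p * Real.log p - p * Real.log q + q - p := by
  have hm : ∀ τ ∈ Set.uIcc (0 : ℝ) 1, 0 < p + τ * (q - p) := by
    intro τ hτ
    rw [Set.uIcc_of_le zero_le_one] at hτ
    have := logWeight_denom_pos (τ := τ) (r := p / q) (by positivity) hτ.1 hτ.2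
    have h2 := mul_pos hq this
    field_simp at h2
    linarith
  rw [intervalIntegral.integral_eq_sub_of_hasDerivAt
    (f := fun τ => τ * (q - p) - p * Real.log (p + τ * (q - p)))]
  · simp
    ring
  · intro τ hτ
    have hd : HasDerivAt (fun τ : ℝ => τ * (q - p)) (q - p) τ := by
      simpa using (hasDerivAt_id τ).mul_const (q - p)
    have := hd.sub (((hd.const_add p).log (hm τ hτ).ne').const_mul p)
    exact this.congr_deriv (by ring)
  · refine ContinuousOn.intervalIntegrable ?_
    refine continuousOn_const.sub (continuousOn_const.div (by fun_prop) fun τ hτ => (hm τ hτ).ne')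

/-- Variational lower bound for a single term of the relative entropy: from
`p ln p - p ln q + q - p = ∫₀¹ τ (p - q)² / m dτ` with `m = (1 - τ) p + τ q`, by completing the
square in `y`. -/
theorem integral_le_entropyTerm {p q : ℝ} (hp : 0 ≤ p) (hq : 0 ≤ q) (c : ℂ) {y : ℝ → ℂ}
    (hy : Continuous y) :
    ENNReal.ofReal (∫ τ in (0 : ℝ)..1, (τ * (2 * (p - q) * (starRingEnd ℂ c * y τ).re)
      - τ * ((1 - τ) * p + τ * q) * ‖y τ‖ ^ 2)) ≤ entropyTerm p q * ‖c‖ₑ ^ 2 := by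
  have hint : IntervalIntegrable (fun τ => τ * (2 * (p - q) * (starRingEnd ℂ c * y τ).re)
      - τ * ((1 - τ) * p + τ * q) * ‖y τ‖ ^ 2) volume 0 1 := by
    refine Continuous.intervalIntegrable ?_ _ _
    have := Complex.continuous_re.comp ((continuous_const (y := starRingEnd ℂ c)).mul hy)
    simp only [Function.comp_def] at this
    fun_prop
  rcases hq.eq_or_lt with rfl | hq
  · rcases hp.eq_or_lt with rfl | hp
    · simp
    by_cases hc : c = 0
    · refine le_of_eq_of_le (ENNReal.ofReal_of_nonpos ?_) zero_le
      have := intervalIntegral.integral_mono_on zero_le_one hint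
        (intervalIntegrable_const (c := (0 : ℝ))) (fun τ hτ => ?_)
      · simpa using this
      · have h1 : 0 ≤ 1 - τ := by linarith [hτ.2]
        have h2 := hτ.1
        have : 0 ≤ τ * ((1 - τ) * p + τ * 0) * ‖y τ‖ ^ 2 := by positivity
        simp only [hc, map_zero, zero_mul, Complex.zero_re, mul_zero]
        linarith
    · have hc' : ‖c‖ₑ ^ 2 ≠ 0 := by simpa using hc
      rw [entropyTerm, if_pos rfl, if_neg hp.ne', ENNReal.top_mul hc']
      exact le_top
  rw [entropyTerm, if_neg hq.ne', ← ofReal_norm, ← ENNReal.ofReal_pow (norm_nonneg _),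
    ← ENNReal.ofReal_mul' (by positivity)]
  refine ENNReal.ofReal_le_ofReal ?_
  rcases hp.eq_or_lt with rfl | hp
  · have := intervalIntegral.integral_mono_on zero_le_one hint
        (intervalIntegrable_const (c := q * ‖c‖ ^ 2)) (fun τ hτ => ?_)
    · simpa using this
    · rcases hτ.1.eq_or_lt with rfl | h0
      · simp; positivity
      have h := mul_le_mul_of_nonneg_left (quadratic_le (δ := q) (m := τ * q) (by positivity) c
        (y τ)) h0.le
      have h2 : τ * (q ^ 2 / (τ * q) * ‖c‖ ^ 2) = q * ‖c‖ ^ 2 := by field_simp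
      rw [h2] at h
      refine le_trans (le_of_eq ?_) h
      ring
  · rw [← integral_entropy hp hq, ← intervalIntegral.integral_mul_const]
    have hm : ∀ τ ∈ Set.uIcc (0 : ℝ) 1, 0 < p + τ * (q - p) := by
      intro τ hτ
      rw [Set.uIcc_of_le zero_le_one] at hτ
      have := logWeight_denom_pos (τ := τ) (r := p / q) (by positivity) hτ.1 hτ.2
      have h2 := mul_pos hq this
      field_simp at h2
      linarith
    refine intervalIntegral.integral_mono_on zero_le_one hint ?_ fun τ hτ => ?_
    · refine ContinuousOn.intervalIntegrable ?_
      refine (continuousOn_const.sub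
        (continuousOn_const.div (by fun_prop) fun τ hτ => (hm τ hτ).ne')).mul continuousOn_const
    · have hm' := hm τ (by rwa [Set.uIcc_of_le zero_le_one])
      have h := mul_le_mul_of_nonneg_left (quadratic_le (δ := q - p) hm' c (y τ)) hτ.1
      have h2 : τ * ((q - p) ^ 2 / (p + τ * (q - p)) * ‖c‖ ^ 2)
          = ((q - p) - p * (q - p) / (p + τ * (q - p))) * ‖c‖ ^ 2 := by
        field_simp
        ring
      rw [h2] at h
      refine le_trans (le_of_eq ?_) h
      ring

/-! ### The functional calculus and integrals -/

section Calculus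

variable {H : Type*} [NormedAddCommGroup H] [InnerProductSpace ℂ H] [CompleteSpace H]

theorem continuous_cfc_fun {g : ℝ → ℝ → ℝ} (hg : Continuous fun x : ℝ × ℝ => g x.1 x.2)
    (K : H →L[ℂ] H) : Continuous fun τ => cfc (g τ) K := by
  refine Continuous.cfc_fun g K ?_ fun τ =>
    (hg.comp (by fun_prop : Continuous fun k : ℝ => (τ, k))).continuousOn
  rw [continuous_iff_continuousAt]
  intro τ
  rw [ContinuousAt, UniformOnFun.tendsto_iff_tendstoUniformlyOn]
  rintro s rfl
  have hK : IsCompact (spectrum ℝ K) := spectrum.isCompact K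
  have := (hg.continuousOn (s := Set.univ ×ˢ spectrum ℝ K))
  simp only [UniformOnFun.toFun_ofFun, Function.comp_def]
  intro u hu
  obtain ⟨v, hv, h⟩ := hK.mem_uniformity_of_prod (f := g) this (Set.mem_univ τ)
    (symm_le_uniformity hu)
  rw [nhdsWithin_univ] at hv
  filter_upwards [hv] with x hx k hk using h x hx k hk

theorem integral_cfc_fun {g : ℝ → ℝ → ℝ} (hg : Continuous fun x : ℝ × ℝ => g x.1 x.2)
    {K : H →L[ℂ] H} (hK : IsSelfAdjoint K) :
    ∫ τ in (0 : ℝ)..1, cfc (g τ) K = cfc (fun k => ∫ τ in (0 : ℝ)..1, g τ k) K := by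
  have hKc : IsCompact (spectrum ℝ K) := spectrum.isCompact K
  obtain ⟨C, hC⟩ := ((isCompact_Icc (a := (0 : ℝ)) (b := 1)).prod hKc).exists_bound_of_continuousOn
    hg.continuousOn
  simp only [intervalIntegral.integral_of_le zero_le_one, ← integral_Icc_eq_integral_Ioc]
  symm
  refine cfc_setIntegral measurableSet_Icc g (fun _ => C) K hg.continuousOn ?_ ?_ hK
  · refine (ae_restrict_iff' measurableSet_Icc).2 (Filter.Eventually.of_forall fun τ hτ k hk => ?_)
    exact hC (τ, k) ⟨hτ, hk⟩
  · exact HasFiniteIntegral.of_bounded (C := ‖C‖) (by simp)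

theorem re_inner_intervalIntegral {F : ℝ → H →L[ℂ] H} (hF : Continuous F) (v w : H) :
    (inner ℂ v ((∫ τ in (0 : ℝ)..1, F τ) w)).re = ∫ τ in (0 : ℝ)..1, (inner ℂ v (F τ w)).re := by
  have h := ContinuousLinearMap.intervalIntegral_comp_comm
    ((innerSL ℂ v) ∘L (ContinuousLinearMap.apply ℂ H w)) (hF.intervalIntegrable 0 1 (μ := volume))
  have h2 := ContinuousLinearMap.intervalIntegral_comp_comm Complex.reCLM
    (f := fun τ => inner ℂ v (F τ w)) (a := 0) (b := 1) (μ := volume)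
    (Continuous.intervalIntegrable (by fun_prop) _ _)
  simp only [Complex.reCLM_apply] at h2
  rw [h2]
  congr 1
  exact h.symm

end Calculus

/-! ### The Gibbs variational inequality -/

section Gibbs

variable {H ι κ : Type*} [NormedAddCommGroup H] [InnerProductSpace ℂ H] [CompleteSpace H]

theorem summable_mul_of_abs_le {p x : ι → ℝ} (hp0 : ∀ i, 0 ≤ p i) (hp : Summable p) {C : ℝ}
    (hx : ∀ i, |x i| ≤ C) : Summable fun i => p i * x i := by
  refine Summable.of_norm_bounded (hp.mul_right C) fun i => ?_
  rw [Real.norm_eq_abs, abs_mul, abs_of_nonneg (hp0 i)]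
  exact mul_le_mul_of_nonneg_left (hx i) (hp0 i)

theorem summable_weighted {p : ι → ℝ} (hp0 : ∀ i, 0 ≤ p i) (hp : Summable p) {g : ι → κ → ℝ}
    {C : ℝ} (hg : ∀ i, Summable fun j => |g i j|) (hC : ∀ i, ∑' j, |g i j| ≤ C) :
    Summable fun ij : ι × κ => p ij.1 * g ij.1 ij.2 := by
  have h1 : Summable fun ij : ι × κ => |p ij.1| * |g ij.1 ij.2| := by
    refine (summable_prod_of_nonneg fun ij => mul_nonneg (abs_nonneg _) (abs_nonneg _)).2
      ⟨fun i => (hg i).mul_left |p i|, ?_⟩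
    have h2 : (fun i => ∑' j, |p i| * |g i j|) = fun i => p i * ∑' j, |g i j| := by
      ext i
      rw [tsum_mul_left, abs_of_nonneg (hp0 i)]
    refine h2 ▸ summable_mul_of_abs_le hp0 hp (C := C) fun i => ?_
    rw [abs_of_nonneg (tsum_nonneg fun _ => abs_nonneg _)]
    exact hC i
  refine Summable.of_norm_bounded h1 fun ij => ?_
  rw [Real.norm_eq_abs, abs_mul]

theorem tsum_weighted {p : ι → ℝ} (hp0 : ∀ i, 0 ≤ p i) (hp : Summable p) {g : ι → κ → ℝ}
    {C : ℝ} (hg : ∀ i, Summable fun j => |g i j|) (hC : ∀ i, ∑' j, |g i j| ≤ C) :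
    ∑' ij : ι × κ, p ij.1 * g ij.1 ij.2 = ∑' i, p i * ∑' j, g i j := by
  rw [(summable_weighted hp0 hp hg hC).tsum_prod]
  simp only [tsum_mul_left]

/-- Summation of a termwise bound `p a - q a - q b - p c ≤ d` over all pairs of indices. -/
theorem tsum_sub_le_of_forall_le {p : ι → ℝ} {q : κ → ℝ} (hp0 : ∀ i, 0 ≤ p i) (hp : Summable p)
    (hq0 : ∀ j, 0 ≤ q j) (hq : Summable q) {a c : ι → κ → ℝ} {b : κ → ι → ℝ} {d : ι × κ → ℝ}
    (hd : Summable d)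
    (h : ∀ i j, p i * a i j - q j * a i j - q j * b j i - p i * c i j ≤ d (i, j))
    {C₁ C₂ C₃ C₄ : ℝ} (h1 : ∀ i, Summable (fun j => |a i j|) ∧ ∑' j, |a i j| ≤ C₁)
    (h2 : ∀ j, Summable (fun i => |a i j|) ∧ ∑' i, |a i j| ≤ C₂)
    (h3 : ∀ j, Summable (fun i => |b j i|) ∧ ∑' i, |b j i| ≤ C₃)
    (h4 : ∀ i, Summable (fun j => |c i j|) ∧ ∑' j, |c i j| ≤ C₄) :
    ∑' i, p i * ∑' j, a i j - ∑' j, q j * ∑' i, a i j - ∑' j, q j * ∑' i, b j i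
      - ∑' i, p i * ∑' j, c i j ≤ ∑' ij, d ij := by
  have s1 := summable_weighted hp0 hp (fun i => (h1 i).1) (fun i => (h1 i).2)
  have s2 : Summable fun ij : ι × κ => q ij.2 * a ij.1 ij.2 := (Equiv.prodComm ι κ).summable_iff.2
    (summable_weighted (g := fun j i => a i j) hq0 hq (fun i => (h2 i).1) (fun i => (h2 i).2))
  have s3 : Summable fun ij : ι × κ => q ij.2 * b ij.2 ij.1 := (Equiv.prodComm ι κ).summable_iff.2
    (summable_weighted hq0 hq (fun i => (h3 i).1) (fun i => (h3 i).2))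
  have s4 := summable_weighted hp0 hp (fun i => (h4 i).1) (fun i => (h4 i).2)
  have t1 := tsum_weighted hp0 hp (fun i => (h1 i).1) (fun i => (h1 i).2)
  have t2 := tsum_weighted (g := fun j i => a i j) hq0 hq (fun i => (h2 i).1) (fun i => (h2 i).2)
  have t3 := tsum_weighted hq0 hq (fun i => (h3 i).1) (fun i => (h3 i).2)
  have t4 := tsum_weighted hp0 hp (fun i => (h4 i).1) (fun i => (h4 i).2)
  have e2 : ∑' ij : ι × κ, q ij.2 * a ij.1 ij.2 = ∑' ji : κ × ι, q ji.1 * a ji.2 ji.1 :=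
    (Equiv.prodComm ι κ).tsum_eq (fun ji : κ × ι => q ji.1 * a ji.2 ji.1)
  have e3 : ∑' ij : ι × κ, q ij.2 * b ij.2 ij.1 = ∑' ji : κ × ι, q ji.1 * b ji.1 ji.2 :=
    (Equiv.prodComm ι κ).tsum_eq (fun ji : κ × ι => q ji.1 * b ji.1 ji.2)
  have s12 : Summable fun ij : ι × κ => p ij.1 * a ij.1 ij.2 - q ij.2 * a ij.1 ij.2 := s1.sub s2
  have s123 : Summable fun ij : ι × κ => p ij.1 * a ij.1 ij.2 - q ij.2 * a ij.1 ij.2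
    - q ij.2 * b ij.2 ij.1 := s12.sub s3
  rw [← t1, ← t2, ← t3, ← t4, ← e2, ← e3, ← s1.tsum_sub s2, ← s12.tsum_sub s3,
    ← s123.tsum_sub s4]
  exact (s123.sub s4).tsum_le_tsum (fun ij => h ij.1 ij.2) hd

/-- Bessel's inequality under an integral sign. -/
theorem summable_integral_norm_sq_inner (b : HilbertBasis ι ℂ H) {F : ℝ → H} (hF : Continuous F)
    {w : ℝ → ℝ} (hw : Continuous w) (hw0 : ∀ τ ∈ Set.Icc (0 : ℝ) 1, 0 ≤ w τ) :
    (∀ i, 0 ≤ ∫ τ in (0 : ℝ)..1, w τ * ‖inner ℂ (b i) (F τ)‖ ^ 2) ∧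
    Summable (fun i => ∫ τ in (0 : ℝ)..1, w τ * ‖inner ℂ (b i) (F τ)‖ ^ 2) ∧
      ∑' i, ∫ τ in (0 : ℝ)..1, w τ * ‖inner ℂ (b i) (F τ)‖ ^ 2
        ≤ ∫ τ in (0 : ℝ)..1, w τ * ‖F τ‖ ^ 2 := by
  have h0 : ∀ i, 0 ≤ ∫ τ in (0 : ℝ)..1, w τ * ‖inner ℂ (b i) (F τ)‖ ^ 2 := fun i =>
    intervalIntegral.integral_nonneg zero_le_one fun τ hτ => mul_nonneg (hw0 τ hτ) (by positivity)
  have hle : ∀ s : Finset ι, ∑ i ∈ s, ∫ τ in (0 : ℝ)..1, w τ * ‖inner ℂ (b i) (F τ)‖ ^ 2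
      ≤ ∫ τ in (0 : ℝ)..1, w τ * ‖F τ‖ ^ 2 := by
    intro s
    rw [← intervalIntegral.integral_finsetSum fun i _ =>
      Continuous.intervalIntegrable (by fun_prop) _ _]
    refine intervalIntegral.integral_mono_on zero_le_one
      (Continuous.intervalIntegrable (by fun_prop) _ _)
      (Continuous.intervalIntegrable (by fun_prop) _ _) fun τ hτ => ?_
    rw [← Finset.mul_sum]
    exact mul_le_mul_of_nonneg_left
      (sum_le_hasSum _ (fun _ _ => by positivity) (hasSum_norm_sq_inner b (F τ))) (hw0 τ hτ)
  exact ⟨h0, summable_of_sum_le h0 hle, Real.tsum_le_of_sum_le h0 hle⟩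

theorem hasSum_re_conj_inner_mul (χ : HilbertBasis κ ℂ H) (A : H →L[ℂ] H) (v : H) :
    HasSum (fun j => (starRingEnd ℂ (inner ℂ (χ j) v) * inner ℂ (χ j) (A v)).re)
      (inner ℂ v (A v)).re := by
  convert Complex.hasSum_re (χ.hasSum_inner_mul_inner v (A v)) using 2 with j
  rw [inner_conj_symm]

theorem summable_abs_re_conj_inner_mul (χ : HilbertBasis κ ℂ H) (A : H →L[ℂ] H) (v : H) :
    Summable (fun j => |(starRingEnd ℂ (inner ℂ (χ j) v) * inner ℂ (χ j) (A v)).re|) ∧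
      ∑' j, |(starRingEnd ℂ (inner ℂ (χ j) v) * inner ℂ (χ j) (A v)).re|
        ≤ ‖v‖ ^ 2 + ‖A v‖ ^ 2 := by
  have hs := (hasSum_norm_sq_inner χ v).add (hasSum_norm_sq_inner χ (A v))
  have hle : ∀ j, |(starRingEnd ℂ (inner ℂ (χ j) v) * inner ℂ (χ j) (A v)).re|
      ≤ ‖inner ℂ (χ j) v‖ ^ 2 + ‖inner ℂ (χ j) (A v)‖ ^ 2 := fun j => by
    refine (Complex.abs_re_le_norm _).trans ?_
    rw [norm_mul, RCLike.norm_conj]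
    nlinarith [sq_nonneg (‖inner ℂ (χ j) v‖ - ‖inner ℂ (χ j) (A v)‖),
      norm_nonneg (inner ℂ (χ j) v), norm_nonneg (inner ℂ (χ j) (A v)),
      mul_nonneg (norm_nonneg (inner ℂ (χ j) v)) (norm_nonneg (inner ℂ (χ j) (A v)))]
  have hsum := Summable.of_nonneg_of_le (fun _ => abs_nonneg _) hle hs.summable
  exact ⟨hsum, (hsum.tsum_le_tsum hle hs.summable).trans_eq hs.tsum_eq⟩

theorem norm_sq_cfc_apply {K : H →L[ℂ] H} (hK : IsSelfAdjoint K) {f : ℝ → ℝ}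
    (hf : Continuous f) (v : H) :
    ‖cfc f K v‖ ^ 2 = (inner ℂ v (cfc (fun k => f k ^ 2) K v)).re := by
  have hsa : IsSelfAdjoint (cfc f K) := IsSelfAdjoint.cfc
  rw [cfc_pow f 2 K hf.continuousOn hK, pow_two (cfc f K)]
  change _ = (inner ℂ v (cfc f K (cfc f K v))).re
  rw [← ContinuousLinearMap.adjoint_inner_left, hsa.adjoint_eq, inner_self_eq_norm_sq_to_K]
  norm_cast

theorem continuous_logWeight_right (τ : ℝ) : Continuous (logWeight τ) :=
  continuous_logWeight.comp (by fun_prop : Continuous fun k : ℝ => (τ, k))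

/-- The operator `∫₀¹ 2 τ Y_τ dτ`, where `Y_τ` is the function `logWeight τ` of `K`. -/
def logMean (K : H →L[ℂ] H) : H →L[ℂ] H := ∫ τ in (0 : ℝ)..1, (2 * τ) • cfc (logWeight τ) K

theorem inner_logMean_left {K : H →L[ℂ] H} (hK : IsSelfAdjoint K) (v w : H) :
    inner ℂ (logMean K v) w = inner ℂ v (logMean K w) := by
  have hl := continuous_logWeight
  have hg : Continuous fun x : ℝ × ℝ => 2 * x.1 * logWeight x.1 x.2 := by fun_prop
  have h1 := integral_cfc_fun (g := fun τ k => 2 * τ * logWeight τ k) hg hK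
  have h2 : logMean K = cfc (fun k => ∫ τ in (0 : ℝ)..1, 2 * τ * logWeight τ k) K := by
    rw [← h1]
    refine intervalIntegral.integral_congr fun τ _ => ?_
    exact (cfc_const_mul _ _ K (continuous_logWeight_right τ).continuousOn).symm
  have hsa : IsSelfAdjoint (logMean K) := h2 ▸ IsSelfAdjoint.cfc
  rw [← ContinuousLinearMap.adjoint_inner_right, hsa.adjoint_eq]

theorem inner_cfc_logWeight_left (K : H →L[ℂ] H) (τ : ℝ) (v w : H) :
    inner ℂ (cfc (logWeight τ) K v) w = inner ℂ v (cfc (logWeight τ) K w) := by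
  have hsa : IsSelfAdjoint (cfc (logWeight τ) K) := IsSelfAdjoint.cfc
  rw [← ContinuousLinearMap.adjoint_inner_right, hsa.adjoint_eq]

/-- The terms linear and quadratic in `Y_τ`, which is the function `logWeight τ` of `K`, combine
into a single function of `K`. -/
theorem re_inner_integral_add {K : H →L[ℂ] H} (hK : IsSelfAdjoint K) {w : ℝ → ℝ}
    (hw : Continuous w) (v : H) :
    (inner ℂ v (logMean K v)).re
      + ∫ τ in (0 : ℝ)..1, w τ * ‖cfc (logWeight τ) K v‖ ^ 2
      = (inner ℂ v (cfc (fun k => ∫ τ in (0 : ℝ)..1,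
          (2 * τ * logWeight τ k + w τ * logWeight τ k ^ 2)) K v)).re := by
  have hl := continuous_logWeight
  have hY := continuous_cfc_fun continuous_logWeight K
  have hg : Continuous fun x : ℝ × ℝ =>
      2 * x.1 * logWeight x.1 x.2 + w x.1 * logWeight x.1 x.2 ^ 2 := by fun_prop
  rw [logMean, ← integral_cfc_fun hg hK, re_inner_intervalIntegral (by fun_prop),
    re_inner_intervalIntegral (continuous_cfc_fun hg K), ← intervalIntegral.integral_add
      (Continuous.intervalIntegrable (by fun_prop) _ _)
      (Continuous.intervalIntegrable (by fun_prop) _ _)]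
  refine intervalIntegral.integral_congr fun τ _ => ?_
  have hτ := continuous_logWeight_right τ
  rw [norm_sq_cfc_apply hK hτ, cfc_add K (fun k => 2 * τ * logWeight τ k)
    (fun k => w τ * logWeight τ k ^ 2) (by fun_prop) (by fun_prop),
    cfc_const_mul _ _ K (by fun_prop), cfc_const_mul _ _ K (by fun_prop)]
  simp only [add_apply, smul_apply, inner_add_right, Complex.add_re]
  congr 1
  rw [← Complex.coe_smul, inner_smul_right, Complex.re_ofReal_mul]

/-- The variational lower bound for a single term of the relative entropy, integrated over `τ`. -/
theorem matrixElement_le_entropyTerm (K : H →L[ℂ] H) (v w : H) {p q : ℝ} (hp : 0 ≤ p)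
    (hq : 0 ≤ q) (hfin : entropyTerm p q * ‖inner ℂ v w‖ₑ ^ 2 ≠ ⊤) :
    p * (starRingEnd ℂ (inner ℂ v w) * inner ℂ v (logMean K w)).re
      - q * (starRingEnd ℂ (inner ℂ v w) * inner ℂ v (logMean K w)).re
      - q * (∫ τ in (0 : ℝ)..1, τ ^ 2 * ‖inner ℂ v (cfc (logWeight τ) K w)‖ ^ 2)
      - p * (∫ τ in (0 : ℝ)..1, τ * (1 - τ) * ‖inner ℂ w (cfc (logWeight τ) K v)‖ ^ 2)
      ≤ (entropyTerm p q * ‖inner ℂ v w‖ₑ ^ 2).toReal := by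
  have hY := continuous_cfc_fun continuous_logWeight K
  have h := integral_le_entropyTerm hp hq (inner ℂ v w)
    (y := fun τ => inner ℂ v (cfc (logWeight τ) K w)) (by fun_prop)
  refine le_of_eq_of_le ?_ ((ENNReal.ofReal_le_iff_le_toReal hfin).1 h)
  have ha : (starRingEnd ℂ (inner ℂ v w) * inner ℂ v (logMean K w)).re
      = ∫ τ in (0 : ℝ)..1, 2 * τ *
        (starRingEnd ℂ (inner ℂ v w) * inner ℂ v (cfc (logWeight τ) K w)).re := by
    have := re_inner_intervalIntegral (F := fun τ => (2 * τ) • cfc (logWeight τ) K) (by fun_prop)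
      ((inner ℂ v w : ℂ) • v) w
    simp only [inner_smul_left] at this
    refine this.trans (intervalIntegral.integral_congr fun τ _ => ?_)
    simp only [smul_apply]
    rw [← Complex.coe_smul, inner_smul_right, mul_left_comm, Complex.re_ofReal_mul]
  have hsymm : ∀ τ, ‖inner ℂ w (cfc (logWeight τ) K v)‖ = ‖inner ℂ v (cfc (logWeight τ) K w)‖ :=
    fun τ => by rw [← inner_cfc_logWeight_left, norm_inner_symm]
  have hre : Continuous fun τ =>
      (starRingEnd ℂ (inner ℂ v w) * inner ℂ v (cfc (logWeight τ) K w)).re := by fun_prop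
  simp only [ha, hsymm]
  rw [← intervalIntegral.integral_const_mul, ← intervalIntegral.integral_const_mul,
    ← intervalIntegral.integral_const_mul, ← intervalIntegral.integral_const_mul,
    ← intervalIntegral.integral_sub, ← intervalIntegral.integral_sub,
    ← intervalIntegral.integral_sub]
  · refine intervalIntegral.integral_congr fun τ _ => ?_
    ring
  all_goals exact Continuous.intervalIntegrable (by fun_prop) _ _

/-- The Gibbs variational inequality `Tr (ρ K) - Tr (σ exp K) + 1 ≤ D(ρ‖σ)` for a bounded
self-adjoint operator `K`, in terms of eigenbases of `ρ` and `σ`. -/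
theorem gibbs_eigenbasis (ψ : HilbertBasis ι ℂ H) {p : ι → ℝ} (hp0 : ∀ i, 0 ≤ p i)
    (hp : HasSum p 1) (χ : HilbertBasis κ ℂ H) {q : κ → ℝ} (hq0 : ∀ j, 0 ≤ q j)
    (hq : HasSum q 1) {K : H →L[ℂ] H} (hK : IsSelfAdjoint K)
    (hD : ∑' ij : ι × κ, entropyTerm (p ij.1) (q ij.2) * ‖inner ℂ (ψ ij.1) (χ ij.2)‖ₑ ^ 2 ≠ ⊤) :
    ∑' i, p i * (inner ℂ (ψ i) (K (ψ i))).re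
      - ∑' j, q j * (inner ℂ (χ j) (cfc Real.exp K (χ j))).re + 1
      ≤ (∑' ij : ι × κ, entropyTerm (p ij.1) (q ij.2)
          * ‖inner ℂ (ψ ij.1) (χ ij.2)‖ₑ ^ 2).toReal := by
  have hY := continuous_cfc_fun continuous_logWeight K
  have hw₁0 : ∀ τ ∈ Set.Icc (0 : ℝ) 1, 0 ≤ τ * (1 - τ) := fun τ hτ =>
    mul_nonneg hτ.1 (by linarith [hτ.2])
  have hw₂0 : ∀ τ ∈ Set.Icc (0 : ℝ) 1, 0 ≤ τ ^ 2 := fun τ hτ => sq_nonneg τ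
  -- the matrix elements that bound the entropy terms from below
  obtain ⟨a, ha⟩ : ∃ a : ι → κ → ℝ, a = fun i j =>
    (starRingEnd ℂ (inner ℂ (ψ i) (χ j)) * inner ℂ (ψ i) (logMean K (χ j))).re := ⟨_, rfl⟩
  obtain ⟨c, hc'⟩ : ∃ c : ι → κ → ℝ, c = fun i j =>
    ∫ τ in (0 : ℝ)..1, τ * (1 - τ) * ‖inner ℂ (χ j) (cfc (logWeight τ) K (ψ i))‖ ^ 2 := ⟨_, rfl⟩
  obtain ⟨b, hb'⟩ : ∃ b : κ → ι → ℝ, b = fun j i =>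
    ∫ τ in (0 : ℝ)..1, τ ^ 2 * ‖inner ℂ (ψ i) (cfc (logWeight τ) K (χ j))‖ ^ 2 := ⟨_, rfl⟩
  obtain ⟨cbar, hcbar'⟩ : ∃ c : ι → ℝ, c = fun i =>
    ∫ τ in (0 : ℝ)..1, τ * (1 - τ) * ‖cfc (logWeight τ) K (ψ i)‖ ^ 2 := ⟨_, rfl⟩
  obtain ⟨bbar, hbbar'⟩ : ∃ b : κ → ℝ, b = fun j =>
    ∫ τ in (0 : ℝ)..1, τ ^ 2 * ‖cfc (logWeight τ) K (χ j)‖ ^ 2 := ⟨_, rfl⟩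
  have hc : ∀ i, (∀ j, 0 ≤ c i j) ∧ Summable (c i) ∧ ∑' j, c i j ≤ cbar i := fun i => by
    rw [hc', hcbar']
    exact summable_integral_norm_sq_inner χ (F := fun τ => cfc (logWeight τ) K (ψ i))
      (by fun_prop) (by fun_prop) hw₁0
  have hb : ∀ j, (∀ i, 0 ≤ b j i) ∧ Summable (b j) ∧ ∑' i, b j i ≤ bbar j := fun j => by
    rw [hb', hbbar']
    exact summable_integral_norm_sq_inner ψ (F := fun τ => cfc (logWeight τ) K (χ j))
      (by fun_prop) (by fun_prop) hw₂0
  obtain ⟨M, hM⟩ := (isCompact_Icc (a := (0 : ℝ)) (b := 1)).exists_bound_of_continuousOn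
    hY.continuousOn
  have hbound : ∀ {w : ℝ → ℝ} (_ : Continuous w) (_ : ∀ τ ∈ Set.Icc (0 : ℝ) 1, 0 ≤ w τ) (v : H),
      ‖v‖ = 1 → |∫ τ in (0 : ℝ)..1, w τ * ‖cfc (logWeight τ) K v‖ ^ 2|
        ≤ ∫ τ in (0 : ℝ)..1, w τ * M ^ 2 := by
    intro w hw hw0 v hv
    rw [abs_of_nonneg (intervalIntegral.integral_nonneg zero_le_one fun τ hτ =>
      mul_nonneg (hw0 τ hτ) (by positivity))]
    refine intervalIntegral.integral_mono_on zero_le_one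
      (Continuous.intervalIntegrable (by fun_prop) _ _)
      (Continuous.intervalIntegrable (by fun_prop) _ _) fun τ hτ => ?_
    have h1 : ‖cfc (logWeight τ) K v‖ ≤ M := by
      simpa [hv] using (cfc (logWeight τ) K).le_of_opNorm_le (hM τ hτ) v
    have := hw0 τ hτ
    gcongr
  have hψ1 := ψ.orthonormal.1
  have hχ1 := χ.orthonormal.1
  obtain ⟨M₁, hcbar⟩ : ∃ C, ∀ i, |cbar i| ≤ C :=
    ⟨_, fun i => by rw [hcbar']; exact hbound (by fun_prop) hw₁0 _ (hψ1 i)⟩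
  obtain ⟨M₂, hbbar⟩ : ∃ C, ∀ j, |bbar j| ≤ C :=
    ⟨_, fun j => by rw [hbbar']; exact hbound (by fun_prop) hw₂0 _ (hχ1 j)⟩
  have hasym : ∀ i j, a i j
      = (starRingEnd ℂ (inner ℂ (χ j) (ψ i)) * inner ℂ (χ j) (logMean K (ψ i))).re := fun i j => by
    rw [ha]
    simp only
    rw [← inner_logMean_left hK (ψ i) (χ j), inner_conj_symm, inner_conj_symm, ← inner_conj_symm,
      ← inner_conj_symm (logMean K (ψ i)), ← map_mul, Complex.conj_re]
  have hterm : ∀ i j, p i * a i j - q j * a i j - q j * b j i - p i * c i j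
      ≤ (entropyTerm (p i) (q j) * ‖inner ℂ (ψ i) (χ j)‖ₑ ^ 2).toReal := fun i j => by
    rw [ha, hb', hc']
    exact matrixElement_le_entropyTerm K (ψ i) (χ j) (hp0 i) (hq0 j)
      (ENNReal.ne_top_of_tsum_ne_top hD (i, j))
  -- summability of the four double series
  have hpa_abs : ∀ i, Summable (fun j => |a i j|) ∧
      ∑' j, |a i j| ≤ 1 + ‖logMean K‖ ^ 2 := fun i => by
    simp only [hasym]
    obtain ⟨h1, h2⟩ := summable_abs_re_conj_inner_mul χ (logMean K) (ψ i)
    refine ⟨h1, h2.trans ?_⟩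
    have := (logMean K).le_opNorm (ψ i)
    rw [hψ1, mul_one] at this
    rw [hψ1, one_pow]
    gcongr
  have hqa_abs : ∀ j, Summable (fun i => |a i j|) ∧
      ∑' i, |a i j| ≤ 1 + ‖logMean K‖ ^ 2 := fun j => by
    rw [ha]
    obtain ⟨h1, h2⟩ := summable_abs_re_conj_inner_mul ψ (logMean K) (χ j)
    refine ⟨h1, h2.trans ?_⟩
    have := (logMean K).le_opNorm (χ j)
    rw [hχ1, mul_one] at this
    rw [hχ1, one_pow]
    gcongr
  have hc_abs : ∀ i, Summable (fun j => |c i j|) ∧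
      ∑' j, |c i j| ≤ M₁ := fun i => by
    simp only [fun j => abs_of_nonneg ((hc i).1 j)]
    exact ⟨(hc i).2.1, (hc i).2.2.trans ((le_abs_self _).trans (hcbar i))⟩
  have hb_abs : ∀ j, Summable (fun i => |b j i|) ∧
      ∑' i, |b j i| ≤ M₂ := fun j => by
    simp only [fun i => abs_of_nonneg ((hb j).1 i)]
    exact ⟨(hb j).2.1, (hb j).2.2.trans ((le_abs_self _).trans (hbbar j))⟩
  have hmain := tsum_sub_le_of_forall_le hp0 hp.summable hq0 hq.summable
    (ENNReal.summable_toReal hD) hterm hpa_abs hqa_abs hb_abs hc_abs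
  rw [← ENNReal.tsum_toReal_eq fun ij => ENNReal.ne_top_of_tsum_ne_top hD ij] at hmain
  refine le_trans ?_ hmain
  have e1 : ∀ i, ∑' j, a i j = (inner ℂ (ψ i) (logMean K (ψ i))).re := fun i => by
    simp only [hasym]
    exact (hasSum_re_conj_inner_mul χ (logMean K) (ψ i)).tsum_eq
  have e2 : ∀ j, ∑' i, a i j = (inner ℂ (χ j) (logMean K (χ j))).re := fun j => by
    rw [ha]
    exact (hasSum_re_conj_inner_mul ψ (logMean K) (χ j)).tsum_eq
  simp only [e1, e2]
  -- the two integral identities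
  have f1 : ∀ i, (inner ℂ (ψ i) (logMean K (ψ i))).re
      = (inner ℂ (ψ i) (K (ψ i))).re + cbar i := fun i => by
    have h := re_inner_integral_add hK (w := fun τ => -(τ * (1 - τ))) (by fun_prop) (ψ i)
    simp only [neg_mul, intervalIntegral.integral_neg, ← sub_eq_add_neg] at h
    have h2 : (fun k => ∫ τ in (0 : ℝ)..1,
        (2 * τ * logWeight τ k - τ * (1 - τ) * logWeight τ k ^ 2)) = id :=
      funext fun k => integral_logWeight_log k
    rw [h2, cfc_id ℝ K] at h
    rw [hcbar']
    linarith
  have f2 : ∀ j, (inner ℂ (χ j) (logMean K (χ j))).re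
      = (inner ℂ (χ j) (cfc Real.exp K (χ j))).re - 1 - bbar j := fun j => by
    have h := re_inner_integral_add hK (w := fun τ => τ ^ 2) (by fun_prop) (χ j)
    have h2 : (fun k => ∫ τ in (0 : ℝ)..1, (2 * τ * logWeight τ k + τ ^ 2 * logWeight τ k ^ 2))
        = fun k => Real.exp k - 1 := funext fun k => integral_logWeight_exp k
    rw [h2, cfc_sub Real.exp (fun _ => 1) K, cfc_const_one ℝ K] at h
    simp only [sub_apply, one_apply_eq_self, inner_sub_right, Complex.sub_re,
      inner_self_eq_norm_sq_to_K, hχ1] at h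
    rw [hbbar']
    simp at h
    linarith
  have hop : ∀ (T : H →L[ℂ] H) (v : H), ‖v‖ = 1 → |(inner ℂ v (T v)).re| ≤ ‖T‖ := by
    intro T v hv
    refine (Complex.abs_re_le_norm _).trans ((norm_inner_le_norm _ _).trans ?_)
    simpa [hv] using T.le_opNorm v
  have u1 := summable_mul_of_abs_le hp0 hp.summable fun i => hop K (ψ i) (hψ1 i)
  have u2 := summable_mul_of_abs_le hp0 hp.summable hcbar
  have u3 := summable_mul_of_abs_le hq0 hq.summable fun j => hop (cfc Real.exp K) (χ j) (hχ1 j)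
  have u4 := summable_mul_of_abs_le hq0 hq.summable hbbar
  have v1 : ∑' i, p i * (inner ℂ (ψ i) (logMean K (ψ i))).re
      = ∑' i, p i * (inner ℂ (ψ i) (K (ψ i))).re + ∑' i, p i * cbar i := by
    rw [← u1.tsum_add u2]
    exact tsum_congr fun i => by rw [f1]; ring
  have v2 : ∑' j, q j * (inner ℂ (χ j) (logMean K (χ j))).re
      = ∑' j, q j * (inner ℂ (χ j) (cfc Real.exp K (χ j))).re - 1 - ∑' j, q j * bbar j := by
    rw [← hq.tsum_eq, ← u3.tsum_sub hq.summable, ← (u3.sub hq.summable).tsum_sub u4]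
    exact tsum_congr fun i => by rw [f2]; ring
  have w1 : ∑' i, p i * ∑' j, c i j ≤ ∑' i, p i * cbar i := by
    refine Summable.tsum_le_tsum (fun i => mul_le_mul_of_nonneg_left (hc i).2.2 (hp0 i)) ?_ u2
    refine Summable.of_nonneg_of_le (fun i => mul_nonneg (hp0 i) (tsum_nonneg (hc i).1))
      (fun i => mul_le_mul_of_nonneg_left (hc i).2.2 (hp0 i)) u2
  have w2 : ∑' j, q j * ∑' i, b j i ≤ ∑' j, q j * bbar j := by
    refine Summable.tsum_le_tsum (fun i => mul_le_mul_of_nonneg_left (hb i).2.2 (hq0 i)) ?_ u4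
    refine Summable.of_nonneg_of_le (fun i => mul_nonneg (hq0 i) (tsum_nonneg (hb i).1))
      (fun i => mul_le_mul_of_nonneg_left (hb i).2.2 (hq0 i)) u4
  -- the quadratic terms cancel up to the two Bessel inequalities `w1` and `w2`
  rw [v1, v2]
  linarith

end Gibbs

section GibbsMean

variable {H ι κ : Type*} [NormedAddCommGroup H] [InnerProductSpace ℂ H] [CompleteSpace H]

theorem cfc_exp_sub_smul_one {T : H →L[ℂ] H} (hT : IsSelfAdjoint T) (c : ℝ) :
    cfc Real.exp (T - c • (1 : H →L[ℂ] H)) = Real.exp (-c) • NormedSpace.exp T := by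
  have hsa : IsSelfAdjoint (T - c • (1 : H →L[ℂ] H)) :=
    hT.sub ((IsSelfAdjoint.all c).smul (IsSelfAdjoint.one _))
  rw [CFC.real_exp_eq_normedSpace_exp hsa, sub_eq_add_neg, ← neg_smul]
  have hcomm : Commute T ((-c) • (1 : H →L[ℂ] H)) := (Commute.one_right T).smul_right _
  let : NormedAlgebra ℚ (H →L[ℂ] H) := NormedAlgebra.restrictScalars ℚ ℂ _
  rw [NormedSpace.exp_add_of_commute hcomm]
  have h1 : NormedSpace.exp ((-c) • (1 : H →L[ℂ] H)) = Real.exp (-c) • (1 : H →L[ℂ] H) := by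
    rw [← Algebra.algebraMap_eq_smul_one, ← Algebra.algebraMap_eq_smul_one,
      ← NormedSpace.algebraMap_exp_comm, Real.exp_eq_exp_ℝ]
  rw [h1, mul_smul_comm, mul_one]

/-- The Gibbs variational inequality `Tr (ρ T) ≤ D(ρ‖σ) + ln Tr (σ exp T)` for a bounded positive
operator `T`. -/
theorem mean_le_relEntropy_add_log {ρ σ T : H →L[ℂ] H} (hρ : IsDensity ρ) (hσ : IsDensity σ)
    (hT : T.IsPositive) (hD : relEntropy ρ σ ≠ ⊤) {Z : ℝ} (hZ0 : 0 < Z)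
    (hZ : mean σ (fun v => ENNReal.ofReal (inner ℂ v (NormedSpace.exp T v)).re)
      ≤ ENNReal.ofReal Z) :
    mean ρ (fun v => ENNReal.ofReal (inner ℂ v (T v)).re)
      ≤ ENNReal.ofReal ((relEntropy ρ σ).toReal + Real.log Z) := by
  obtain ⟨s, ψ, p, hψ, hp0, hp⟩ := hρ.exists_eigenbasis
  obtain ⟨s', χ, q, hχ, hq0, hq⟩ := hσ.exists_eigenbasis
  have hexp : (NormedSpace.exp T).IsPositive :=
    (ContinuousLinearMap.nonneg_iff_isPositive _).1 hT.isSelfAdjoint.exp_nonneg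
  rw [mean_re_inner hσ.1 χ hq0 hχ hexp] at hZ
  rw [mean_re_inner hρ.1 ψ hp0 hψ hT]
  have hop : ∀ (T : H →L[ℂ] H) (v : H), ‖v‖ = 1 → |(inner ℂ v (T v)).re| ≤ ‖T‖ := by
    intro T v hv
    refine (Complex.abs_re_le_norm _).trans ((norm_inner_le_norm _ _).trans ?_)
    simpa [hv] using T.le_opNorm v
  have hT0 : ∀ i, 0 ≤ p i * (inner ℂ (ψ i) (T (ψ i))).re := fun i =>
    mul_nonneg (hp0 i) (hT.re_inner_nonneg_right _)
  have hexp0 : ∀ i, 0 ≤ q i * (inner ℂ (χ i) (NormedSpace.exp T (χ i))).re := fun i =>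
    mul_nonneg (hq0 i) (hexp.re_inner_nonneg_right _)
  have hs1 := summable_mul_of_abs_le hp0 hp.summable fun i => hop T (ψ i) (ψ.orthonormal.1 i)
  have hs2 := summable_mul_of_abs_le hq0 hq.summable fun i =>
    hop (NormedSpace.exp T) (χ i) (χ.orthonormal.1 i)
  rw [← ENNReal.ofReal_tsum_of_nonneg hT0 hs1]
  rw [← ENNReal.ofReal_tsum_of_nonneg hexp0 hs2,
    ENNReal.ofReal_le_ofReal_iff hZ0.le] at hZ
  refine ENNReal.ofReal_le_ofReal ?_
  rw [relEntropy_eq_tsum hρ.1 hσ.1 ψ hψ χ hχ] at hD ⊢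
  have hsa : IsSelfAdjoint (T - Real.log Z • (1 : H →L[ℂ] H)) :=
    hT.isSelfAdjoint.sub ((IsSelfAdjoint.all _).smul (IsSelfAdjoint.one _))
  have h := gibbs_eigenbasis ψ hp0 hp χ hq0 hq hsa hD
  rw [cfc_exp_sub_smul_one hT.isSelfAdjoint, Real.exp_neg, Real.exp_log hZ0] at h
  have e1 : ∑' i, p i * (inner ℂ (ψ i) ((T - Real.log Z • (1 : H →L[ℂ] H)) (ψ i))).re
      = ∑' i, p i * (inner ℂ (ψ i) (T (ψ i))).re - Real.log Z := by
    have hlog : Real.log Z = ∑' i, Real.log Z * p i := by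
      rw [tsum_mul_left, hp.tsum_eq, mul_one]
    conv_rhs => rw [hlog, ← hs1.tsum_sub (hp.summable.mul_left _)]
    refine tsum_congr fun i => ?_
    simp only [sub_apply, smul_apply, one_apply_eq_self, inner_sub_right, Complex.sub_re]
    rw [← Complex.coe_smul, inner_smul_right, Complex.re_ofReal_mul, inner_self_eq_norm_sq_to_K,
      ψ.orthonormal.1 i]
    simp
    ring
  have e2 : ∑' j, q j * (inner ℂ (χ j) ((Z⁻¹ • NormedSpace.exp T) (χ j))).re
      = Z⁻¹ * ∑' j, q j * (inner ℂ (χ j) (NormedSpace.exp T (χ j))).re := by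
    rw [← tsum_mul_left]
    refine tsum_congr fun j => ?_
    rw [smul_apply, ← Complex.coe_smul, inner_smul_right, Complex.re_ofReal_mul]
    ring
  rw [e1, e2] at h
  have h3 : Z⁻¹ * ∑' j, q j * (inner ℂ (χ j) (NormedSpace.exp T (χ j))).re ≤ 1 := by
    rw [inv_mul_le_iff₀ hZ0, mul_one]
    exact hZ
  linarith

end GibbsMean

/-! ### Closed quadratic forms and Yosida approximations -/

theorem inner_self_eq_ofReal {E : Type*} [NormedAddCommGroup E] [InnerProductSpace ℂ E] (x : E) :
    inner ℂ x x = ((‖x‖ ^ 2 : ℝ) : ℂ) := by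
  rw [inner_self_eq_norm_sq_to_K]
  norm_cast

/-- A closed nonnegative quadratic form on a Hilbert space, with the value `∞` off its domain.
Closedness is encoded as lower semicontinuity of `form`, and `bil` is the sesquilinear form, which
is only meaningful on the domain of `form`. -/
structure ClosedForm (E : Type*) [NormedAddCommGroup E] [InnerProductSpace ℂ E] where
  form : E → ℝ≥0∞
  bil : E → E → ℂ
  lsc : LowerSemicontinuous form
  zero_ne_top : form 0 ≠ ⊤
  add_ne_top : ∀ {u v}, form u ≠ ⊤ → form v ≠ ⊤ → form (u + v) ≠ ⊤
  smul_ne_top : ∀ {u} (c : ℂ), form u ≠ ⊤ → form (c • u) ≠ ⊤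
  bil_conj : ∀ {u v}, form u ≠ ⊤ → form v ≠ ⊤ → starRingEnd ℂ (bil v u) = bil u v
  bil_add_left : ∀ {u v w}, form u ≠ ⊤ → form v ≠ ⊤ → form w ≠ ⊤ →
    bil (u + v) w = bil u w + bil v w
  bil_smul_left : ∀ {u w} (c : ℂ), form u ≠ ⊤ → form w ≠ ⊤ →
    bil (c • u) w = starRingEnd ℂ c * bil u w
  bil_self : ∀ {u}, form u ≠ ⊤ → bil u u = ((form u).toReal : ℂ)

namespace ClosedForm

variable {E : Type*} [NormedAddCommGroup E] [InnerProductSpace ℂ E] (q : ClosedForm E)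

/-- The domain of a closed form. -/
def domain : Submodule ℂ E where
  carrier := {v | q.form v ≠ ⊤}
  zero_mem' := q.zero_ne_top
  add_mem' := q.add_ne_top
  smul_mem' c _ := q.smul_ne_top c

/-- The domain of a closed form `q`, equipped with the inner product `⟪u, v⟫ + ε q(u, v)`; a type
synonym, because the domain also carries the norm of the ambient space. -/
def FormDomain (_ε : {ε : ℝ // 0 < ε}) : Type _ := q.domain

variable (ε : {ε : ℝ // 0 < ε})

instance : AddCommGroup (q.FormDomain ε) := inferInstanceAs (AddCommGroup q.domain)

instance : Module ℂ (q.FormDomain ε) := inferInstanceAs (Module ℂ q.domain)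

/-- The inclusion of the form domain into the ambient space, as a linear map. -/
def FormDomain.incl : q.FormDomain ε →ₗ[ℂ] E := q.domain.subtype

/-- A vector of finite form, as an element of the form domain. -/
def FormDomain.mk (v : E) (hv : q.form v ≠ ⊤) : q.FormDomain ε := (⟨v, hv⟩ : q.domain)

theorem FormDomain.incl_mk (v : E) (hv : q.form v ≠ ⊤) :
    FormDomain.incl q ε (FormDomain.mk q ε v hv) = v := rfl

theorem FormDomain.ne_top (u : q.FormDomain ε) : q.form (FormDomain.incl q ε u) ≠ ⊤ := u.2

/-- The inner product `⟪u, v⟫ + ε q(u, v)` on the form domain. -/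
@[reducible] def FormDomain.core : InnerProductSpace.Core ℂ (q.FormDomain ε) where
  inner u v := inner ℂ (FormDomain.incl q ε u) (FormDomain.incl q ε v)
    + (ε.1 : ℂ) * q.bil (FormDomain.incl q ε u) (FormDomain.incl q ε v)
  conj_inner_symm u v := by
    rw [map_add, inner_conj_symm, map_mul, Complex.conj_ofReal, q.bil_conj u.ne_top v.ne_top]
  re_inner_nonneg u := by
    rw [q.bil_self u.ne_top, inner_self_eq_ofReal, ← Complex.ofReal_mul, ← Complex.ofReal_add]
    have := ε.2
    change 0 ≤ ‖_‖ ^ 2 + _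
    positivity
  add_left u v w := by
    rw [map_add, inner_add_left, q.bil_add_left u.ne_top v.ne_top w.ne_top]
    ring
  smul_left u v c := by
    rw [map_smul, inner_smul_left, q.bil_smul_left c u.ne_top v.ne_top]
    ring
  definite u hu := by
    rw [q.bil_self u.ne_top, inner_self_eq_ofReal, ← Complex.ofReal_mul, ← Complex.ofReal_add,
      Complex.ofReal_eq_zero] at hu
    have h0 : 0 ≤ ε.1 * (q.form (FormDomain.incl q ε u)).toReal := by
      have := ε.2
      positivity
    have h1 : ‖FormDomain.incl q ε u‖ ^ 2 = 0 := le_antisymm (by linarith) (by positivity)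
    have h2 : FormDomain.incl q ε u = 0 := by simpa using h1
    exact Subtype.ext h2

instance : NormedAddCommGroup (q.FormDomain ε) :=
  (FormDomain.core q ε).toNormedAddCommGroup

instance : InnerProductSpace ℂ (q.FormDomain ε) :=
  InnerProductSpace.ofCore (FormDomain.core q ε).toCore

theorem FormDomain.inner_def (u v : q.FormDomain ε) :
    inner ℂ u v = inner ℂ (FormDomain.incl q ε u) (FormDomain.incl q ε v)
      + (ε.1 : ℂ) * q.bil (FormDomain.incl q ε u) (FormDomain.incl q ε v) := rfl

theorem FormDomain.norm_sq (u : q.FormDomain ε) :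
    ‖u‖ ^ 2 = ‖FormDomain.incl q ε u‖ ^ 2 + ε.1 * (q.form (FormDomain.incl q ε u)).toReal := by
  have h := inner_self_eq_ofReal u
  rw [FormDomain.inner_def, q.bil_self u.ne_top, inner_self_eq_ofReal,
    ← Complex.ofReal_mul, ← Complex.ofReal_add] at h
  exact (Complex.ofReal_injective h).symm

theorem FormDomain.norm_incl_le (u : q.FormDomain ε) : ‖FormDomain.incl q ε u‖ ≤ ‖u‖ := by
  refine le_of_sq_le_sq ?_ (norm_nonneg _)
  rw [FormDomain.norm_sq]
  have := ε.2
  have : 0 ≤ ε.1 * (q.form (FormDomain.incl q ε u)).toReal := by positivity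
  linarith

/-- The inclusion of the form domain into the ambient space, as a contraction. -/
def FormDomain.inclL : q.FormDomain ε →L[ℂ] E :=
  (FormDomain.incl q ε).mkContinuous 1 fun u => by
    rw [one_mul]; exact FormDomain.norm_incl_le q ε u

instance [CompleteSpace E] : CompleteSpace (q.FormDomain ε) := by
  refine Metric.complete_of_cauchySeq_tendsto fun u hu => ?_
  have hε := ε.2
  have hι : CauchySeq fun n => FormDomain.inclL q ε (u n) :=
    (FormDomain.inclL q ε).uniformContinuous.comp_cauchySeq hu
  obtain ⟨v, hv⟩ := cauchySeq_tendsto_of_complete hι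
  -- closedness of the form bounds `q (u n - v)` by the Cauchy modulus of `u`
  have key : ∀ δ > 0, ∃ N, ∀ n ≥ N, q.form (FormDomain.incl q ε (u n) - v)
      ≤ ENNReal.ofReal (δ ^ 2 / ε.1) := by
    intro δ hδ
    obtain ⟨N, hN⟩ := Metric.cauchySeq_iff.1 hu δ hδ
    refine ⟨N, fun n hn => ?_⟩
    have hcl := q.lsc.isClosed_preimage (ENNReal.ofReal (δ ^ 2 / ε.1))
    refine hcl.mem_of_tendsto (tendsto_const_nhds.sub hv) ?_
    filter_upwards [Filter.eventually_ge_atTop N] with m hm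
    have h1 := hN n hn m hm
    rw [dist_eq_norm] at h1
    have h2 := FormDomain.norm_sq q ε (u n - u m)
    change q.form (FormDomain.incl q ε (u n) - FormDomain.incl q ε (u m)) ≤ _
    rw [← map_sub, ENNReal.le_ofReal_iff_toReal_le (FormDomain.ne_top q ε _) (by positivity),
      le_div_iff₀ hε]
    have h3 : ‖u n - u m‖ ^ 2 ≤ δ ^ 2 := by gcongr
    nlinarith [sq_nonneg ‖FormDomain.incl q ε (u n - u m)‖]
  have hvdom : q.form v ≠ ⊤ := by
    obtain ⟨N, hN⟩ := key 1 one_pos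
    have h1 : FormDomain.incl q ε (u N) - v ∈ q.domain :=
      ne_top_of_le_ne_top ENNReal.ofReal_ne_top (hN N le_rfl)
    have h2 : FormDomain.incl q ε (u N) ∈ q.domain := (u N).ne_top
    have h3 := q.domain.sub_mem h2 h1
    rwa [sub_sub_cancel] at h3
  refine ⟨FormDomain.mk q ε v hvdom, ?_⟩
  rw [Metric.tendsto_atTop]
  intro e he
  obtain ⟨N₁, hN₁⟩ := key (e / 2) (by positivity)
  obtain ⟨N₂, hN₂⟩ := Metric.tendsto_atTop.1 hv (e / 2) (by positivity)
  refine ⟨max N₁ N₂, fun n hn => ?_⟩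
  have h1 := hN₁ n (le_trans (le_max_left _ _) hn)
  have h2 := hN₂ n (le_trans (le_max_right _ _) hn)
  rw [dist_eq_norm] at h2 ⊢
  refine lt_of_pow_lt_pow_left₀ 2 he.le ?_
  rw [FormDomain.norm_sq, map_sub, FormDomain.incl_mk]
  have h3 : (q.form (FormDomain.incl q ε (u n) - v)).toReal ≤ (e / 2) ^ 2 / ε.1 :=
    ENNReal.toReal_le_of_le_ofReal (by positivity) h1
  rw [le_div_iff₀ hε] at h3
  have h4 : ‖FormDomain.incl q ε (u n) - v‖ ^ 2 ≤ (e / 2) ^ 2 := by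
    have : ‖FormDomain.incl q ε (u n) - v‖ < e / 2 := h2
    gcongr
  nlinarith

variable [CompleteSpace E]

/-- `R` is the resolvent `(1 + ε φ)⁻¹` of the self-adjoint operator `φ` of the form `q`. -/
def IsResolvent (ε : ℝ) (R : E →L[ℂ] E) : Prop :=
  ∀ y, q.form (R y) ≠ ⊤ ∧
    ∀ u, q.form u ≠ ⊤ → inner ℂ u (R y) + (ε : ℂ) * q.bil u (R y) = inner ℂ u y

/-- The resolvent exists: it is `ι ι*` for the inclusion `ι` of the form domain. -/
theorem exists_isResolvent {ε : ℝ} (hε : 0 < ε) : ∃ R, q.IsResolvent ε R := by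
  let ι := FormDomain.inclL q ⟨ε, hε⟩
  refine ⟨ι ∘L ι.adjoint, fun y => ⟨(ι.adjoint y).ne_top, fun u hu => ?_⟩⟩
  have h := ι.adjoint_inner_right (FormDomain.mk q ⟨ε, hε⟩ u hu) y
  rw [FormDomain.inner_def] at h
  exact h

/-- The Yosida approximation `φ (1 + ε φ)⁻¹ = ε⁻¹ (1 - R)`. -/
def yosida (ε : ℝ) (R : E →L[ℂ] E) : E →L[ℂ] E := (ε⁻¹ : ℂ) • (1 - R)

theorem yosida_apply (ε : ℝ) (R : E →L[ℂ] E) (x : E) :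
    yosida ε R x = (ε⁻¹ : ℂ) • (x - R x) := rfl

theorem re_inner_yosida (ε : ℝ) (R : E →L[ℂ] E) (x : E) :
    (inner ℂ x (yosida ε R x)).re = ε⁻¹ * (‖x‖ ^ 2 - (inner ℂ x (R x)).re) := by
  rw [yosida_apply, inner_smul_right, inner_sub_right, inner_self_eq_ofReal, ← Complex.ofReal_inv,
    Complex.re_ofReal_mul, Complex.sub_re, Complex.ofReal_re]

namespace IsResolvent

variable {q} {ε : ℝ} {R : E →L[ℂ] E}

theorem inner_left (hR : q.IsResolvent ε R) (x y : E) : inner ℂ (R x) y = inner ℂ x (R y) := by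
  rw [← (hR y).2 _ (hR x).1, ← inner_conj_symm x, ← (hR x).2 _ (hR y).1, map_add, map_mul,
    inner_conj_symm, Complex.conj_ofReal, q.bil_conj (hR x).1 (hR y).1]

theorem inner_self (hR : q.IsResolvent ε R) (x : E) :
    inner ℂ x (R x) = ((‖R x‖ ^ 2 + ε * (q.form (R x)).toReal : ℝ) : ℂ) := by
  rw [← hR.inner_left, ← (hR x).2 _ (hR x).1, q.bil_self (hR x).1, inner_self_eq_ofReal]
  push_cast
  ring

theorem re_inner_self (hR : q.IsResolvent ε R) (x : E) :
    (inner ℂ x (R x)).re = ‖R x‖ ^ 2 + ε * (q.form (R x)).toReal := by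
  rw [hR.inner_self, Complex.ofReal_re]

theorem norm_apply_le (hR : q.IsResolvent ε R) (hε : 0 < ε) (x : E) : ‖R x‖ ≤ ‖x‖ := by
  have h1 := hR.re_inner_self x
  have h2 : (inner ℂ x (R x)).re ≤ ‖x‖ * ‖R x‖ :=
    (Complex.re_le_norm _).trans (norm_inner_le_norm _ _)
  have h3 : 0 ≤ ε * (q.form (R x)).toReal := by positivity
  by_contra h
  push Not at h
  nlinarith [norm_nonneg x, norm_nonneg (R x)]

theorem norm_pow_apply_le (hR : q.IsResolvent ε R) (hε : 0 < ε) (k : ℕ) (x : E) :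
    ‖(R ^ k) x‖ ≤ ‖x‖ := by
  induction k with
  | zero => simp
  | succ k ih =>
    rw [pow_succ']
    exact (hR.norm_apply_le hε _).trans ih

theorem yosida_isPositive (hR : q.IsResolvent ε R) (hε : 0 < ε) : (yosida ε R).IsPositive := by
  refine ContinuousLinearMap.isPositive_def'.2 ⟨?_, fun x => ?_⟩
  · rw [ContinuousLinearMap.isSelfAdjoint_iff_isSymmetric]
    intro x y
    simp only [ContinuousLinearMap.coe_coe, yosida_apply]
    rw [inner_smul_left, inner_smul_right, inner_sub_left, inner_sub_right, hR.inner_left,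
      ← Complex.ofReal_inv, Complex.conj_ofReal]
  · rw [ContinuousLinearMap.reApplyInnerSelf_apply, inner_re_symm]
    change 0 ≤ (inner ℂ x (yosida ε R x)).re
    rw [re_inner_yosida]
    have h1 : (inner ℂ x (R x)).re ≤ ‖x‖ * ‖R x‖ :=
      (Complex.re_le_norm _).trans (norm_inner_le_norm _ _)
    have h2 := hR.norm_apply_le hε x
    refine mul_nonneg (by positivity) ?_
    nlinarith [norm_nonneg x]

theorem form_apply_le (hR : q.IsResolvent ε R) (hε : 0 < ε) (x : E) :
    (q.form (R x)).toReal ≤ (inner ℂ x (yosida ε R x)).re := by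
  rw [re_inner_yosida, inv_mul_eq_div, le_div_iff₀ hε, hR.re_inner_self]
  have h1 := hR.re_inner_self x
  have h2 : (inner ℂ x (R x)).re ≤ ‖x‖ * ‖R x‖ :=
    (Complex.re_le_norm _).trans (norm_inner_le_norm _ _)
  nlinarith [sq_nonneg (‖x‖ - ‖R x‖)]

theorem norm_sub_sq_le (hR : q.IsResolvent ε R) (hε : 0 < ε) (x : E) :
    ‖x - R x‖ ^ 2 ≤ ε * (inner ℂ x (yosida ε R x)).re := by
  rw [re_inner_yosida, mul_inv_cancel_left₀ hε.ne']
  have h := norm_sub_sq (𝕜 := ℂ) x (R x)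
  change _ = ‖x‖ ^ 2 - 2 * (inner ℂ x (R x)).re + _ at h
  have h1 := hR.re_inner_self x
  have h3 : 0 ≤ ε * (q.form (R x)).toReal := by positivity
  linarith

/-- The form of `φ` at `x`, on and off the domain, is at most the lower limit of its Yosida
approximations: if these stay bounded, then `R x → x` with bounded `q (R x)`, and `q` is closed. -/
theorem form_le_liminf {ε : ℕ → ℝ} {R : ℕ → E →L[ℂ] E} (hR : ∀ n, q.IsResolvent (ε n) (R n))
    (hε : ∀ n, 0 < ε n) (hlim : Filter.Tendsto ε Filter.atTop (nhds 0)) (x : E) :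
    q.form x ≤ Filter.liminf
      (fun n => ENNReal.ofReal (inner ℂ x (yosida (ε n) (R n) x)).re) Filter.atTop := by
  by_contra h
  push Not at h
  obtain ⟨a, ha1, ha2⟩ := exists_between h
  have hatop : a ≠ ⊤ := ha2.ne_top
  have hfreq := Filter.frequently_lt_of_liminf_lt (by isBoundedDefault) ha1
  obtain ⟨δ, hδ, hball⟩ := Metric.eventually_nhds_iff.1 (q.lsc x a ha2)
  have hev : ∀ᶠ n in Filter.atTop, ε n * a.toReal < δ ^ 2 := by
    have : Filter.Tendsto (fun n => ε n * a.toReal) Filter.atTop (nhds (0 * a.toReal)) :=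
      hlim.mul_const _
    rw [zero_mul] at this
    exact this.eventually_lt_const (by positivity)
  obtain ⟨n, hn1, hn2⟩ := (hfreq.and_eventually hev).exists
  have h1 : (inner ℂ x (yosida (ε n) (R n) x)).re ≤ a.toReal :=
    (ENNReal.ofReal_le_iff_le_toReal hatop).1 hn1.le
  have h2 : dist (R n x) x < δ := by
    rw [dist_comm, dist_eq_norm]
    refine lt_of_pow_lt_pow_left₀ 2 hδ.le ((hR n).norm_sub_sq_le (hε n) x |>.trans_lt ?_)
    exact (mul_le_mul_of_nonneg_left h1 (hε n).le).trans_lt hn2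
  have h3 := hball h2
  have h4 := (hR n).form_apply_le (hε n) x
  rw [← ENNReal.le_ofReal_iff_toReal_le ((hR n) x).1 (ENNReal.toReal_nonneg.trans h4)] at h4
  exact (h3.trans_le h4).not_ge hn1.le

theorem re_inner_yosida_le (hR : q.IsResolvent ε R) (hε : 0 < ε) {x : E} (hx : q.form x ≠ ⊤) :
    (inner ℂ x (yosida ε R x)).re ≤ (q.form x).toReal := by
  -- `⟪x, φ_ε x⟫ = q(x, R x)`, and `q(x - R x) ≥ 0`
  have hRx := (hR x).1
  have h1 := (hR x).2 x hx
  have hb : (q.bil x (R x)).re = (inner ℂ x (yosida ε R x)).re := by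
    rw [re_inner_yosida, inv_mul_eq_div, eq_div_iff hε.ne']
    have := congrArg Complex.re h1
    rw [inner_self_eq_ofReal, Complex.add_re, Complex.re_ofReal_mul, Complex.ofReal_re] at this
    linarith
  have hneg : q.form ((-1 : ℂ) • R x) ≠ ⊤ := q.smul_ne_top _ hRx
  have hd := q.add_ne_top hx hneg
  have h2 := q.bil_self hd
  have hr : ∀ {u}, q.form u ≠ ⊤ → q.bil u (x + (-1 : ℂ) • R x) = q.bil u x - q.bil u (R x) := by
    intro u hu
    rw [← q.bil_conj hu hd, q.bil_add_left hx hneg hu, q.bil_smul_left _ hRx hu, map_add, map_mul,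
      q.bil_conj hu hx, q.bil_conj hu hRx]
    simp
    ring
  rw [q.bil_add_left hx hneg hd, q.bil_smul_left _ hRx hd, hr hx, hr hRx, q.bil_self hx,
    q.bil_self hRx, ← q.bil_conj hRx hx] at h2
  have h3 := congrArg Complex.re h2
  simp at h3
  have h4 := hR.form_apply_le hε x
  have h5 : 0 ≤ (q.form (x + -R x)).toReal := ENNReal.toReal_nonneg
  linarith

theorem re_inner_yosida_apply_le (hR : q.IsResolvent ε R) (hε : 0 < ε) (x : E) :
    (inner ℂ (R x) (yosida ε R (R x))).re ≤ (inner ℂ x (yosida ε R x)).re := by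
  simp only [yosida_apply, inner_smul_right, ← Complex.ofReal_inv, Complex.re_ofReal_mul]
  refine mul_le_mul_of_nonneg_left ?_ (by positivity)
  set d := x - R x with hd
  have hRd : R x - R (R x) = R d := by rw [hd, map_sub]
  have h1 : inner ℂ x d - inner ℂ (R x) (R d) = inner ℂ d d + inner ℂ d (R d) := by
    have hx : x = d + R x := by rw [hd]; abel
    have h2 : inner ℂ x d = inner ℂ d d + inner ℂ x (R d) := by
      conv_lhs => rw [hx, inner_add_left, hR.inner_left]
    rw [h2, hd, inner_sub_left x (R x) (R _)]
    ring
  have h3 := congrArg Complex.re h1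
  rw [inner_self_eq_ofReal, hR.inner_self, ← Complex.ofReal_add, Complex.ofReal_re,
    Complex.sub_re] at h3
  have h4 : 0 ≤ ε * (q.form (R d)).toReal := by positivity
  rw [hRd]
  nlinarith [sq_nonneg ‖d‖, sq_nonneg ‖R d‖]

theorem re_inner_yosida_pow_apply_le (hR : q.IsResolvent ε R) (hε : 0 < ε) (k : ℕ) (x : E) :
    (inner ℂ ((R ^ k) x) (yosida ε R ((R ^ k) x))).re ≤ (inner ℂ x (yosida ε R x)).re := by
  induction k with
  | zero => simp
  | succ k ih =>
    rw [pow_succ']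
    exact (hR.re_inner_yosida_apply_le hε _).trans ih

/-- `φ_ε v = R (φ v)` on the domain of `φ`. -/
theorem yosida_apply_eq (hR : q.IsResolvent ε R) (hε : 0 < ε) {v w : E} (hv : q.form v ≠ ⊤)
    (hvw : ∀ u, q.form u ≠ ⊤ → q.bil u v = inner ℂ u w) : yosida ε R v = R w := by
  have key : R (v + (ε : ℂ) • w) = v := by
    set z := R (v + (ε : ℂ) • w) with hz
    obtain ⟨h1, h2⟩ := hR (v + (ε : ℂ) • w)
    rw [← hz] at h1 h2
    have hneg : q.form ((-1 : ℂ) • v) ≠ ⊤ := q.smul_ne_top _ hv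
    have hd := q.add_ne_top h1 hneg
    have h3 := h2 _ hd
    have h4 := hvw _ hd
    have h5 : q.bil (z + (-1 : ℂ) • v) (z + (-1 : ℂ) • v)
        = q.bil (z + (-1 : ℂ) • v) z - q.bil (z + (-1 : ℂ) • v) v := by
      rw [← q.bil_conj hd hd, q.bil_add_left h1 hneg hd, q.bil_smul_left _ hv hd, map_add, map_mul,
        q.bil_conj hd h1, q.bil_conj hd hv]
      simp
      ring
    have h6 : inner ℂ (z + (-1 : ℂ) • v) (z + (-1 : ℂ) • v)
        + (ε : ℂ) * q.bil (z + (-1 : ℂ) • v) (z + (-1 : ℂ) • v) = 0 := by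
      rw [h5, h4, mul_sub, inner_add_right (z + (-1 : ℂ) • v) z, inner_smul_right]
      rw [inner_add_right, inner_smul_right] at h3
      linear_combination h3
    rw [inner_self_eq_ofReal, q.bil_self hd, ← Complex.ofReal_mul, ← Complex.ofReal_add,
      Complex.ofReal_eq_zero] at h6
    have h7 : 0 ≤ ε * (q.form (z + (-1 : ℂ) • v)).toReal := by positivity
    have h8 : ‖z + (-1 : ℂ) • v‖ ^ 2 = 0 := le_antisymm (by linarith) (by positivity)
    have h9 : z + (-1 : ℂ) • v = 0 := by simpa only [sq_eq_zero_iff, norm_eq_zero] using h8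
    rw [neg_one_smul, ← sub_eq_add_neg, sub_eq_zero] at h9
    exact h9
  rw [yosida_apply]
  have hε' : (ε : ℂ) ≠ 0 := by exact_mod_cast hε.ne'
  have : v - R v = (ε : ℂ) • R w := by
    conv_lhs => rw [← key]
    rw [← map_sub, key, add_sub_cancel_left, map_smul]
  rw [this, inv_smul_smul₀ hε']

theorem commute_yosida (R : E →L[ℂ] E) : Commute (yosida ε R) R :=
  ((Commute.one_left R).sub_left (Commute.refl R)).smul_left _

theorem yosida_pow_apply_eq (hR : q.IsResolvent ε R) (hε : 0 < ε) {x : ℕ → E}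
    (hx : ∀ k, q.form (x k) ≠ ⊤ ∧ ∀ u, q.form u ≠ ⊤ → q.bil u (x k) = inner ℂ u (x (k + 1)))
    (k : ℕ) : (yosida ε R ^ k) (x 0) = (R ^ k) (x k) := by
  induction k with
  | zero => simp
  | succ k ih =>
    have h1 : (yosida ε R ^ (k + 1)) (x 0) = yosida ε R ((R ^ k) (x k)) := by
      rw [pow_succ', ← ih]; rfl
    have h2 : yosida ε R ((R ^ k) (x k)) = (R ^ k) (yosida ε R (x k)) :=
      congrArg (fun T : E →L[ℂ] E => T (x k)) ((commute_yosida (ε := ε) R).pow_right k).eq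
    rw [h1, h2, hR.yosida_apply_eq hε (hx k).1 (hx k).2, pow_succ]
    rfl

/-- The exponential of a Yosida approximation is bounded by the power series of the exponential of
the form: if `x k = φᵏ (x 0)` then `φ_εᵏ (x 0) = Rᵏ (x k)`, and `R` is a contraction. -/
theorem re_inner_exp_yosida_le (hR : q.IsResolvent ε R) (hε : 0 < ε) {θ : ℝ} (hθ : 0 ≤ θ)
    {x : ℕ → E}
    (hx : ∀ k, q.form (x k) ≠ ⊤ ∧ ∀ u, q.form u ≠ ⊤ → q.bil u (x k) = inner ℂ u (x (k + 1))) :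
    ENNReal.ofReal (inner ℂ (x 0) (NormedSpace.exp ((θ : ℂ) • yosida ε R) (x 0))).re
      ≤ ∑' k : ℕ, (ENNReal.ofReal (θ ^ (2 * k) / (2 * k).factorial) * ‖x k‖ₑ ^ 2
      + ENNReal.ofReal (θ ^ (2 * k + 1) / (2 * k + 1).factorial) * q.form (x k)) := by
  set Φ := yosida ε R with hΦ
  have hpos := hR.yosida_isPositive hε
  have hsa : ∀ (k : ℕ) (u v : E), inner ℂ u ((Φ ^ k) v) = inner ℂ ((Φ ^ k) u) v := by
    intro k u v
    have := (hpos.isSelfAdjoint.pow k).adjoint_eq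
    rw [← ContinuousLinearMap.adjoint_inner_left, this]
  have hodd : ∀ k, (inner ℂ (x 0) ((Φ ^ (2 * k + 1)) (x 0))).re
      = (inner ℂ ((R ^ k) (x k)) (Φ ((R ^ k) (x k)))).re := by
    intro k
    have h1 : (Φ ^ (2 * k + 1)) (x 0) = (Φ ^ k) (Φ ((Φ ^ k) (x 0))) := by
      rw [two_mul, add_assoc, pow_add, pow_succ']; rfl
    rw [h1, hsa, hR.yosida_pow_apply_eq hε hx]
  have heven : ∀ k, (inner ℂ (x 0) ((Φ ^ (2 * k)) (x 0))).re = ‖(R ^ k) (x k)‖ ^ 2 := by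
    intro k
    have h1 : (Φ ^ (2 * k)) (x 0) = (Φ ^ k) ((Φ ^ k) (x 0)) := by
      rw [two_mul, pow_add]; rfl
    rw [h1, hsa, hR.yosida_pow_apply_eq hε hx, inner_self_eq_ofReal, Complex.ofReal_re]
  set f : ℕ → ℝ := fun n => θ ^ n / n.factorial * (inner ℂ (x 0) ((Φ ^ n) (x 0))).re with hf
  have hsum : HasSum f (inner ℂ (x 0) (NormedSpace.exp ((θ : ℂ) • Φ) (x 0))).re := by
    have h1 := NormedSpace.exp_series_hasSum_exp' (𝕂 := ℂ) ((θ : ℂ) • Φ)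
    have h2 : HasSum _ (inner ℂ (x 0) (NormedSpace.exp ((θ : ℂ) • Φ) (x 0))).re :=
      Complex.hasSum_re (h1.mapL ((innerSL ℂ (x 0)) ∘L ContinuousLinearMap.apply ℂ E (x 0)))
    convert h2 using 2 with n
    simp only [hf, smul_pow, smul_smul]
    change _ = (inner ℂ (x 0) (((n.factorial : ℂ)⁻¹ * (θ : ℂ) ^ n) • (Φ ^ n) (x 0))).re
    rw [inner_smul_right]
    have : ((n.factorial : ℂ)⁻¹ * (θ : ℂ) ^ n) = ((θ ^ n / n.factorial : ℝ) : ℂ) := by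
      push_cast
      ring
    rw [this, Complex.re_ofReal_mul]
  have hf0 : ∀ n, 0 ≤ f n := by
    intro n
    refine mul_nonneg (by positivity) ?_
    rcases Nat.even_or_odd' n with ⟨k, rfl | rfl⟩
    · rw [heven]; positivity
    · rw [hodd]; exact hpos.re_inner_nonneg_right _
  rw [← hsum.tsum_eq, ENNReal.ofReal_tsum_of_nonneg hf0 hsum.summable,
    ← tsum_even_add_odd (f := fun n => ENNReal.ofReal (f n)) ENNReal.summable ENNReal.summable,
    ← ENNReal.tsum_add]
  refine ENNReal.tsum_le_tsum fun k => add_le_add ?_ ?_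
  · simp only [hf]
    rw [ENNReal.ofReal_mul (by positivity), heven, ← ofReal_norm,
      ← ENNReal.ofReal_pow (norm_nonneg _)]
    gcongr
    exact hR.norm_pow_apply_le hε k (x k)
  · simp only [hf]
    rw [ENNReal.ofReal_mul (by positivity), hodd]
    gcongr
    rw [ENNReal.ofReal_le_iff_le_toReal (hx k).1]
    exact (hR.re_inner_yosida_pow_apply_le hε k (x k)).trans (hR.re_inner_yosida_le hε (hx k).1)

end IsResolvent

end ClosedForm

/-! ### The generator of a one-parameter unitary group -/

section UnitaryGroup

variable {E : Type*} [NormedAddCommGroup E] [InnerProductSpace ℂ E]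

/-- A strongly continuous one-parameter group of isometries (hence of unitary operators). -/
structure IsUnitaryGroup (U : ℝ → E →L[ℂ] E) : Prop where
  zero_apply : ∀ v, U 0 v = v
  add_apply : ∀ r s v, U (r + s) v = U r (U s v)
  norm_apply : ∀ r v, ‖U r v‖ = ‖v‖
  continuous : ∀ v, Continuous fun r => U r v

/-- The form `‖L v‖²` of the self-adjoint generator `L` of a unitary group `U r = exp (i r L)`, as
the supremum of `‖(U r v - v) / r‖²` over all `r`; the term for `r = 0` is `0 / 0 = 0`. -/
def generatorForm (U : ℝ → E →L[ℂ] E) (v : E) : ℝ≥0∞ :=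
  ⨆ r : ℝ, ENNReal.ofReal (‖U r v - v‖ ^ 2 / r ^ 2)

namespace IsUnitaryGroup

variable {U : ℝ → E →L[ℂ] E} (hU : IsUnitaryGroup U)
include hU

theorem inner_apply_apply (r : ℝ) (v w : E) : inner ℂ (U r v) (U r w) = inner ℂ v w :=
  (⟨(U r).toLinearMap, hU.norm_apply r⟩ : E →ₗᵢ[ℂ] E).inner_map_map v w

theorem inner_apply_left (r : ℝ) (v w : E) : inner ℂ (U r v) w = inner ℂ v (U (-r) w) := by
  rw [← hU.inner_apply_apply r v, ← hU.add_apply, add_neg_cancel, hU.zero_apply]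

/-- Mean value inequality: the derivative of `U r v` has the constant norm `‖w‖`. -/
theorem norm_sub_le_of_hasDerivAt {v w : E} (h : HasDerivAt (fun r => U r v) w 0) (r : ℝ) :
    ‖U r v - v‖ ≤ ‖w‖ * |r| := by
  have hd : ∀ r, HasDerivAt (fun r => U r v) (U r w) r := by
    intro r
    have h1 : HasDerivAt (fun x : ℝ => x - r) 1 r := (hasDerivAt_id r).sub_const r
    have h2 : HasDerivAt (fun r => U r v) w (r - r) := by rwa [sub_self]
    have h3 := HasDerivAt.scomp (h := fun x : ℝ => x - r) r h2 h1
    have h4 := ((U r).restrictScalars ℝ).hasFDerivAt.comp_hasDerivAt r h3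
    rw [one_smul] at h4
    refine h4.congr_of_eventuallyEq (Filter.Eventually.of_forall fun x => ?_)
    change U x v = U r (U (x - r) v)
    rw [← hU.add_apply, add_sub_cancel]
  have := convex_univ.norm_image_sub_le_of_norm_hasDerivWithin_le (C := ‖w‖)
    (fun x _ => (hd x).hasDerivWithinAt) (fun x _ => (hU.norm_apply x w).le)
    (Set.mem_univ 0) (Set.mem_univ r)
  simpa [hU.zero_apply] using this

theorem generatorForm_of_hasDerivAt {v w : E} (h : HasDerivAt (fun r => U r v) w 0) :
    generatorForm U v = ‖w‖ₑ ^ 2 := by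
  rw [← ofReal_norm, ← ENNReal.ofReal_pow (norm_nonneg _)]
  refine le_antisymm (iSup_le fun r => ENNReal.ofReal_le_ofReal ?_) ?_
  · have h1 := hU.norm_sub_le_of_hasDerivAt h r
    refine div_le_of_le_mul₀ (sq_nonneg r) (sq_nonneg _) ?_
    rw [← sq_abs r, ← mul_pow]
    gcongr
  · have h1 := hasDerivAt_iff_tendsto_slope_zero.1 h
    have h2 := (ENNReal.continuous_ofReal.tendsto _).comp (h1.norm.pow 2)
    refine le_of_tendsto h2 (Filter.Eventually.of_forall fun r => ?_)
    refine le_of_eq_of_le ?_ (le_iSup _ r)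
    simp only [Function.comp_def, zero_add, hU.zero_apply]
    rw [norm_smul, mul_pow, norm_inv, Real.norm_eq_abs, inv_pow, sq_abs, inv_mul_eq_div]

/-- Weak compactness: the difference quotients of a vector of finite form have a weak limit point,
along an ultrafilter. -/
theorem exists_weak_limit [CompleteSpace E] {v : E} {C : ℝ}
    (hC : ∀ r, ‖U r v - v‖ ≤ C * |r|) :
    ∃ (𝒰 : Ultrafilter ℝ) (w : E), ↑𝒰 ≤ nhdsWithin (0 : ℝ) (Set.Ioi 0) ∧
      ∀ y, Filter.Tendsto (fun h : ℝ => inner ℂ (h⁻¹ • (U h v - v)) y) 𝒰 (nhds (inner ℂ w y)) := by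
  let 𝒰 := Ultrafilter.of (nhdsWithin (0 : ℝ) (Set.Ioi 0))
  have hle : ↑𝒰 ≤ nhdsWithin (0 : ℝ) (Set.Ioi 0) := Ultrafilter.of_le _
  have hbd : ∀ y (h : ℝ), ‖inner ℂ (h⁻¹ • (U h v - v)) y‖ ≤ |C| * ‖y‖ := by
    intro y h
    refine (norm_inner_le_norm _ _).trans (mul_le_mul_of_nonneg_right ?_ (norm_nonneg y))
    rw [norm_smul, norm_inv, Real.norm_eq_abs, inv_mul_eq_div]
    refine div_le_of_le_mul₀ (abs_nonneg h) (abs_nonneg C) ((hC h).trans ?_)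
    gcongr
    exact le_abs_self C
  have hlim : ∀ y, ∃ z, ‖z‖ ≤ |C| * ‖y‖ ∧
      Filter.Tendsto (fun h : ℝ => inner ℂ (h⁻¹ • (U h v - v)) y) 𝒰 (nhds z) := by
    intro y
    obtain ⟨z, hz, hz2⟩ := (isCompact_closedBall (0 : ℂ) (|C| * ‖y‖)).ultrafilter_le_nhds
      (𝒰.map fun h : ℝ => inner ℂ (h⁻¹ • (U h v - v)) y) (by
        rw [Filter.le_principal_iff]
        refine Filter.mem_map.2 (Filter.Eventually.of_forall fun h : ℝ => ?_)
        simpa [mem_closedBall_zero_iff] using hbd y h)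
    exact ⟨z, by simpa using hz, hz2⟩
  choose z hz1 hz2 using hlim
  let ℓ : E →ₗ[ℂ] ℂ :=
    { toFun := z
      map_add' := fun x y => tendsto_nhds_unique (hz2 (x + y)) (by
        simpa only [inner_add_right] using (hz2 x).add (hz2 y))
      map_smul' := fun c x => tendsto_nhds_unique (hz2 (c • x)) (by
        simpa only [inner_smul_right, smul_eq_mul, RingHom.id_apply] using (hz2 x).const_mul c) }
  refine ⟨𝒰, (InnerProductSpace.toDual ℂ E).symm (ℓ.mkContinuous |C| hz1), hle, fun y => ?_⟩
  rw [InnerProductSpace.toDual_symm_apply]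
  exact hz2 y

/-- A vector of finite form is in the domain of the generator. -/
theorem exists_hasDerivAt [CompleteSpace E] {v : E} (hv : generatorForm U v ≠ ⊤) :
    ∃ w, HasDerivAt (fun r => U r v) w 0 := by
  have hC : ∀ r, ‖U r v - v‖ ≤ Real.sqrt (generatorForm U v).toReal * |r| := by
    intro r
    have h1 : ‖U r v - v‖ ^ 2 / r ^ 2 ≤ (generatorForm U v).toReal :=
      (ENNReal.ofReal_le_iff_le_toReal hv).1
        (le_iSup (fun r : ℝ => ENNReal.ofReal (‖U r v - v‖ ^ 2 / r ^ 2)) r)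
    rcases eq_or_ne r 0 with rfl | hr
    · simp [hU.zero_apply]
    rw [div_le_iff₀ (by positivity)] at h1
    refine le_of_sq_le_sq ?_ (by positivity)
    rwa [mul_pow, Real.sq_sqrt ENNReal.toReal_nonneg, sq_abs]
  obtain ⟨𝒰, w, hle, hw⟩ := hU.exists_weak_limit hC
  refine ⟨w, ?_⟩
  have hcw := hU.continuous w
  have hcv := hU.continuous v
  -- the integral form `U r v - v = ∫₀ʳ U s w ds`
  have key : ∀ r, U r v - v = ∫ s in (0 : ℝ)..r, U s w := by
    intro r
    refine ext_inner_right ℂ fun y => ?_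
    have hcy : Continuous fun s => U (-s) y := (hU.continuous y).comp continuous_neg
    set z := ∫ s in (0 : ℝ)..r, U (-s) y with hz
    have hzi : ∀ x, inner ℂ x z = ∫ s in (0 : ℝ)..r, inner ℂ (U s x) y := by
      intro x
      have := ContinuousLinearMap.intervalIntegral_comp_comm (innerSL ℂ x)
        (hcy.intervalIntegrable 0 r (μ := volume))
      rw [innerSL_apply_apply] at this
      rw [hz, ← this]
      refine intervalIntegral.integral_congr fun s _ => ?_
      exact (hU.inner_apply_left s x y).symm
    -- the difference quotients, paired with `z`, tend to `⟪w, z⟫` and also to `g r - g 0`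
    have hlim1 := hw z
    set g : ℝ → ℂ := fun s => inner ℂ (U s v) y with hg
    have hgc : Continuous g := by fun_prop
    have hgi : ∀ a b, IntervalIntegrable g volume a b := fun a b => hgc.intervalIntegrable a b
    have hG : ∀ a, HasDerivAt (fun x => ∫ s in (0 : ℝ)..x, g s) (g a) a := fun a =>
      intervalIntegral.integral_hasDerivAt_right (hgi 0 a)
        (hgc.stronglyMeasurableAtFilter _ _) hgc.continuousAt
    have hlim2 : Filter.Tendsto (fun h : ℝ => inner ℂ (h⁻¹ • (U h v - v)) z) 𝒰
        (nhds (g r - g 0)) := by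
      have h1 := (hasDerivAt_iff_tendsto_slope_zero.1 (hG r)).sub
        (hasDerivAt_iff_tendsto_slope_zero.1 (hG 0))
      have hle2 : (𝒰 : Filter ℝ) ≤ nhdsWithin 0 {0}ᶜ :=
        hle.trans (nhdsWithin_mono 0 fun x hx => ne_of_gt hx)
      refine (h1.mono_left hle2).congr fun h => ?_
      have e1 : inner ℂ (h⁻¹ • (U h v - v)) z
          = (h⁻¹ : ℝ) • ∫ s in (0 : ℝ)..r, (g (s + h) - g s) := by
        rw [hzi, ← intervalIntegral.integral_smul]
        refine intervalIntegral.integral_congr fun s _ => ?_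
        simp only [hg]
        rw [hU.add_apply, ← inner_sub_left, ← map_sub, ← Complex.coe_smul, map_smul,
          inner_smul_left, Complex.conj_ofReal]
        rfl
      have hgs : Continuous fun s => g (s + h) := hgc.comp (continuous_add_const h)
      rw [e1, intervalIntegral.integral_sub (hgs.intervalIntegrable _ _) (hgi _ _),
        intervalIntegral.integral_comp_add_right (fun s => g s) h,
        intervalIntegral.integral_same, ← smul_sub]
      congr 1
      have a1 := intervalIntegral.integral_add_adjacent_intervals (hgi 0 (0 + h))
        (hgi (0 + h) (r + h))
      rw [← a1]
      ring
    have huniq := tendsto_nhds_unique hlim1 hlim2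
    rw [hzi] at huniq
    have hr := ContinuousLinearMap.intervalIntegral_comp_comm
      ((innerSL ℂ y)) (hcw.intervalIntegrable 0 r (μ := volume))
    simp only [innerSL_apply_apply] at hr
    rw [← inner_conj_symm (∫ s in (0 : ℝ)..r, U s w) y, ← hr,
      ← intervalIntegral.intervalIntegral_conj, inner_sub_left]
    simp only [inner_conj_symm]
    rw [huniq]
    simp [hg, hU.zero_apply]
  have hder : HasDerivAt (fun r => v + ∫ s in (0 : ℝ)..r, U s w) (U 0 w) 0 :=
    (intervalIntegral.integral_hasDerivAt_right (hcw.intervalIntegrable 0 0)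
        (hcw.stronglyMeasurableAtFilter _ _) hcw.continuousAt).const_add v
  rw [hU.zero_apply] at hder
  refine hder.congr_of_eventuallyEq (Filter.Eventually.of_forall fun r => ?_)
  change U r v = v + _
  rw [← key r, add_sub_cancel]

end IsUnitaryGroup

theorem lowerSemicontinuous_generatorForm (U : ℝ → E →L[ℂ] E) :
    LowerSemicontinuous (generatorForm U) :=
  lowerSemicontinuous_iSup fun r =>
    (ENNReal.continuous_ofReal.comp (by fun_prop)).lowerSemicontinuous

end UnitaryGroup

section UnitaryGroup

variable {E : Type*} [NormedAddCommGroup E] [InnerProductSpace ℂ E]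

/-- The self-adjoint generator `L` of a unitary group `U r = exp (i r L)`; it is meaningful on the
vectors `v` with `generatorForm U v ≠ ∞`. -/
def generator (U : ℝ → E →L[ℂ] E) (v : E) : E := -Complex.I • deriv (fun r => U r v) 0

theorem generatorForm_add_le (U : ℝ → E →L[ℂ] E) (u v : E) :
    generatorForm U (u + v) ≤ 2 * generatorForm U u + 2 * generatorForm U v := by
  refine iSup_le fun r => ?_
  refine le_trans ?_ (add_le_add
    (mul_le_mul_right (le_iSup (fun r : ℝ => ENNReal.ofReal (‖U r u - u‖ ^ 2 / r ^ 2)) r) 2)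
    (mul_le_mul_right (le_iSup (fun r : ℝ => ENNReal.ofReal (‖U r v - v‖ ^ 2 / r ^ 2)) r) 2))
  have h2 : (2 : ℝ≥0∞) = ENNReal.ofReal 2 := by simp
  rw [h2, ← ENNReal.ofReal_mul (by norm_num), ← ENNReal.ofReal_mul (by norm_num),
    ← ENNReal.ofReal_add (by positivity) (by positivity), map_add, add_sub_add_comm]
  refine ENNReal.ofReal_le_ofReal ?_
  rw [← mul_div_assoc, ← mul_div_assoc, ← add_div]
  refine div_le_div_of_nonneg_right ?_ (sq_nonneg r)
  have h := norm_add_le (U r u - u) (U r v - v)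
  nlinarith [sq_nonneg (‖U r u - u‖ - ‖U r v - v‖), norm_nonneg (U r u - u + (U r v - v))]

theorem generatorForm_smul_le (U : ℝ → E →L[ℂ] E) (c : ℂ) (u : E) :
    generatorForm U (c • u) ≤ ENNReal.ofReal (‖c‖ ^ 2) * generatorForm U u := by
  refine iSup_le fun r => ?_
  refine le_trans ?_
    (mul_le_mul_right (le_iSup (fun r : ℝ => ENNReal.ofReal (‖U r u - u‖ ^ 2 / r ^ 2)) r) _)
  rw [← ENNReal.ofReal_mul (by positivity), map_smul, ← smul_sub, norm_smul, mul_pow, mul_div_assoc]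

namespace IsUnitaryGroup

variable [CompleteSpace E] {U : ℝ → E →L[ℂ] E} (hU : IsUnitaryGroup U)
include hU

theorem hasDerivAt_generator {v : E} (hv : generatorForm U v ≠ ⊤) :
    HasDerivAt (fun r => U r v) (Complex.I • generator U v) 0 := by
  obtain ⟨w, hw⟩ := hU.exists_hasDerivAt hv
  rw [generator, smul_smul, mul_neg, Complex.I_mul_I, neg_neg, one_smul]
  exact hw.differentiableAt.hasDerivAt

theorem generatorForm_eq_enorm {v : E} (hv : generatorForm U v ≠ ⊤) :
    generatorForm U v = ‖generator U v‖ₑ ^ 2 := by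
  rw [hU.generatorForm_of_hasDerivAt (hU.hasDerivAt_generator hv), enorm_smul]
  simp [← ofReal_norm]

theorem generator_eq {v w : E} (h : HasDerivAt (fun r => U r v) (Complex.I • w) 0) :
    generator U v = w := by
  rw [generator, h.deriv, smul_smul, neg_mul, Complex.I_mul_I, neg_neg, one_smul]

theorem generator_add {u v : E} (hu : generatorForm U u ≠ ⊤) (hv : generatorForm U v ≠ ⊤) :
    generator U (u + v) = generator U u + generator U v := by
  refine hU.generator_eq ?_
  rw [smul_add]
  simpa only [map_add] using! (hU.hasDerivAt_generator hu).add (hU.hasDerivAt_generator hv)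

theorem generator_smul {u : E} (c : ℂ) (hu : generatorForm U u ≠ ⊤) :
    generator U (c • u) = c • generator U u := by
  refine hU.generator_eq ?_
  rw [smul_comm]
  simpa only [map_smul] using! (hU.hasDerivAt_generator hu).const_smul c

theorem tendsto_generator {v : E} (hv : generatorForm U v ≠ ⊤) :
    Filter.Tendsto (fun n : ℕ => (-Complex.I * (n + 1 : ℂ)) • (U ((n : ℝ) + 1)⁻¹ v - v))
      Filter.atTop (nhds (generator U v)) := by
  have h1 := hasDerivAt_iff_tendsto_slope_zero.1 (hU.hasDerivAt_generator hv)
  have h2 : Filter.Tendsto (fun n : ℕ => ((n : ℝ) + 1)⁻¹) Filter.atTop (nhdsWithin 0 {0}ᶜ) := by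
    refine tendsto_nhdsWithin_iff.2 ⟨?_, Filter.Eventually.of_forall fun n => ?_⟩
    · simpa only [one_div] using tendsto_one_div_add_atTop_nhds_zero_nat (𝕜 := ℝ)
    · exact inv_ne_zero (by positivity)
  have h3 := (h1.comp h2).const_smul (-Complex.I)
  rw [smul_smul, neg_mul, Complex.I_mul_I, neg_neg, one_smul] at h3
  refine h3.congr fun n => ?_
  simp only [Function.comp_def, zero_add, hU.zero_apply, inv_inv]
  rw [← Complex.coe_smul, smul_smul]
  push_cast
  rfl

end IsUnitaryGroup

end UnitaryGroup

/-! ### Integrals of squared generators -/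

section IntegralForm

variable {E : Type*} [NormedAddCommGroup E] [InnerProductSpace ℂ E]
  {κ : Type*} [Fintype κ] {U : ℝ → κ → ℝ → E →L[ℂ] E} {μ : Measure ℝ}

/-- The quadratic form of `∫ ∑ₖ Lₖ(s)² dμ(s)`, where `Lₖ(s)` generates the unitary group `U s k`. -/
def integralForm (U : ℝ → κ → ℝ → E →L[ℂ] E) (μ : Measure ℝ) (v : E) : ℝ≥0∞ :=
  ∫⁻ s, ∑ k, generatorForm (U s k) v ∂μ

theorem measurable_generatorForm (hc : ∀ k r v, Continuous fun s => U s k r v) (k : κ) (v : E) :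
    Measurable fun s => generatorForm (U s k) v := by
  refine LowerSemicontinuous.measurable (lowerSemicontinuous_iSup fun r => ?_)
  refine (ENNReal.continuous_ofReal.comp ?_).lowerSemicontinuous
  have := hc k r v
  fun_prop

theorem measurable_sum_generatorForm (hc : ∀ k r v, Continuous fun s => U s k r v) (v : E) :
    Measurable fun s => ∑ k, generatorForm (U s k) v :=
  Finset.measurable_sum _ fun k _ => measurable_generatorForm hc k v

/-- The integral form is closed, by Fatou's lemma. -/
theorem lowerSemicontinuous_integralForm (hc : ∀ k r v, Continuous fun s => U s k r v) :
    LowerSemicontinuous (integralForm U μ) := by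
  rw [lowerSemicontinuous_iff_isClosed_preimage]
  intro y
  refine IsSeqClosed.isClosed fun x v hx hv => ?_
  have hl : ∀ s, LowerSemicontinuous fun v => ∑ k, generatorForm (U s k) v := fun s =>
    lowerSemicontinuous_sum fun k _ => lowerSemicontinuous_generatorForm (U s k)
  calc integralForm U μ v
      ≤ ∫⁻ s, Filter.liminf (fun n => ∑ k, generatorForm (U s k) (x n)) Filter.atTop ∂μ :=
        lintegral_mono fun s => ((hl s).le_liminf v).trans
          (Filter.liminf_le_liminf_of_le hv |>.trans_eq rfl)
    _ ≤ Filter.liminf (fun n => integralForm U μ (x n)) Filter.atTop :=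
        lintegral_liminf_le fun n => measurable_sum_generatorForm hc (x n)
    _ ≤ Filter.liminf (fun _ : ℕ => y) Filter.atTop :=
        Filter.liminf_le_liminf (Filter.Eventually.of_forall hx)
    _ = y := Filter.liminf_const y

theorem ae_generatorForm_ne_top (hc : ∀ k r v, Continuous fun s => U s k r v) {v : E}
    (hv : integralForm U μ v ≠ ⊤) : ∀ᵐ s ∂μ, ∀ k, generatorForm (U s k) v ≠ ⊤ := by
  filter_upwards [ae_lt_top (measurable_sum_generatorForm hc v) hv] with s hs k
  exact ((ENNReal.sum_lt_top.1 hs) k (Finset.mem_univ k)).ne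

variable [CompleteSpace E]

theorem aestronglyMeasurable_generator (hU : ∀ s k, IsUnitaryGroup (U s k))
    (hc : ∀ k r v, Continuous fun s => U s k r v) {v : E} (hv : integralForm U μ v ≠ ⊤) (k : κ) :
    AEStronglyMeasurable (fun s => generator (U s k) v) μ := by
  refine aestronglyMeasurable_of_tendsto_ae Filter.atTop (f := fun (n : ℕ) s =>
    (-Complex.I * (n + 1 : ℂ)) • (U s k ((n : ℝ) + 1)⁻¹ v - v)) (fun n => ?_) ?_
  · exact Continuous.aestronglyMeasurable (((hc k _ v).sub continuous_const).const_smul _)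
  · filter_upwards [ae_generatorForm_ne_top hc hv] with s hs
    exact (hU s k).tendsto_generator (hs k)

theorem integralForm_eq_lintegral (hU : ∀ s k, IsUnitaryGroup (U s k))
    (hc : ∀ k r v, Continuous fun s => U s k r v) {v : E} (hv : integralForm U μ v ≠ ⊤) :
    integralForm U μ v = ∫⁻ s, ENNReal.ofReal (∑ k, ‖generator (U s k) v‖ ^ 2) ∂μ := by
  refine lintegral_congr_ae ?_
  filter_upwards [ae_generatorForm_ne_top hc hv] with s hs
  rw [ENNReal.ofReal_sum_of_nonneg fun k _ => sq_nonneg _]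
  refine Finset.sum_congr rfl fun k _ => ?_
  rw [(hU s k).generatorForm_eq_enorm (hs k), ← ofReal_norm, ENNReal.ofReal_pow (norm_nonneg _)]

theorem integrable_sum_norm_sq_generator (hU : ∀ s k, IsUnitaryGroup (U s k))
    (hc : ∀ k r v, Continuous fun s => U s k r v) {v : E} (hv : integralForm U μ v ≠ ⊤) :
    Integrable (fun s => ∑ k, ‖generator (U s k) v‖ ^ 2) μ := by
  refine ⟨Finset.aestronglyMeasurable_fun_sum _ fun k _ =>
    (aestronglyMeasurable_generator hU hc hv k).norm.pow 2, ?_⟩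
  rw [hasFiniteIntegral_iff_ofReal
    (Filter.Eventually.of_forall fun s => Finset.sum_nonneg fun k _ => sq_nonneg _),
    ← integralForm_eq_lintegral hU hc hv]
  exact hv.lt_top

theorem integrable_sum_inner_generator (hU : ∀ s k, IsUnitaryGroup (U s k))
    (hc : ∀ k r v, Continuous fun s => U s k r v) {u v : E} (hu : integralForm U μ u ≠ ⊤)
    (hv : integralForm U μ v ≠ ⊤) :
    Integrable (fun s => ∑ k, inner ℂ (generator (U s k) u) (generator (U s k) v)) μ := by
  refine Integrable.mono' ((integrable_sum_norm_sq_generator hU hc hu).add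
    (integrable_sum_norm_sq_generator hU hc hv)) ?_ (Filter.Eventually.of_forall fun s => ?_)
  · exact Finset.aestronglyMeasurable_fun_sum _ fun k _ =>
      (aestronglyMeasurable_generator hU hc hu k).inner (aestronglyMeasurable_generator hU hc hv k)
  · rw [Pi.add_apply, ← Finset.sum_add_distrib]
    refine (norm_sum_le _ _).trans (Finset.sum_le_sum fun k _ => (norm_inner_le_norm _ _).trans ?_)
    nlinarith [sq_nonneg (‖generator (U s k) u‖ - ‖generator (U s k) v‖),
      sq_nonneg ‖generator (U s k) u‖, sq_nonneg ‖generator (U s k) v‖]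

/-- The closed form of `∫ ∑ₖ Lₖ(s)² dμ(s)` for a continuous family of unitary groups. -/
def integralClosedForm (hU : ∀ s k, IsUnitaryGroup (U s k))
    (hc : ∀ k r v, Continuous fun s => U s k r v) : ClosedForm E where
  form := integralForm U μ
  bil u v := ∫ s, ∑ k, inner ℂ (generator (U s k) u) (generator (U s k) v) ∂μ
  lsc := lowerSemicontinuous_integralForm hc
  zero_ne_top := by simp [integralForm, generatorForm]
  add_ne_top {u v} hu hv := by
    have h2 : (2 : ℝ≥0∞) ≠ ⊤ := ENNReal.ofNat_ne_top
    refine ne_top_of_le_ne_top (ENNReal.add_ne_top.2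
      ⟨ENNReal.mul_ne_top h2 hu, ENNReal.mul_ne_top h2 hv⟩) ?_
    rw [integralForm, integralForm, integralForm,
      ← lintegral_const_mul _ (measurable_sum_generatorForm hc u),
      ← lintegral_const_mul _ (measurable_sum_generatorForm hc v),
      ← lintegral_add_left ((measurable_sum_generatorForm hc u).const_mul 2)]
    refine lintegral_mono fun s => ?_
    simp only [Finset.mul_sum, ← Finset.sum_add_distrib]
    exact Finset.sum_le_sum fun k _ => generatorForm_add_le _ _ _
  smul_ne_top {u} c hu := by
    refine ne_top_of_le_ne_top
      (ENNReal.mul_ne_top (ENNReal.ofReal_ne_top (r := ‖c‖ ^ 2)) hu) ?_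
    rw [integralForm, integralForm, ← lintegral_const_mul _ (measurable_sum_generatorForm hc u)]
    refine lintegral_mono fun s => ?_
    simp only [Finset.mul_sum]
    exact Finset.sum_le_sum fun k _ => generatorForm_smul_le _ _ _
  bil_conj {u v} _ _ := by
    rw [← integral_conj]
    simp only [map_sum, inner_conj_symm]
  bil_add_left {u v w} hu hv hw := by
    rw [← integral_add (integrable_sum_inner_generator hU hc hu hw)
      (integrable_sum_inner_generator hU hc hv hw)]
    refine integral_congr_ae ?_
    filter_upwards [ae_generatorForm_ne_top hc hu, ae_generatorForm_ne_top hc hv] with s h1 h2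
    rw [← Finset.sum_add_distrib]
    refine Finset.sum_congr rfl fun k _ => ?_
    rw [(hU s k).generator_add (h1 k) (h2 k), inner_add_left]
  bil_smul_left {u w} c hu _ := by
    rw [← integral_const_mul]
    refine integral_congr_ae ?_
    filter_upwards [ae_generatorForm_ne_top hc hu] with s h1
    rw [Finset.mul_sum]
    refine Finset.sum_congr rfl fun k _ => ?_
    rw [(hU s k).generator_smul c (h1 k), inner_smul_left]
  bil_self {u} hu := by
    rw [integralForm_eq_lintegral hU hc hu, ← integral_eq_lintegral_of_nonneg_ae
      (Filter.Eventually.of_forall fun s => Finset.sum_nonneg fun k _ => sq_nonneg _)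
      (integrable_sum_norm_sq_generator hU hc hu).aestronglyMeasurable, ← integral_complex_ofReal]
    refine integral_congr_ae (Filter.Eventually.of_forall fun s => ?_)
    simp only [inner_self_eq_ofReal, Complex.ofReal_sum]

end IntegralForm

/-! ### Weyl operators on the Fock space -/

/-- Strong continuity of a family of contractions can be checked on a dense set. -/
theorem continuous_apply_of_denseRange {X E F ι : Type*} [TopologicalSpace X] [PseudoMetricSpace E]
    [PseudoMetricSpace F] {T : X → E → F} (hT : ∀ x v w, dist (T x v) (T x w) ≤ dist v w)
    {D : ι → E} (hD : DenseRange D) (h : ∀ i, Continuous fun x => T x (D i)) (v : E) :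
    Continuous fun x => T x v := by
  refine continuous_of_uniform_approx_of_continuous fun u hu => ?_
  obtain ⟨ε, hε, hεu⟩ := Metric.mem_uniformity_dist.1 hu
  obtain ⟨i, hi⟩ := hD.exists_dist_lt v hε
  exact ⟨_, h i, fun x => hεu ((hT x v (D i)).trans_lt hi)⟩

section Fock

variable {K : Type*} [NormedAddCommGroup K] [InnerProductSpace ℂ K]

theorem continuous_expVec : Continuous (expVec (K := K)) := by
  refine continuous_iff_continuousAt.2 fun f => tendsto_iff_norm_sub_tendsto_zero.2 ?_
  have h : Continuous fun g : K => Real.sqrt ((Complex.exp (inner ℂ g g)).re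
      - 2 * (Complex.exp (inner ℂ g f)).re + (Complex.exp (inner ℂ f f)).re) := by fun_prop
  have h0 := h.tendsto f
  have e : ∀ g : K, Real.sqrt ((Complex.exp (inner ℂ g g)).re
      - 2 * (Complex.exp (inner ℂ g f)).re + (Complex.exp (inner ℂ f f)).re)
      = ‖expVec g - expVec f‖ := by
    intro g
    rw [← Real.sqrt_sq (norm_nonneg (expVec g - expVec f)), norm_sub_sq (𝕜 := ℂ),
      norm_sq_eq_re_inner (𝕜 := ℂ) (expVec g), norm_sq_eq_re_inner (𝕜 := ℂ) (expVec f),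
      inner_expVec, inner_expVec, inner_expVec]
    rfl
  simpa only [e, sub_self, norm_zero] using h0

theorem continuous_weylVec (f : K) : Continuous fun h : K => weylVec h f := by
  unfold weylVec
  have := continuous_expVec (K := K)
  fun_prop

theorem expComb_eq_sum (x : K →₀ ℂ) : expComb K x = ∑ f ∈ x.support, x f • expVec f := by
  rw [expComb, Finsupp.linearCombination_apply, Finsupp.sum]

theorem fock_ext {F : Type*} [NormedAddCommGroup F] [InnerProductSpace ℂ F]
    {T T' : Fock K →L[ℂ] F} (h : ∀ f, T (expVec f) = T' (expVec f)) : T = T' := by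
  refine DFunLike.coe_injective (expComb_denseRange.equalizer T.continuous T'.continuous ?_)
  funext x
  simp only [Function.comp_apply, expComb_eq_sum, map_sum, map_smul, h]

/-- The Weyl operators are strongly continuous. -/
theorem continuous_fockWeyl_apply (v : Fock K) : Continuous fun h : K => fockWeyl h v := by
  refine continuous_apply_of_denseRange (T := fun h v => fockWeyl h v)
    (fun h v w => ((fockWeyl h).dist_map v w).le) expComb_denseRange (fun x => ?_) v
  simp only [expComb_eq_sum, map_sum, map_smul, fockWeyl_expVec]
  exact continuous_finsetSum _ fun f _ => (continuous_weylVec f).fun_const_smul _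

theorem fockWeyl_zero_apply (v : Fock K) : fockWeyl 0 v = v := by
  have : (fockWeyl (0 : K)).toContinuousLinearMap = ContinuousLinearMap.id ℂ _ :=
    fock_ext fun f => by simp [fockWeyl_expVec, weylVec]
  exact DFunLike.congr_fun this v

/-- The Weyl relations for commuting Weyl operators. -/
theorem fockWeyl_fockWeyl_apply {h h' : K} (hr : inner ℂ h h' = inner ℂ h' h) (v : Fock K) :
    fockWeyl h (fockWeyl h' v) = fockWeyl (h + h') v := by
  have : (fockWeyl h).toContinuousLinearMap ∘L (fockWeyl h').toContinuousLinearMap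
      = (fockWeyl (h + h')).toContinuousLinearMap := by
    refine fock_ext fun f => ?_
    change fockWeyl h (fockWeyl h' (expVec f)) = fockWeyl (h + h') (expVec f)
    rw [fockWeyl_expVec, fockWeyl_expVec, weylVec, map_smul, fockWeyl_expVec, weylVec, weylVec,
      smul_smul, ← Complex.exp_add, add_assoc, add_comm h' h]
    congr 2
    have hn : (‖h + h'‖ : ℂ) ^ 2 = ‖h‖ ^ 2 + 2 * inner ℂ h h' + ‖h'‖ ^ 2 := by
      have e := inner_self_eq_ofReal (h + h')
      rw [inner_add_left, inner_add_right, inner_add_right, inner_self_eq_ofReal,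
        inner_self_eq_ofReal, ← hr] at e
      push_cast at e
      rw [← e]
      ring
    rw [hn, inner_add_left, inner_add_right]
    ring
  exact DFunLike.congr_fun this v

end Fock

/-! ### Tensor products of isometries -/

section Tensor

variable {H F : Type*} [NormedAddCommGroup H] [InnerProductSpace ℂ H] [NormedAddCommGroup F]
  [InnerProductSpace ℂ F]

/-- The tensor product of two isometries on the Hilbert space tensor product. -/
abbrev tensorIsometry (A : H →ₗᵢ[ℂ] H) (B : F →ₗᵢ[ℂ] F) :
    UniformSpace.Completion (H ⊗[ℂ] F) →L[ℂ] UniformSpace.Completion (H ⊗[ℂ] F) :=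
  (TensorProduct.mapIsometry A B).toContinuousLinearMap.completion

theorem tensorIsometry_coe (A : H →ₗᵢ[ℂ] H) (B : F →ₗᵢ[ℂ] F) (z : H ⊗[ℂ] F) :
    tensorIsometry A B z = (TensorProduct.mapIsometry A B z : H ⊗[ℂ] F) :=
  UniformSpace.Completion.map_coe
    (TensorProduct.mapIsometry A B).toContinuousLinearMap.uniformContinuous z

theorem norm_tensorIsometry_apply (A : H →ₗᵢ[ℂ] H) (B : F →ₗᵢ[ℂ] F)
    (v : UniformSpace.Completion (H ⊗[ℂ] F)) : ‖tensorIsometry A B v‖ = ‖v‖ := by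
  induction v using UniformSpace.Completion.induction_on with
  | hp => exact isClosed_eq (by fun_prop) continuous_norm
  | ih z => rw [tensorIsometry_coe, UniformSpace.Completion.norm_coe,
      UniformSpace.Completion.norm_coe, LinearIsometry.norm_map]

theorem tensor_ext {T T' : UniformSpace.Completion (H ⊗[ℂ] F) →L[ℂ]
    UniformSpace.Completion (H ⊗[ℂ] F)} (h : ∀ (x : H) (y : F), T (x ⊗ₜ[ℂ] y : H ⊗[ℂ] F)
      = T' (x ⊗ₜ[ℂ] y : H ⊗[ℂ] F)) : T = T' := by
  ext v
  induction v using UniformSpace.Completion.induction_on with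
  | hp => exact isClosed_eq T.continuous T'.continuous
  | ih z =>
    induction z using TensorProduct.induction_on with
    | zero => rw [UniformSpace.Completion.coe_zero, map_zero, map_zero]
    | tmul x y => exact h x y
    | add a b ha hb => rw [UniformSpace.Completion.coe_add, map_add, map_add, ha, hb]

theorem continuous_tensorIsometry_apply {X : Type*} [TopologicalSpace X] {A : X → H →ₗᵢ[ℂ] H}
    {B : X → F →ₗᵢ[ℂ] F} (hA : ∀ v, Continuous fun x => A x v) (hB : ∀ v, Continuous fun x => B x v)
    (v : UniformSpace.Completion (H ⊗[ℂ] F)) :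
    Continuous fun x => tensorIsometry (A x) (B x) v := by
  refine continuous_apply_of_denseRange (T := fun x v => tensorIsometry (A x) (B x) v)
    (fun x v w => ?_) (UniformSpace.Completion.denseRange_coe (α := H ⊗[ℂ] F)) (fun z => ?_) v
  · rw [dist_eq_norm, dist_eq_norm, ← map_sub, norm_tensorIsometry_apply]
  simp only [tensorIsometry_coe]
  refine (UniformSpace.Completion.continuous_coe _).comp ?_
  induction z using TensorProduct.induction_on with
  | zero => simpa using continuous_const
  | tmul a b =>
    simp only [TensorProduct.mapIsometry_apply, TensorProduct.map_tmul]
    refine continuous_iff_continuousAt.2 fun x => tendsto_iff_norm_sub_tendsto_zero.2 ?_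
    have h1 := tendsto_iff_norm_sub_tendsto_zero.1 ((hA a).tendsto x)
    have h2 := tendsto_iff_norm_sub_tendsto_zero.1 ((hB b).tendsto x)
    have h3 := (h1.mul_const ‖b‖).add (h2.const_mul ‖a‖)
    rw [zero_mul, mul_zero, add_zero] at h3
    refine squeeze_zero (fun _ => norm_nonneg _) (fun y => ?_) h3
    change ‖A y a ⊗ₜ[ℂ] B y b - A x a ⊗ₜ[ℂ] B x b‖ ≤ _
    have e : A y a ⊗ₜ[ℂ] B y b - A x a ⊗ₜ[ℂ] B x b
        = (A y a - A x a) ⊗ₜ[ℂ] B y b + A x a ⊗ₜ[ℂ] (B y b - B x b) := by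
      rw [TensorProduct.sub_tmul, TensorProduct.tmul_sub]
      abel
    rw [e]
    refine (norm_add_le _ _).trans (le_of_eq ?_)
    rw [TensorProduct.norm_tmul, TensorProduct.norm_tmul, (B y).norm_map, (A x).norm_map]
  | add a b ha hb => simpa only [map_add] using! ha.add hb

end Tensor

/-! ### The quadratic forms of the oscillator -/

namespace OQHO

variable {n d : ℕ} (S : OQHO n d)

theorem initCoeff_smul (s r : ℝ) (u : Fin n → ℝ) :
    S.initCoeff s (r • u) = r • S.initCoeff s u := by
  rw [initCoeff, initCoeff, Matrix.mulVec_smul]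

/-- The test function `noiseFun S s u` at time `s - x`, as a function of the lag `x`. -/
def lagFun (u : Fin n → ℝ) (x : ℝ) : EuclideanSpace ℂ (Fin d) :=
  WithLp.toLp 2 fun k => (S.B.transpose.mulVec (S.initCoeff x u) (Sum.inl k) : ℂ)
    + Complex.I * (S.B.transpose.mulVec (S.initCoeff x u) (Sum.inr k) : ℂ)

theorem noiseFun_eq (s : ℝ) (u : Fin n → ℝ) :
    S.noiseFun s u = (Set.Icc 0 s).indicator fun r => S.lagFun u (s - r) := rfl

theorem continuous_lagFun (u : Fin n → ℝ) : Continuous (S.lagFun u) := by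
  have h1 : Continuous fun x => S.B.transpose.mulVec (S.initCoeff x u) :=
    continuous_const.matrix_mulVec (S.continuous_initCoeff u)
  unfold lagFun
  fun_prop

theorem lagFun_smul (r : ℝ) (u : Fin n → ℝ) (x : ℝ) :
    S.lagFun (r • u) x = (r : ℂ) • S.lagFun u x := by
  ext k
  simp only [lagFun, initCoeff_smul, Matrix.mulVec_smul, Pi.smul_apply, smul_eq_mul,
    Complex.ofReal_mul, PiLp.smul_apply]
  ring

theorem noiseFun_smul (s r : ℝ) (u : Fin n → ℝ) :
    S.noiseFun s (r • u) = (r : ℂ) • S.noiseFun s u := by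
  simp only [noiseFun_eq, lagFun_smul]
  exact Set.indicator_const_smul _ _ _

theorem measurable_noiseFun (s : ℝ) (u : Fin n → ℝ) : Measurable (S.noiseFun s u) := by
  rw [noiseFun_eq]
  exact ((S.continuous_lagFun u).comp (continuous_sub_left s)).measurable.indicator
    measurableSet_Icc

/-- The test functions depend continuously on time in `L²`, by dominated convergence. -/
theorem continuous_toLp_noiseFun (u : Fin n → ℝ) (t : ℝ) :
    Continuous fun s => (S.memLp_noiseFun s u t).toLp := by
  refine continuous_iff_continuousAt.2 fun s => ?_
  rw [ContinuousAt, Lp.tendsto_Lp_iff_tendsto_eLpNorm'' _ fun s => S.memLp_noiseFun s u t]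
  obtain ⟨C, hC⟩ := (isCompact_Icc (a := s - 1 - t) (b := s + 1)).exists_bound_of_continuousOn
    (S.continuous_lagFun u).continuousOn
  have hb : ∀ s' ∈ Set.Icc (s - 1) (s + 1), ∀ r ∈ Set.Icc 0 t, ‖S.noiseFun s' u r‖ ≤ |C| := by
    intro s' hs' r hr
    rw [noiseFun_eq]
    refine (norm_indicator_le_norm_self _ _).trans ((hC _ ?_).trans (le_abs_self C))
    constructor <;> linarith [hs'.1, hs'.2, hr.1, hr.2]
  have hlim : Filter.Tendsto (fun s' => ∫⁻ r in Set.Icc 0 t,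
      ‖S.noiseFun s' u r - S.noiseFun s u r‖ₑ ^ 2) (nhds s) (nhds (∫⁻ _ in Set.Icc 0 t, 0)) := by
    refine tendsto_lintegral_filter_of_dominated_convergence
      (fun _ => ENNReal.ofReal ((2 * |C|) ^ 2)) (Filter.Eventually.of_forall fun s' => ?_) ?_ ?_ ?_
    · exact ((S.measurable_noiseFun s' u).sub (S.measurable_noiseFun s u)).enorm.pow_const 2
    · filter_upwards [Icc_mem_nhds (show s - 1 < s by linarith) (show s < s + 1 by linarith)]
        with s' hs'
      refine (ae_restrict_iff' measurableSet_Icc).2 (Filter.Eventually.of_forall fun r hr => ?_)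
      rw [← ofReal_norm, ← ENNReal.ofReal_pow (norm_nonneg _)]
      refine ENNReal.ofReal_le_ofReal (pow_le_pow_left₀ (norm_nonneg _) ?_ 2)
      have h1 := hb s' hs' r hr
      have h2 := hb s (by constructor <;> linarith) r hr
      linarith [norm_sub_le (S.noiseFun s' u r) (S.noiseFun s u r)]
    · rw [setLIntegral_const]
      exact ENNReal.mul_ne_top ENNReal.ofReal_ne_top (by simp [Real.volume_Icc])
    · refine ae_restrict_of_ae ?_
      filter_upwards [Measure.ae_ne volume s] with r hr
      have h1 : Filter.Tendsto (fun s' => S.noiseFun s' u r) (nhds s)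
          (nhds (S.noiseFun s u r)) := by
        have hc : Filter.Tendsto (fun s' => S.lagFun u (s' - r)) (nhds s)
            (nhds (S.lagFun u (s - r))) :=
          ((S.continuous_lagFun u).comp (continuous_sub_right r)).tendsto s
        simp only [noiseFun_eq, Set.indicator_apply, Set.mem_Icc]
        rcases lt_or_gt_of_ne hr with h | h
        · by_cases h0 : 0 ≤ r
          · rw [if_pos ⟨h0, h.le⟩]
            refine hc.congr' ?_
            filter_upwards [lt_mem_nhds h] with s' hs'
            rw [if_pos ⟨h0, hs'.le⟩]
          · simp [h0]
        · rw [if_neg fun hh => absurd hh.2 (not_le.2 h)]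
          refine tendsto_const_nhds.congr' ?_
          filter_upwards [gt_mem_nhds h] with s' hs'
          rw [if_neg fun hh => absurd hh.2 (not_le.2 hs')]
      have h2 := (ENNReal.continuous_pow 2).tendsto _ |>.comp
        (h1.sub_const (S.noiseFun s u r)).enorm
      simpa [Function.comp_def] using h2
  rw [lintegral_zero] at hlim
  have h3 := (ENNReal.continuous_rpow_const (y := 2⁻¹)).tendsto 0 |>.comp hlim
  rw [ENNReal.zero_rpow_of_pos (by norm_num)] at h3
  refine h3.congr fun s' => ?_
  rw [eLpNorm_eq_lintegral_rpow_enorm_toReal (by norm_num) (by norm_num)]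
  simp

end OQHO

theorem WeylSystem.W_zero_apply {n : ℕ} {Θ : Matrix (Fin n) (Fin n) ℝ} {H₀ : Type*}
    [NormedAddCommGroup H₀] [InnerProductSpace ℂ H₀] (X₀ : WeylSystem Θ H₀) (x : H₀) :
    X₀.W 0 x = x := by
  have h := X₀.ccr 0 0 x
  simp only [zero_dotProduct, Complex.ofReal_zero, mul_zero, Complex.exp_zero, one_smul,
    add_zero] at h
  exact (X₀.W 0).injective h

theorem WeylSystem.W_smul_W_smul_apply {n : ℕ} {Θ : Matrix (Fin n) (Fin n) ℝ} {H₀ : Type*}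
    [NormedAddCommGroup H₀] [InnerProductSpace ℂ H₀] (X₀ : WeylSystem Θ H₀)
    (hΘ : Θ.transpose = -Θ) (r r' : ℝ) (u : Fin n → ℝ) (x : H₀) :
    X₀.W (r • u) (X₀.W (r' • u) x) = X₀.W ((r + r') • u) x := by
  have h : u ⬝ᵥ Θ.mulVec u = 0 := by
    have h1 : u ⬝ᵥ Θ.mulVec u = -(u ⬝ᵥ Θ.mulVec u) := by
      conv_lhs => rw [Matrix.dotProduct_mulVec, ← Matrix.mulVec_transpose, hΘ, Matrix.neg_mulVec,
        neg_dotProduct, dotProduct_comm]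
    linarith
  rw [X₀.ccr, Matrix.mulVec_smul, smul_dotProduct, dotProduct_smul, h, ← add_smul]
  simp

section Dynamics

variable {n d : ℕ} {S : OQHO n d} {H₀ : Type*} [NormedAddCommGroup H₀] [InnerProductSpace ℂ H₀]
  [CompleteSpace H₀] (X₀ : WeylSystem S.Θ H₀)

theorem isUnitaryGroup_tensorIsometry {H K : Type*} [NormedAddCommGroup H] [InnerProductSpace ℂ H]
    [NormedAddCommGroup K] [InnerProductSpace ℂ K] {W : ℝ → H ≃ₗᵢ[ℂ] H} (h0 : ∀ x, W 0 x = x)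
    (hadd : ∀ r r' x, W r (W r' x) = W (r + r') x) (hW : ∀ x, Continuous fun r => W r x) (g : K) :
    IsUnitaryGroup fun r : ℝ => tensorIsometry (W r).toLinearIsometry (fockWeyl ((r : ℂ) • g)) where
  zero_apply v := by
    have : tensorIsometry (W 0).toLinearIsometry (fockWeyl (((0 : ℝ) : ℂ) • g))
        = ContinuousLinearMap.id ℂ _ := tensor_ext fun x y => by
      rw [tensorIsometry_coe, TensorProduct.mapIsometry_apply, TensorProduct.map_tmul]
      simp [fockWeyl_zero_apply, h0]
    rw [this, ContinuousLinearMap.id_apply]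
  add_apply r r' v := by
    rw [← ContinuousLinearMap.comp_apply]
    refine DFunLike.congr_fun (tensor_ext fun x y => ?_) v
    rw [ContinuousLinearMap.comp_apply]
    simp only [tensorIsometry_coe, TensorProduct.mapIsometry_apply, TensorProduct.map_tmul]
    simp only [LinearIsometry.coe_toLinearMap, LinearIsometryEquiv.coe_toLinearIsometry]
    rw [hadd, fockWeyl_fockWeyl_apply, ← add_smul, Complex.ofReal_add]
    simp only [inner_smul_left, inner_smul_right, Complex.conj_ofReal]
    ring
  norm_apply r v := norm_tensorIsometry_apply _ _ v
  continuous v := continuous_tensorIsometry_apply hW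
    (fun y => (continuous_fockWeyl_apply y).comp (by fun_prop)) v

theorem I_smul_toLp_of_eq_smul {α F : Type*} [MeasurableSpace α] {μ : Measure α}
    [NormedAddCommGroup F] [InnerProductSpace ℂ F] {f g : α → F} (hf : MemLp f 2 μ)
    (hg : MemLp g 2 μ) {c : ℂ} (h : g = c • f) :
    Complex.I • hg.toLp = c • (Complex.I • hf.toLp) := by
  subst h
  rw [smul_comm c]
  exact congrArg _ (MemLp.toLp_const_smul c hf)

theorem toLp_noiseFun_smul (S : OQHO n d) (t s r : ℝ) (u : Fin n → ℝ) :
    Complex.I • (S.memLp_noiseFun s (r • u) t).toLp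
      = (r : ℂ) • (Complex.I • (S.memLp_noiseFun s u t).toLp) :=
  I_smul_toLp_of_eq_smul (S.memLp_noiseFun s u t) (S.memLp_noiseFun s (r • u) t)
    (S.noiseFun_smul s r u)

theorem weylAt_eq {t s : ℝ} {u c : Fin n → ℝ} {g : NoiseSpace d t} (hc : S.initCoeff s u = c)
    (hg : Complex.I • (S.memLp_noiseFun s u t).toLp = g) :
    weylAt X₀ t s u = tensorIsometry (X₀.W c).toLinearIsometry (fockWeyl g) := by
  subst hg hc
  unfold weylAt tensorIsometry
  rfl

theorem weylAt_smul (t s r : ℝ) (u : Fin n → ℝ) :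
    weylAt X₀ t s (r • u) = tensorIsometry (X₀.W (r • S.initCoeff s u)).toLinearIsometry
      (fockWeyl ((r : ℂ) • (Complex.I • (S.memLp_noiseFun s u t).toLp))) :=
  weylAt_eq X₀ (S.initCoeff_smul s r u) (toLp_noiseFun_smul S t s r u)

theorem isUnitaryGroup_weylAt (t s : ℝ) (u : Fin n → ℝ) :
    IsUnitaryGroup fun r => weylAt X₀ t s (r • u) := by
  simp only [weylAt_smul]
  refine isUnitaryGroup_tensorIsometry (W := fun r => X₀.W (r • S.initCoeff s u)) (fun x => ?_)
    (fun r r' x => X₀.W_smul_W_smul_apply S.antisymm r r' _ x)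
    (fun x => (X₀.continuous x).comp (continuous_id.smul continuous_const)) _
  rw [zero_smul, X₀.W_zero_apply]

theorem continuous_weylAt_apply (t : ℝ) (u : Fin n → ℝ) (v : SysField H₀ d t) :
    Continuous fun s => weylAt X₀ t s u v := by
  refine continuous_tensorIsometry_apply (fun x => ?_) (fun y => ?_) v
  · exact (X₀.continuous x).comp (S.continuous_initCoeff u)
  · exact (continuous_fockWeyl_apply y).comp ((S.continuous_toLp_noiseFun u t).fun_const_smul _)

theorem sysVar_eq_generator (t s : ℝ) (u : Fin n → ℝ) (v : SysField H₀ d t) :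
    sysVar X₀ t s u v = generator (fun r => weylAt X₀ t s (r • u)) v := by
  rw [sysVar, generator]

variable (Q : Matrix (Fin n) (Fin n) ℝ)

theorem psiForm_eq_sum (t s : ℝ) (v : SysField H₀ d t) :
    psiForm X₀ Q t s v = ∑ k, generatorForm (fun r => weylAt X₀ t s (r • CFC.sqrt Q k)) v := by
  refine Finset.sum_congr rfl fun k _ => ?_
  have hU := isUnitaryGroup_weylAt X₀ t s (CFC.sqrt Q k)
  by_cases h : generatorForm (fun r => weylAt X₀ t s (r • CFC.sqrt Q k)) v = ⊤
  · rw [h, if_neg]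
    intro hd
    exact absurd h (by rw [hU.generatorForm_of_hasDerivAt hd.hasDerivAt]; simp)
  · rw [if_pos, sysVar_eq_generator, hU.generatorForm_eq_enorm h]
    exact (hU.hasDerivAt_generator h).differentiableAt

/-- The closed form of `φ(t)`. -/
def phiClosedForm (t : ℝ) : ClosedForm (SysField H₀ d t) :=
  integralClosedForm (μ := volume.restrict (Set.Icc 0 t))
    (U := fun s k r => weylAt X₀ t s (r • CFC.sqrt Q k))
    (fun s k => isUnitaryGroup_weylAt X₀ t s (CFC.sqrt Q k))
    (fun k r => continuous_weylAt_apply X₀ t (r • CFC.sqrt Q k))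

theorem phiClosedForm_form (t : ℝ) : (phiClosedForm X₀ Q t).form = phiForm X₀ Q t :=
  funext fun v => lintegral_congr fun s => (psiForm_eq_sum X₀ Q t s v).symm

theorem phiClosedForm_bil (t : ℝ) (u v : SysField H₀ d t) :
    (phiClosedForm X₀ Q t).bil u v = ∫ s in Set.Icc 0 t, ∑ k,
      inner ℂ (sysVar X₀ t s (CFC.sqrt Q k) u) (sysVar X₀ t s (CFC.sqrt Q k) v) := by
  simp only [sysVar_eq_generator]
  rfl

end Dynamics

/-! ### The nominal state and the variational bound -/

section Conj

variable {H H' : Type*} [NormedAddCommGroup H] [InnerProductSpace ℂ H] [CompleteSpace H]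
  [NormedAddCommGroup H'] [InnerProductSpace ℂ H'] [CompleteSpace H']

/-- An isometry transports density operators to density operators. -/
theorem IsDensity.conj_isometry {ρ : H →L[ℂ] H} (hρ : IsDensity ρ) {V : H →L[ℂ] H'}
    (hV : ∀ x, ‖V x‖ = ‖x‖) : IsDensity (V ∘L ρ ∘L V.adjoint) := by
  have hpos := hρ.1.conj_adjoint V
  refine ⟨hpos, ?_⟩
  have h1 : ∀ v, ‖CFC.sqrt (V ∘L ρ ∘L V.adjoint) v‖ₑ ^ 2
      = ‖(CFC.sqrt ρ ∘L V.adjoint) v‖ₑ ^ 2 := by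
    intro v
    rw [enorm_sq_sqrt_apply hpos, ContinuousLinearMap.comp_apply (CFC.sqrt ρ),
      enorm_sq_sqrt_apply hρ.1, ContinuousLinearMap.adjoint_inner_left]
    rfl
  have hsa : (CFC.sqrt ρ).adjoint = CFC.sqrt ρ :=
    ((ContinuousLinearMap.nonneg_iff_isPositive _).1 (CFC.sqrt_nonneg ρ)).isSelfAdjoint.adjoint_eq
  rw [mean, ← hρ.2, mean]
  simp only [h1]
  rw [tsum_enorm_sq_adjoint (basis H') (basis H), ContinuousLinearMap.adjoint_comp, hsa,
    ContinuousLinearMap.adjoint_adjoint]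
  refine tsum_congr fun j => ?_
  rw [ContinuousLinearMap.comp_apply, ← ofReal_norm, ← ofReal_norm, hV]

/-- Fatou's lemma for mean values. -/
theorem mean_le_of_le_liminf {ρ : H →L[ℂ] H} {q : H → ℝ≥0∞} {f : ℕ → H → ℝ≥0∞} {c : ℝ≥0∞}
    (hq : ∀ v, q v ≤ Filter.liminf (fun n => f n v) Filter.atTop) (hf : ∀ n, mean ρ (f n) ≤ c) :
    mean ρ q ≤ c := by
  let : MeasurableSpace (basisIndex H) := ⊤
  calc mean ρ q ≤ ∑' i, Filter.liminf (fun n => f n (CFC.sqrt ρ (basis H i))) Filter.atTop :=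
        ENNReal.tsum_le_tsum fun i => hq _
    _ = ∫⁻ i, Filter.liminf (fun n => f n (CFC.sqrt ρ (basis H i))) Filter.atTop
          ∂Measure.count := (lintegral_count _).symm
    _ ≤ Filter.liminf (fun n => ∫⁻ i, f n (CFC.sqrt ρ (basis H i)) ∂Measure.count)
          Filter.atTop := lintegral_liminf_le fun n => measurable_from_top
    _ = Filter.liminf (fun n => mean ρ (f n)) Filter.atTop := by simp only [lintegral_count, mean]
    _ ≤ Filter.liminf (fun _ : ℕ => c) Filter.atTop :=
        Filter.liminf_le_liminf (Filter.Eventually.of_forall hf)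
    _ = c := Filter.liminf_const c

/-- The variational bound for a closed form `q`: if `F` dominates the exponentials of the Yosida
approximations of `θ q`, then `θ Tr (ρ q) ≤ D(ρ‖σ) + ln Tr (σ F)`. -/
theorem ClosedForm.mean_form_le (q : ClosedForm H) {ρ σ : H →L[ℂ] H} (hρ : IsDensity ρ)
    (hσ : IsDensity σ) {θ D Z : ℝ} (hθ : 0 < θ) (hZ0 : 0 < Z)
    (hD : relEntropy ρ σ ≤ ENNReal.ofReal D) (hD0 : 0 ≤ D) {F : H → ℝ≥0∞}
    (hF : ∀ {ε : ℝ} {R : H →L[ℂ] H}, q.IsResolvent ε R → 0 < ε → ∀ v, ENNReal.ofReal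
      (inner ℂ v (NormedSpace.exp ((θ : ℂ) • ClosedForm.yosida ε R) v)).re ≤ F v)
    (hZ : mean σ F ≤ ENNReal.ofReal Z) :
    mean ρ q.form ≤ ENNReal.ofReal ((D + Real.log Z) / θ) := by
  have hε : ∀ n : ℕ, 0 < 1 / ((n : ℝ) + 1) := fun n => by positivity
  choose R hR using fun n => q.exists_isResolvent (hε n)
  refine mean_le_of_le_liminf
    (ClosedForm.IsResolvent.form_le_liminf hR hε tendsto_one_div_add_atTop_nhds_zero_nat)
    fun n => ?_
  have hpos := (hR n).yosida_isPositive (hε n)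
  have hpos' : ((θ : ℂ) • ClosedForm.yosida (1 / ((n : ℝ) + 1)) (R n)).IsPositive :=
    hpos.smul_of_nonneg (Complex.zero_le_real.2 hθ.le)
  have h := mean_le_relEntropy_add_log hρ hσ hpos'
    (ne_top_of_le_ne_top ENNReal.ofReal_ne_top hD) hZ0
    ((ENNReal.tsum_le_tsum fun i => hF (hR n) (hε n) _).trans hZ)
  have e : ∀ v, ENNReal.ofReal
      (inner ℂ v (((θ : ℂ) • ClosedForm.yosida (1 / ((n : ℝ) + 1)) (R n)) v)).re
      = ENNReal.ofReal θ * ENNReal.ofReal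
        (inner ℂ v (ClosedForm.yosida (1 / ((n : ℝ) + 1)) (R n) v)).re := by
    intro v
    rw [← ENNReal.ofReal_mul hθ.le, smul_apply, inner_smul_right,
      Complex.re_ofReal_mul]
  simp only [mean, e, ENNReal.tsum_mul_left] at h
  rw [ENNReal.ofReal_div_of_pos hθ, ENNReal.le_div_iff_mul_le (by simp [hθ]) (by simp), mul_comm]
  refine h.trans (ENNReal.ofReal_le_ofReal (add_le_add_left ?_ _))
  exact ENNReal.toReal_le_of_le_ofReal hD0 hD

end Conj

section Dynamics

variable {n d : ℕ} {S : OQHO n d} {H₀ : Type*} [NormedAddCommGroup H₀] [InnerProductSpace ℂ H₀]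
  [CompleteSpace H₀] (X₀ : WeylSystem S.Θ H₀)

theorem norm_expVec_zero {K : Type*} [NormedAddCommGroup K] [InnerProductSpace ℂ K] :
    ‖expVec (0 : K)‖ = 1 := by
  have h := inner_self_eq_ofReal (expVec (0 : K))
  rw [inner_expVec, inner_zero_left, Complex.exp_zero] at h
  have h2 : ‖expVec (0 : K)‖ ^ 2 = 1 := by exact_mod_cast h.symm
  exact (pow_eq_one_iff_of_nonneg (norm_nonneg _) two_ne_zero).1 h2

theorem norm_vacEmb_apply (t : ℝ) (x : H₀) : ‖vacEmb H₀ d t x‖ = ‖x‖ := by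
  have h : vacEmb H₀ d t x = ((x ⊗ₜ[ℂ] expVec 0 : H₀ ⊗[ℂ] Fock (NoiseSpace d t)) :
      SysField H₀ d t) := rfl
  rw [h, UniformSpace.Completion.norm_coe, TensorProduct.norm_tmul, norm_expVec_zero, mul_one]

theorem isDensity_nominal (d : ℕ) {ρ₀ : H₀ →L[ℂ] H₀} (hρ₀ : IsDensity ρ₀) (t : ℝ) :
    IsDensity (nominal d ρ₀ t) :=
  hρ₀.conj_isometry (norm_vacEmb_apply t)

variable (Q : Matrix (Fin n) (Fin n) ℝ)

theorem enorm_sq_le_expForm (θ t : ℝ) (v : SysField H₀ d t) :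
    ‖v‖ₑ ^ 2 ≤ expForm X₀ Q θ t v := by
  refine le_iInf₂ fun x hx => ?_
  refine le_trans ?_ (ENNReal.le_tsum 0)
  rw [← hx.1]
  simp

theorem one_le_nominalQEF {ρ₀ : H₀ →L[ℂ] H₀} (hρ₀ : IsDensity ρ₀) (θ t : ℝ) :
    1 ≤ nominalQEF X₀ Q ρ₀ θ t := by
  rw [← (isDensity_nominal d hρ₀ t).2]
  exact ENNReal.tsum_le_tsum fun i => enorm_sq_le_expForm X₀ Q θ t _

theorem quadCost_le {ρ₀ : H₀ →L[ℂ] H₀} (hρ₀ : IsDensity ρ₀) {ε θ t : ℝ} (hε : 0 ≤ ε) (hθ : 0 < θ)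
    (ht : 0 ≤ t) (hfin : nominalQEF X₀ Q ρ₀ θ t ≠ ⊤) {ρ : SysField H₀ d t →L[ℂ] SysField H₀ d t}
    (hρ : ρ ∈ uncertaintyClass d ρ₀ ε t) :
    quadCost X₀ Q t ρ
      ≤ ENNReal.ofReal ((ε * t + Real.log (nominalQEF X₀ Q ρ₀ θ t).toReal) / θ) := by
  rw [quadCost, ← phiClosedForm_form X₀ Q t]
  have h1 := one_le_nominalQEF X₀ Q hρ₀ θ t
  refine (phiClosedForm X₀ Q t).mean_form_le hρ.1 (isDensity_nominal d hρ₀ t) hθ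
    (ENNReal.toReal_pos (zero_lt_one.trans_le h1).ne' hfin) hρ.2 (mul_nonneg hε ht)
    (F := expForm X₀ Q θ t) ?_ (ENNReal.ofReal_toReal hfin).ge
  intro δ R hR hδ v
  refine le_iInf₂ fun x hx => ?_
  rw [← hx.1, ← phiClosedForm_form X₀ Q t]
  refine hR.re_inner_exp_yosida_le hδ hθ.le fun k => ?_
  have h2 := hx.2 k
  simp only [IsPhi, ← phiClosedForm_form X₀ Q t, ← phiClosedForm_bil X₀ Q t] at h2
  exact h2

/-- The bound for a fixed time horizon, normalized by its length. -/
theorem iSup_quadCost_div_le {ρ₀ : H₀ →L[ℂ] H₀} (hρ₀ : IsDensity ρ₀) {ε θ t : ℝ} (hε : 0 ≤ ε)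
    (hθ : 0 < θ) (ht : 0 < t) :
    ((⨆ ρ ∈ uncertaintyClass d ρ₀ ε t, quadCost X₀ Q t ρ : ℝ≥0∞) : EReal) / (t : EReal)
      ≤ ((θ⁻¹ : ℝ) : EReal)
        * ((ε : EReal) + ENNReal.log (nominalQEF X₀ Q ρ₀ θ t) / (t : EReal)) := by
  have h1 := one_le_nominalQEF X₀ Q hρ₀ θ t
  by_cases hfin : nominalQEF X₀ Q ρ₀ θ t = ⊤
  · rw [hfin, ENNReal.log_top, EReal.top_div_of_pos_ne_top (EReal.coe_pos.2 ht)
      (EReal.coe_ne_top t), EReal.coe_add_top, EReal.coe_mul_top_of_pos (inv_pos.2 hθ)]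
    exact le_top
  have hZ1 : 1 ≤ (nominalQEF X₀ Q ρ₀ θ t).toReal := by
    simpa using ENNReal.toReal_mono hfin h1
  have hS : (⨆ ρ ∈ uncertaintyClass d ρ₀ ε t, quadCost X₀ Q t ρ)
      ≤ ENNReal.ofReal ((ε * t + Real.log (nominalQEF X₀ Q ρ₀ θ t).toReal) / θ) :=
    iSup₂_le fun ρ hρ => quadCost_le X₀ Q hρ₀ hε hθ ht.le hfin hρ
  have hL := Real.log_nonneg hZ1
  rw [ENNReal.log_pos_real (zero_lt_one.trans_le h1).ne' hfin]
  refine (EReal.monotone_div_right_of_nonneg (EReal.coe_nonneg.2 ht.le)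
    (EReal.coe_ennreal_le_coe_ennreal_iff.2 hS)).trans (le_of_eq ?_)
  rw [EReal.coe_ennreal_ofReal, max_eq_left (by positivity)]
  simp only [← EReal.coe_div, ← EReal.coe_add, ← EReal.coe_mul]
  congr 1
  field_simp

end Dynamics

end QuantumOscillator

end

theorem theorem4 {n d : ℕ} (S : QuantumOscillator.OQHO n d)
    (Q : Matrix (Fin n) (Fin n) ℝ) (hQ : Q.PosSemidef)
    {H₀ : Type*} [NormedAddCommGroup H₀] [InnerProductSpace ℂ H₀] [CompleteSpace H₀]
    [TopologicalSpace.SeparableSpace H₀]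
    (X₀ : QuantumOscillator.WeylSystem S.Θ H₀)
    (ρ₀ : H₀ →L[ℂ] H₀) (hρ₀ : QuantumOscillator.IsDensity ρ₀)
    (ε : ℝ) (hε : 0 ≤ ε) :
    Filter.limsup (fun t : ℝ =>
        ((⨆ ρ ∈ QuantumOscillator.uncertaintyClass d ρ₀ ε t,
          QuantumOscillator.quadCost X₀ Q t ρ : ℝ≥0∞) : EReal) / (t : EReal)) Filter.atTop
      ≤ ⨅ (θ : ℝ) (_ : 0 < θ),
        ((ε : EReal) + QuantumOscillator.qefRate X₀ Q ρ₀ θ) / (θ : EReal) := by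
  refine le_iInf₂ fun θ hθ => ?_
  set f : ℝ → EReal := fun t =>
    ENNReal.log (QuantumOscillator.nominalQEF X₀ Q ρ₀ θ t) / (t : EReal) with hf
  have hf0 : ∀ᶠ t in Filter.atTop, 0 ≤ f t := by
    filter_upwards [Filter.eventually_gt_atTop 0] with t ht
    refine EReal.div_nonneg ?_ (EReal.coe_nonneg.2 ht.le)
    rw [← ENNReal.log_one]
    exact ENNReal.log_monotone (QuantumOscillator.one_le_nominalQEF X₀ Q hρ₀ θ t)
  have hadd : Filter.limsup (fun t => (ε : EReal) + f t) Filter.atTop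
      ≤ (ε : EReal) + QuantumOscillator.qefRate X₀ Q ρ₀ θ := by
    have h := EReal.limsup_add_le (f := Filter.atTop) (u := fun _ : ℝ => (ε : EReal)) (v := f)
      (by simp) (by simp)
    rwa [Filter.limsup_const] at h
  have hθ' : (0 : EReal) ≤ ((θ⁻¹ : ℝ) : EReal) := EReal.coe_nonneg.2 (inv_pos.2 hθ).le
  have hmul := EReal.limsup_mul_le (f := Filter.atTop) (u := fun _ : ℝ => ((θ⁻¹ : ℝ) : EReal))
    (v := fun t => (ε : EReal) + f t) (Filter.Frequently.of_forall fun _ => hθ')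
    (by
      filter_upwards [hf0] with t ht
      exact add_nonneg (EReal.coe_nonneg.2 hε) ht)
    (by simp [hθ.ne']) (by simp)
  rw [Filter.limsup_const] at hmul
  rw [EReal.div_eq_inv_mul, ← EReal.coe_inv]
  refine le_trans ?_ (hmul.trans (mul_le_mul_of_nonneg_left hadd hθ'))
  refine Filter.limsup_le_limsup ?_
  filter_upwards [Filter.eventually_gt_atTop 0] with t ht
  exact QuantumOscillator.iSup_quadCost_div_le X₀ Q hρ₀ hε hθ ht
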